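/- Let $\mathbb K$ be a field of characteristic $0$, $q$ an indeterminate, $n\ge 2$, and let $U_q=U_q(\mathfrak{sl}_{n+1})$ be the quantised enveloping algebra over $\mathbb K(q)$ with generators $E_i,F_i,K_i^{\pm1}$ ($i\in I=\{1,\dots,n\}$), simple roots $\alpha_i$, Cartan matrix $(a_{ij})$ and $(\alpha_i,\alpha_j)=a_{ij}$. Let $T_i=T''_{i,1}$ be Lusztig's automorphisms, so $T_i(E_i)=-F_iK_i$, $T_i(F_i)=-K_i^{-1}E_i$, $T_i(K_j)=K_jK_i^{-a_{ij}}$, $T_i(E_j)=E_iE_j-q^{-1}E_jE_i$ and $T_i(F_j)=F_jF_i-qF_iF_j$ if $|i-j|=1$, and $T_i(E_j)=E_j$, $T_i(F_j)=F_j$ if $|i-j|\ge2$. Write $\overline{\phantom{x}}$ for the bar involution of $U_q$ (the $\mathbb K$-algebra automorphism with $q\mapsto q^{-1}$, $E_i\mapsto E_i$, $F_i\mapsto F_i$, $K_i\mapsto K_i^{-1}$), and $U^+=\bigoplus_{\mu\in Q^+}U^+_\mu$ for the subalgebra generated by the $E_i$ with its weight grading. Consider the Satake diagram of type $AIV$: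 $X=\{2,\dots,n-1\}$ and $\tau(i)=n+1-i$. Let $w_X$ be the longest element of the parabolic subgroup $W_X$ of the Weyl group, $T_{w_X}$ the product of the $T_i$ along a reduced expression of $w_X$, $\Theta=-w_X\circ\tau$ on the root lattice $Q$, and $2\rho_X$ (resp. $2\rho_X^\vee$) the sum of the positive roots (resp. coroots) of the subsystem generated by $X$. Let $s:I\to\mathbb K^\times$ satisfy $s(i)=1$ if $i\in X$ or $\tau(i)=i$, and $s(i)/s(\tau(i))=(-1)^{\alpha_i(2\rho_X^\vee)}$ otherwise. Let $c_1,c_n\in\mathbb K(q)^\times$ satisfy $c_i=c_{\tau(i)}$ whenever $(\alpha_i,\Theta(\alpha_i))=0$, and $c_{\tau(i)}=q^{(\alpha_i,\Theta(\alpha_i)-2\rho_X)}\,\overline{c_i}$, for $i\in\{1,n\}$. Let $B$ be the $\mathbb K(q)$-subalgebra of $U_q$ generated by $E_i,F_i,K_i^{\pm1}$ ($i\in X$), by $K_\lambda$ ($\lambda\in Q$, $\Theta(\lambda)=\lambda$) and by $$B_i=F_i-c_i\,s(\tau(i))\,T_{w_X}(E_{\tau(i)})K_i^{-1}\qquad(i\in\{1,n\}).$$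 A *quasi $K$-matrix* for $B$ is an element $\mathfrak X=\sum_{\mu\in Q^+}\mathfrak X_\mu$ of $\prod_{\mu\in Q^+}U^+_\mu$ with $\mathfrak X_0=1$ such that there is a ring automorphism $\psi$ of $B$ (the bar involution of $B$) which agrees with $\overline{\phantom{x}}$ on the subalgebra generated by the $E_i,F_i,K_i^{\pm1}$ ($i\in X$) and the $K_\lambda$ ($\Theta(\lambda)=\lambda$), satisfies $\psi(B_i)=B_i$ for $i\in\{1,n\}$, and $$\psi(b)\,\mathfrak X=\mathfrak X\,\overline b\qquad\text{for all }b\in B,$$ as operators on every finite dimensional $U_q$-module of type $1$. Then there is exactly one quasi $K$-matrix for $B$, and it is $$\mathfrak X=\Bigl(\sum_{k\ge0}\frac{(c_1s(n))^k}{\{k\}!}\,T_1T_{w_X}(E_n)^k\Bigr)\Bigl(\sum_{k\ge0}\frac{(c_ns(1))^k}{\{k\}!}\,T_nT_{w_X}(E_1)^k\Bigr),$$ where $\{k\}!=\prod_{j=1}^k\{j\}$ and $\{j\}=1+q^2+\dots+q^{2(j-1)}$. -/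

import Mathlib

set_option linter.unusedSimpArgs false
set_option linter.unnecessarySeqFocus false

universe u

namespace QSP

section SerreIdentities

variable {𝔽 A : Type*} [Field 𝔽] [Ring A] [Algebra 𝔽 A]

/-- The `q`-commutator `[x, y]_a = x y - a y x`. -/
def qcomm (a : 𝔽) (x y : A) : A := x * y - a • (y * x)

/-- The quantum Serre relation `x² y - (q + q⁻¹) x y x + y x² = 0`. -/
def Serre (q : 𝔽) (x y : A) : Prop :=
  x * x * y - (q + q⁻¹) • (x * y * x) + y * x * x = 0

variable {q : 𝔽} {a b c : A}

theorem Serre.smul (h : Serre q a b) (r t : 𝔽) : Serre q (r • a) (t • b) := by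
  unfold Serre at *
  linear_combination (norm := (
    simp only [mul_sub, sub_mul, mul_add, add_mul, smul_mul_assoc, mul_smul_comm, mul_assoc,
      smul_sub, smul_add, smul_smul, smul_zero, mul_zero, zero_mul]
    match_scalars <;> ring))
    (r * r * t) • h

/-- `a x = q x a` for `x = [a, b]_{q⁻¹}`. -/
theorem Serre.left (hq : q ≠ 0) (h : Serre q a b) :
    a * qcomm q⁻¹ a b = q • (qcomm q⁻¹ a b * a) := by
  unfold Serre at h; unfold qcomm
  linear_combination (norm := (
    simp only [mul_sub, sub_mul, mul_add, add_mul, smul_mul_assoc, mul_smul_comm, mul_assoc,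
      smul_sub, smul_add, smul_smul, smul_zero, mul_zero, zero_mul]
    match_scalars <;> field_simp <;> ring)) h

/-- `x b = q b x` for `x = [a, b]_{q⁻¹}`. -/
theorem Serre.right (hq : q ≠ 0) (h : Serre q b a) :
    qcomm q⁻¹ a b * b = q • (b * qcomm q⁻¹ a b) := by
  unfold Serre at h; unfold qcomm
  linear_combination (norm := (
    simp only [mul_sub, sub_mul, mul_add, add_mul, smul_mul_assoc, mul_smul_comm, mul_assoc,
      smul_sub, smul_add, smul_smul, smul_zero, mul_zero, zero_mul]
    match_scalars <;> field_simp <;> ring)) h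

/-- The Serre relation for `x, y` follows if `z = [x, y]_{q⁻¹}` satisfies `x z = q z x`. -/
theorem serre_of_left (hq : q ≠ 0)
    (h : a * qcomm q⁻¹ a b = q • (qcomm q⁻¹ a b * a)) : Serre q a b := by
  unfold Serre; unfold qcomm at h
  linear_combination (norm := (
    simp only [mul_sub, sub_mul, mul_add, add_mul, smul_mul_assoc, mul_smul_comm, mul_assoc,
      smul_sub, smul_add, smul_smul, smul_zero, mul_zero, zero_mul]
    match_scalars <;> field_simp <;> ring)) h

theorem serre_of_right (hq : q ≠ 0)
    (h : qcomm q⁻¹ a b * b = q • (b * qcomm q⁻¹ a b)) : Serre q b a := by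
  unfold Serre; unfold qcomm at h
  linear_combination (norm := (
    simp only [mul_sub, sub_mul, mul_add, add_mul, smul_mul_assoc, mul_smul_comm, mul_assoc,
      smul_sub, smul_add, smul_smul, smul_zero, mul_zero, zero_mul]
    match_scalars <;> field_simp <;> ring)) h

/-- If `b` and `c` commute and are both joined to `a`, then `[a, b]` and `[a, c]` commute. -/
theorem qcomm_commute (hq : q ≠ 0) (hq2 : q ^ 2 + 1 ≠ 0) (hab : Serre q a b) (hac : Serre q a c)
    (hbc : b * c = c * b) : qcomm q⁻¹ a b * qcomm q⁻¹ a c = qcomm q⁻¹ a c * qcomm q⁻¹ a b := by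
  unfold Serre at *; unfold qcomm
  linear_combination (norm := (
    simp only [mul_sub, sub_mul, mul_add, add_mul, smul_mul_assoc, mul_smul_comm, mul_assoc,
      smul_sub, smul_add, smul_smul, smul_zero, mul_zero, zero_mul]
    match_scalars <;> field_simp <;> ring))
    (-(q / (q ^ 2 + 1))) • (hab * c) + (q / (q ^ 2 + 1)) • (hac * b)
      - (q⁻¹ / (q ^ 2 + 1)) • (b * hac) + (q⁻¹ / (q ^ 2 + 1)) • (c * hab)
      + (q / (q ^ 2 + 1)) • (a * a * hbc) - q⁻¹ • (a * hbc * a)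
      + (q⁻¹ / (q ^ 2 + 1)) • (hbc * a * a)

theorem assoc_comm {x y : A} (h : x * y = y * x) (z : A) : x * (y * z) = y * (x * z) := by
  rw [← mul_assoc, h, mul_assoc]

/-- In a chain `a - b - c`, the element `b` commutes with `[[a, b], c]`. -/
theorem middle_commute (hq : q ≠ 0) (hq2 : q ^ 2 + 1 ≠ 0) (hba : Serre q b a) (hbc : Serre q b c)
    (hac : a * c = c * a) :
    b * qcomm q⁻¹ (qcomm q⁻¹ a b) c = qcomm q⁻¹ (qcomm q⁻¹ a b) c * b := by
  have hca := fun x => assoc_comm hac.symm x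
  unfold Serre at *; unfold qcomm
  linear_combination (norm := (
    simp only [mul_sub, sub_mul, mul_add, add_mul, smul_mul_assoc, mul_smul_comm, mul_assoc,
      smul_sub, smul_add, smul_smul, smul_zero, mul_zero, zero_mul, ← hac, hca]
    match_scalars <;> field_simp <;> ring))
    (-(q / (q ^ 2 + 1))) • (hba * c) - (q⁻¹ / (q ^ 2 + 1)) • (hbc * a)
     + (q / (q ^ 2 + 1)) • (a * hbc) + (q⁻¹ / (q ^ 2 + 1)) • (c * hba)

/-- In a chain `a - b - c`, the pair `[a, b], c` satisfies the Serre relation. -/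
theorem serre_chain (hq : q ≠ 0) (hq2 : q ^ 2 + 1 ≠ 0) (hab : Serre q a b) (hba : Serre q b a)
    (hbc : Serre q b c) (hac : a * c = c * a) : Serre q (qcomm q⁻¹ a b) c := by
  apply serre_of_left hq
  have h1 := middle_commute hq hq2 hba hbc hac
  have h2 : qcomm q⁻¹ (qcomm q⁻¹ a b) c * a = q⁻¹ • (a * qcomm q⁻¹ (qcomm q⁻¹ a b) c) := by
    have h := hab.left hq
    generalize qcomm q⁻¹ a b = x at h
    have hca := fun x => assoc_comm hac.symm x
    unfold qcomm
    linear_combination (norm := (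
      simp only [mul_sub, sub_mul, mul_add, add_mul, smul_mul_assoc, mul_smul_comm, mul_assoc,
        smul_sub, smul_add, smul_smul, smul_zero, mul_zero, zero_mul, ← hac, hca]
      match_scalars <;> field_simp <;> ring))
      (-q⁻¹) • (h * c) + (q⁻¹ * q⁻¹) • (c * h)
  generalize qcomm q⁻¹ (qcomm q⁻¹ a b) c = z at *
  unfold qcomm
  linear_combination (norm := (
    simp only [mul_sub, sub_mul, mul_add, add_mul, smul_mul_assoc, mul_smul_comm, mul_assoc,
      smul_sub, smul_add, smul_smul, smul_zero, mul_zero, zero_mul]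
    match_scalars <;> field_simp <;> ring))
    a * h1 - q • (h2 * b) + b * h2 - h1 * a

/-- The easy half of the previous relation. -/
theorem serre_chain' (hq : q ≠ 0) (hcb : Serre q c b) (hac : a * c = c * a) :
    Serre q c (qcomm q⁻¹ a b) := by
  have hca := fun x => assoc_comm hac.symm x
  unfold Serre at *; unfold qcomm
  linear_combination (norm := (
    simp only [mul_sub, sub_mul, mul_add, add_mul, smul_mul_assoc, mul_smul_comm, mul_assoc,
      smul_sub, smul_add, smul_smul, smul_zero, mul_zero, zero_mul, ← hac, hca]
    match_scalars <;> field_simp <;> ring))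
    a * hcb - q⁻¹ • (hcb * a)

theorem qcomm_comm {u x y : A} {r : 𝔽} (hx : u * x = x * u) (hy : u * y = y * u) :
    u * qcomm r x y = qcomm r x y * u := by
  have : Commute u (qcomm r x y) := by
    unfold qcomm
    exact (Commute.mul_right hx hy).sub_right ((Commute.mul_right hy hx).smul_right r)
  exact this

/-- `W K u m` says that `K u = q^m u K`. -/
def W (q : 𝔽) (K u : A) (m : ℤ) : Prop := K * u = q ^ m • (u * K)

theorem W.mul {K u v : A} {m m' : ℤ} (hq : q ≠ 0) (h : W q K u m) (h' : W q K v m') :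
    W q K (u * v) (m + m') := by
  unfold W at *
  rw [← mul_assoc, h, smul_mul_assoc, mul_assoc, h', mul_smul_comm, smul_smul, zpow_add₀ hq,
    mul_assoc]

theorem W.sub {K u v : A} {m : ℤ} (h : W q K u m) (h' : W q K v m) : W q K (u - v) m := by
  unfold W at *
  rw [mul_sub, h, h', sub_mul, smul_sub]

theorem W.smul {K u : A} {m : ℤ} (h : W q K u m) (r : 𝔽) : W q K (r • u) m := by
  unfold W at *
  rw [mul_smul_comm, h, smul_mul_assoc, smul_comm]

theorem W.neg {K u : A} {m : ℤ} (h : W q K u m) : W q K (-u) m := by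
  unfold W at *
  rw [mul_neg, h, neg_mul, smul_neg]

theorem W.mulK {K K' u : A} {m m' : ℤ} (hq : q ≠ 0) (h : W q K u m) (h' : W q K' u m') :
    W q (K * K') u (m + m') := by
  unfold W at *
  rw [mul_assoc, h', mul_smul_comm, ← mul_assoc, h, smul_mul_assoc, smul_smul, mul_assoc,
    zpow_add₀ hq, mul_comm]

theorem W.inv {K L u : A} {m : ℤ} (hq : q ≠ 0) (h : W q K u m) (h1 : K * L = 1)
    (h2 : L * K = 1) : W q L u (-m) := by
  unfold W at *
  have : u * L = q ^ m • (L * u) := by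
    calc u * L = L * (K * u) * L := by rw [← mul_assoc, h2, one_mul]
      _ = q ^ m • (L * u * (K * L)) := by rw [h]; simp [mul_assoc]
      _ = _ := by rw [h1, mul_one]
  rw [this, smul_smul, ← zpow_add₀ hq]; simp

theorem W.of_eq {K u : A} {m m' : ℤ} (h : W q K u m) (e : m = m') : W q K u m' := e ▸ h

theorem W.comm {K u : A} (h : K * u = u * K) : W q K u 0 := by
  unfold W; simpa using h

end SerreIdentities

/-- The defining relations of `U_q(sl_{n+1})` (all roots have `(α, α) = 2`, so `q_i = q`), for
elements `E i, F i, K i, L i = (K i)⁻¹` of an algebra. -/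
structure QuantumRelations {𝔽 A : Type*} [Field 𝔽] [Ring A] [Algebra 𝔽 A] (q : 𝔽) {n : ℕ}
    (E F K L : Fin n → A) : Prop where
  KL : ∀ i, K i * L i = 1
  LK : ∀ i, L i * K i = 1
  KK : ∀ i j, K i * K j = K j * K i
  KE : ∀ i j, K i * E j = q ^ (CartanMatrix.A n i j) • (E j * K i)
  KF : ∀ i j, K i * F j = q ^ (-CartanMatrix.A n i j) • (F j * K i)
  EF : ∀ i j, E i * F j - F j * E i = if i = j then (q - q⁻¹)⁻¹ • (K i - L i) else 0
  EE : ∀ i j, CartanMatrix.A n i j = 0 → E i * E j = E j * E i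
  FF : ∀ i j, CartanMatrix.A n i j = 0 → F i * F j = F j * F i
  serreE : ∀ i j, CartanMatrix.A n i j = -1 →
    E i * E i * E j - (q + q⁻¹) • (E i * E j * E i) + E j * E i * E i = 0
  serreF : ∀ i j, CartanMatrix.A n i j = -1 →
    F i * F i * F j - (q + q⁻¹) • (F i * F j * F i) + F j * F i * F i = 0

section Lusztig

variable {𝔽 A : Type*} [Field 𝔽] [Ring A] [Algebra 𝔽 A] {n : ℕ}

/-- Images of the generators under Lusztig's automorphism `T_i = T''_{i,1}`. -/
def lusE (q : 𝔽) (E F K : Fin n → A) (i j : Fin n) : A :=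
  if j = i then -(F i * K i)
  else if CartanMatrix.A n i j = -1 then E i * E j - q⁻¹ • (E j * E i) else E j

def lusF (q : 𝔽) (E F L : Fin n → A) (i j : Fin n) : A :=
  if j = i then -(L i * E i)
  else if CartanMatrix.A n i j = -1 then F j * F i - q • (F i * F j) else F j

def lusK (K L : Fin n → A) (i j : Fin n) : A :=
  if j = i then L i else if CartanMatrix.A n i j = -1 then K j * K i else K j

theorem cartan_cases (i j : Fin n) :
    (j = i ∧ CartanMatrix.A n i j = 2 ∧ CartanMatrix.A n j i = 2) ∨
    (j ≠ i ∧ CartanMatrix.A n i j = -1 ∧ CartanMatrix.A n j i = -1) ∨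
    (j ≠ i ∧ CartanMatrix.A n i j = 0 ∧ CartanMatrix.A n j i = 0) := by
  simp only [CartanMatrix.A, Matrix.of_apply, Fin.ext_iff]
  split_ifs <;> simp <;> omega

theorem cartan_self (i : Fin n) : CartanMatrix.A n i i = 2 := by simp [CartanMatrix.A]

theorem cartan_symm (i j : Fin n) : CartanMatrix.A n i j = CartanMatrix.A n j i := by
  rcases cartan_cases i j with h | h | h <;> omega

theorem cartan_no_triangle {i j k : Fin n} (h1 : CartanMatrix.A n i j = -1)
    (h2 : CartanMatrix.A n i k = -1) (h3 : CartanMatrix.A n j k = -1) : False := by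
  simp only [CartanMatrix.A, Matrix.of_apply, Fin.ext_iff] at h1 h2 h3
  split_ifs at h1 h2 h3 <;> omega

variable {q : 𝔽} {E F K L : Fin n → A}

theorem lusE_cases (E F K : Fin n → A) (i j : Fin n) :
    (j = i ∧ CartanMatrix.A n i j = 2 ∧ lusE q E F K i j = -(F i * K i)) ∨
    (j ≠ i ∧ CartanMatrix.A n i j = -1 ∧ lusE q E F K i j = qcomm q⁻¹ (E i) (E j)) ∨
    (j ≠ i ∧ CartanMatrix.A n i j = 0 ∧ lusE q E F K i j = E j) := by
  rcases cartan_cases i j with h | h | h <;> simp [lusE, qcomm, h, cartan_self]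

theorem lusF_cases (hq : q ≠ 0) (E F L : Fin n → A) (i j : Fin n) :
    (j = i ∧ CartanMatrix.A n i j = 2 ∧ lusF q E F L i j = -(L i * E i)) ∨
    (j ≠ i ∧ CartanMatrix.A n i j = -1 ∧ lusF q E F L i j = (-q) • qcomm q⁻¹ (F i) (F j)) ∨
    (j ≠ i ∧ CartanMatrix.A n i j = 0 ∧ lusF q E F L i j = F j) := by
  rcases cartan_cases i j with h | h | h <;> simp [lusF, qcomm, h, smul_sub, smul_smul, hq, cartan_self, sub_eq_add_neg, add_comm]

theorem lusK_cases (K L : Fin n → A) (i j : Fin n) :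
    (j = i ∧ CartanMatrix.A n i j = 2 ∧ lusK K L i j = L i ∧ lusK L K i j = K i) ∨
    (j ≠ i ∧ CartanMatrix.A n i j = -1 ∧ lusK K L i j = K j * K i ∧ lusK L K i j = L j * L i) ∨
    (j ≠ i ∧ CartanMatrix.A n i j = 0 ∧ lusK K L i j = K j ∧ lusK L K i j = L j) := by
  rcases cartan_cases i j with h | h | h <;> simp [lusK, h, cartan_self]

namespace QuantumRelations

theorem wE (h : QuantumRelations q E F K L) (i j : Fin n) :
    W q (K i) (E j) (CartanMatrix.A n i j) := h.KE i j

theorem wF (h : QuantumRelations q E F K L) (i j : Fin n) :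
    W q (K i) (F j) (-CartanMatrix.A n i j) := h.KF i j

theorem swap (hq : q ≠ 0) (h : QuantumRelations q E F K L) : QuantumRelations q F E L K where
  KL := h.LK
  LK := h.KL
  KK := fun i j => by
    calc L i * L j = L i * L j * (K i * K j * (L j * L i)) := by
            rw [mul_assoc (K i), ← mul_assoc (K j), h.KL, one_mul, h.KL, mul_one]
      _ = L i * (L j * K j) * K i * (L j * L i) := by rw [h.KK]; simp only [mul_assoc]
      _ = L j * L i := by rw [h.LK, mul_one, h.LK, one_mul]
  KE := fun i j => by
    have := (h.wF i j).inv hq (h.KL i) (h.LK i)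
    unfold W at this; simpa using this
  KF := fun i j => (h.wE i j).inv hq (h.KL i) (h.LK i)
  EF := fun i j => by
    have := h.EF j i
    rw [← neg_sub, this]
    by_cases e : i = j
    · subst e; simp [← smul_neg]
    · simp [e, Ne.symm e]
  EE := h.FF
  FF := h.EE
  serreE := h.serreF
  serreF := h.serreE

theorem w_lusE (hq : q ≠ 0) (h : QuantumRelations q E F K L) (i k l : Fin n) :
    W q (K l) (lusE q E F K i k)
      (CartanMatrix.A n l k - CartanMatrix.A n i k * CartanMatrix.A n l i) := by
  rcases lusE_cases (q := q) E F K i k with ⟨rfl, h2, h3⟩ | ⟨h1, h2, h3⟩ | ⟨h1, h2, h3⟩ <;> rw [h3, h2]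
  · refine (((h.wF l k).mul hq (W.comm (h.KK l k))).neg).of_eq ?_
    ring
  · refine W.of_eq (m := CartanMatrix.A n l i + CartanMatrix.A n l k)
      (((h.wE l i).mul hq (h.wE l k)).sub (W.smul ?_ _)) (by ring)
    exact ((h.wE l k).mul hq (h.wE l i)).of_eq (by ring)
  · exact (h.wE l k).of_eq (by ring)

theorem w_lus (hq : q ≠ 0) (h : QuantumRelations q E F K L) (i j k : Fin n) :
    W q (lusK K L i j) (lusE q E F K i k) (CartanMatrix.A n j k) := by
  have w := h.w_lusE hq i k
  have hs := cartan_symm i j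
  have hii := cartan_self i
  rcases lusK_cases K L i j with ⟨rfl, h2, h3, -⟩ | ⟨h1, h2, h3, -⟩ | ⟨h1, h2, h3, -⟩ <;> rw [h3]
  · refine ((w j).inv hq (h.KL j) (h.LK j)).of_eq ?_
    rw [hii]; ring
  · refine ((w j).mulK hq (w i)).of_eq ?_
    rw [hii, ← hs, h2]; ring
  · refine (w j).of_eq ?_
    rw [← hs, h2]; ring

theorem lusF_eq (hq : q ≠ 0) (h : QuantumRelations q E F K L) (i j : Fin n) :
    ∃ t : 𝔽, lusF q E F L i j = t • lusE q F E L i j := by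
  rcases lusF_cases hq E F L i j with ⟨h1, h2, h3⟩ | ⟨h1, h2, h3⟩ | ⟨h1, h2, h3⟩ <;> rw [h3]
  · subst h1
    refine ⟨q ^ (-2 : ℤ), ?_⟩
    have := (h.wE j j).inv hq (h.KL j) (h.LK j)
    unfold W at this
    rw [this, h2]; simp [lusE]
  · exact ⟨-q, by simp [lusE, h1, h2, qcomm]⟩
  · exact ⟨1, by simp [lusE, h1, h2]⟩

/-- `[x, F i] = -E j (K i)⁻¹` for `x = [E i, E j]` and `i, j` joined. -/
theorem qcomm_F (hq : q ≠ 0) (hq1 : q ^ 2 - 1 ≠ 0) (h : QuantumRelations q E F K L) {i j : Fin n}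
    (hne : j ≠ i) (ha : CartanMatrix.A n i j = -1) :
    qcomm q⁻¹ (E i) (E j) * F i - F i * qcomm q⁻¹ (E i) (E j) = -(E j * L i) := by
  have e1 := h.EF i i
  have e2 := h.EF j i
  have e3 := h.KE i j
  have e4 := (h.wE i j).inv hq (h.KL i) (h.LK i)
  unfold W at e4
  simp only [if_true, hne, if_false, ha, neg_neg, zpow_one, zpow_neg] at e1 e2 e3 e4
  have hh : q - q⁻¹ ≠ 0 := by
    intro h0; apply hq1; field_simp at h0; linear_combination h0
  have hd : (q - q⁻¹)⁻¹ = q / (q ^ 2 - 1) := by field_simp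
  rw [hd] at e1
  unfold qcomm
  linear_combination (norm := (
      simp only [mul_sub, sub_mul, mul_add, add_mul, smul_mul_assoc, mul_smul_comm, mul_assoc,
        smul_sub, smul_add, smul_smul, smul_zero, mul_zero, zero_mul, mul_neg, neg_mul, neg_neg,
        smul_neg]
      match_scalars <;> field_simp <;> ring))
    e1 * E j + E i * e2 - q⁻¹ • (E j * e1) - q⁻¹ • (e2 * E i)
      + (q / (q ^ 2 - 1)) • (e3 - e4)

/-- `[x, F j] = q⁻¹ E i K j` for `x = [E i, E j]` and `i, j` joined. -/
theorem qcomm_F' (hq : q ≠ 0) (hq1 : q ^ 2 - 1 ≠ 0) (h : QuantumRelations q E F K L) {i j : Fin n}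
    (hne : j ≠ i) (ha : CartanMatrix.A n i j = -1) :
    qcomm q⁻¹ (E i) (E j) * F j - F j * qcomm q⁻¹ (E i) (E j) = q⁻¹ • (E i * K j) := by
  have e1 := h.EF j j
  have e2 := h.EF i j
  have e3 := h.KE j i
  have e4 := (h.wE j i).inv hq (h.KL j) (h.LK j)
  unfold W at e4
  rw [← cartan_symm, ha] at e3 e4
  simp only [if_true, hne.symm, if_false, neg_neg, zpow_one, zpow_neg] at e1 e2 e3 e4
  have hh : q - q⁻¹ ≠ 0 := by
    intro h0; apply hq1; field_simp at h0; linear_combination h0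
  have hd : (q - q⁻¹)⁻¹ = q / (q ^ 2 - 1) := by field_simp
  rw [hd] at e1
  unfold qcomm
  linear_combination (norm := (
      simp only [mul_sub, sub_mul, mul_add, add_mul, smul_mul_assoc, mul_smul_comm, mul_assoc,
        smul_sub, smul_add, smul_smul, smul_zero, mul_zero, zero_mul, mul_neg, neg_mul, neg_neg,
        smul_neg]
      match_scalars <;> field_simp <;> ring))
    E i * e1 + e2 * E j - q⁻¹ • (e1 * E i) - q⁻¹ • (E j * e2)
      - (q⁻¹ * (q / (q ^ 2 - 1))) • (e3 - e4)

/-- `[x, X]_{q⁻¹} = E j` for `x = [E i, E j]` and `X = -F i K i`. -/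
theorem qcomm_X (hq : q ≠ 0) (hq1 : q ^ 2 - 1 ≠ 0) (h : QuantumRelations q E F K L) {i j : Fin n}
    (hne : j ≠ i) (ha : CartanMatrix.A n i j = -1) :
    qcomm q⁻¹ (qcomm q⁻¹ (E i) (E j)) (-(F i * K i)) = E j := by
  have h1 := h.qcomm_F hq hq1 hne ha
  have h2 := (h.w_lusE hq i j i)
  have h3 : lusE q E F K i j = qcomm q⁻¹ (E i) (E j) := by simp [lusE, hne, ha, qcomm]
  rw [h3, cartan_self, ha] at h2
  unfold W at h2
  norm_num at h2
  generalize qcomm q⁻¹ (E i) (E j) = x at *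
  have h4 := h.LK i
  unfold qcomm
  rw [← sub_eq_zero]
  linear_combination (norm := (
    simp only [mul_sub, sub_mul, mul_add, add_mul, smul_mul_assoc, mul_smul_comm, mul_assoc,
      smul_sub, smul_add, smul_smul, smul_zero, mul_zero, zero_mul, mul_neg, neg_mul, neg_neg,
      smul_neg, mul_one]
    match_scalars <;> field_simp <;> ring))
    -(h1 * K i) + E j * h4 + q⁻¹ • (F i * h2)

theorem E_X (h : QuantumRelations q E F K L) {i j : Fin n} (hne : j ≠ i) :
    -(F i * K i) * E j = q ^ (CartanMatrix.A n i j) • (E j * -(F i * K i)) := by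
  have h1 := h.EF j i
  rw [if_neg hne, sub_eq_zero] at h1
  rw [neg_mul, mul_assoc, h.KE, mul_smul_comm, ← mul_assoc, ← h1, mul_neg, smul_neg, mul_assoc]

theorem serre (h : QuantumRelations q E F K L) {i j : Fin n} (ha : CartanMatrix.A n i j = -1) :
    Serre q (E i) (E j) := h.serreE i j ha

theorem lus_EE (hq : q ≠ 0) (hq2 : q ^ 2 + 1 ≠ 0) (h : QuantumRelations q E F K L)
    (i j k : Fin n) (hjk : CartanMatrix.A n j k = 0) :
    lusE q E F K i j * lusE q E F K i k = lusE q E F K i k * lusE q E F K i j := by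
  have hs := cartan_symm i j
  have hkj := (cartan_symm k j).trans hjk
  have hs' := cartan_symm i k
  rcases lusE_cases (q := q) E F K i j with ⟨h1, h2, h3⟩ | ⟨h1, h2, h3⟩ | ⟨h1, h2, h3⟩ <;>
  rcases lusE_cases (q := q) E F K i k with ⟨g1, g2, g3⟩ | ⟨g1, g2, g3⟩ | ⟨g1, g2, g3⟩ <;>
  rw [h3, g3]
  · subst h1; omega
  · subst h1; simpa [g2] using h.E_X g1
  · subst g1; omega
  · exact qcomm_commute hq hq2 (h.serre h2) (h.serre g2) (h.EE j k hjk)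
  · exact (qcomm_comm (h.EE k i (hs'.symm.trans g2)) (h.EE k j hkj)).symm
  · subst g1; simpa [h2] using (h.E_X h1).symm
  · exact qcomm_comm (h.EE j i (hs.symm.trans h2)) (h.EE j k hjk)
  · exact h.EE j k hjk

theorem lus_serre (hq : q ≠ 0) (hq1 : q ^ 2 - 1 ≠ 0) (hq2 : q ^ 2 + 1 ≠ 0)
    (h : QuantumRelations q E F K L) (i j k : Fin n) (hjk : CartanMatrix.A n j k = -1) :
    Serre q (lusE q E F K i j) (lusE q E F K i k) := by
  have hs := cartan_symm i j
  have hkj := (cartan_symm k j).trans hjk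
  have hs' := cartan_symm i k
  rcases lusE_cases (q := q) E F K i j with ⟨h1, h2, h3⟩ | ⟨h1, h2, h3⟩ | ⟨h1, h2, h3⟩ <;>
  rcases lusE_cases (q := q) E F K i k with ⟨g1, g2, g3⟩ | ⟨g1, g2, g3⟩ | ⟨g1, g2, g3⟩ <;>
  rw [h3, g3]
  · subst h1; subst g1; omega
  · apply serre_of_right hq
    rw [h.qcomm_X hq hq1 g1 g2, h.E_X g1, g2, smul_smul]
    simp [hq]
  · subst h1; omega
  · apply serre_of_left hq
    rw [h.qcomm_X hq hq1 h1 h2]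
    exact (h.serre (hs ▸ h2)).right hq
  · exact (cartan_no_triangle h2 g2 hjk).elim
  · exact serre_chain hq hq2 (h.serre h2) (h.serre (hs ▸ h2)) (h.serre hjk) (h.EE i k g2)
  · subst g1; omega
  · exact serre_chain' hq (h.serre hjk) (h.EE i j h2)
  · exact h.serre hjk

theorem lus_EF_ne (hq : q ≠ 0) (hq1 : q ^ 2 - 1 ≠ 0) (h : QuantumRelations q E F K L)
    (i j k : Fin n) (hjk : j ≠ k) :
    lusE q E F K i j * lusF q E F L i k = lusF q E F L i k * lusE q E F K i j := by
  have hEF : ∀ {a b}, a ≠ b → E a * F b = F b * E a := fun {a b} hab => by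
    have := h.EF a b
    rwa [if_neg hab, sub_eq_zero] at this
  have hsw := h.swap hq
  rcases lusE_cases (q := q) E F K i j with ⟨h1, h2, h3⟩ | ⟨h1, h2, h3⟩ | ⟨h1, h2, h3⟩ <;>
  rcases lusF_cases hq E F L i k with ⟨g1, g2, g3⟩ | ⟨g1, g2, g3⟩ | ⟨g1, g2, g3⟩ <;>
  rw [h3, g3]
  · exact (hjk (h1.trans g1.symm)).elim
  · rw [mul_smul_comm, smul_mul_assoc]
    congr 1
    have e1 : F i * qcomm q⁻¹ (F i) (F k) = q • (qcomm q⁻¹ (F i) (F k) * F i) :=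
      (hsw.serre g2).left hq
    have e2 := (hsw.w_lusE hq i k i).inv hq (hsw.KL i) (hsw.LK i)
    have e3 : lusE q F E L i k = qcomm q⁻¹ (F i) (F k) := by simp [lusE, g1, g2, qcomm]
    rw [e3, cartan_self, g2] at e2
    unfold W at e2
    norm_num at e2
    rw [neg_mul, mul_assoc, e2, mul_smul_comm, ← mul_assoc, e1, smul_mul_assoc, smul_smul,
      inv_mul_cancel₀ hq, one_smul, mul_assoc, mul_neg]
  · have := (h.wF i k)
    rw [g2] at this
    unfold W at this
    simp only [neg_zero, zpow_zero, one_smul] at this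
    rw [neg_mul, mul_neg, mul_assoc, this, ← mul_assoc, h.FF i k g2, mul_assoc]
  · have e1 : E i * qcomm q⁻¹ (E i) (E j) = q • (qcomm q⁻¹ (E i) (E j) * E i) :=
      (h.serre h2).left hq
    have e2 := (h.w_lusE hq i j i).inv hq (h.KL i) (h.LK i)
    have e3 : lusE q E F K i j = qcomm q⁻¹ (E i) (E j) := by simp [lusE, h1, h2, qcomm]
    rw [e3, cartan_self, h2] at e2
    unfold W at e2
    norm_num at e2
    rw [neg_mul, mul_assoc, e1, mul_smul_comm, ← mul_assoc, e2, smul_mul_assoc, smul_smul,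
      mul_inv_cancel₀ hq, one_smul, mul_assoc, mul_neg]
  · rw [mul_smul_comm, smul_mul_assoc]
    congr 1
    have c : qcomm q⁻¹ (E i) (E j) * F k = F k * qcomm q⁻¹ (E i) (E j) :=
      (qcomm_comm (hEF g1.symm).symm (hEF hjk).symm).symm
    have c' := fun z => assoc_comm c z
    have e := h.qcomm_F hq hq1 h1 h2
    have e1 := (h.wF i k).inv hq (h.KL i) (h.LK i)
    rw [g2] at e1
    unfold W at e1
    norm_num at e1
    have e2 := hEF hjk
    generalize qcomm q⁻¹ (E i) (E j) = x at *
    unfold qcomm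
    linear_combination (norm := (
      simp only [mul_sub, sub_mul, mul_add, add_mul, smul_mul_assoc, mul_smul_comm, mul_assoc,
        smul_sub, smul_add, smul_smul, smul_zero, mul_zero, zero_mul, mul_neg, neg_mul, neg_neg,
        smul_neg, c, c']
      match_scalars <;> field_simp <;> ring))
      e * F k - q⁻¹ • (F k * e) - E j * e1 - q⁻¹ • (e2 * L i)
  · exact (qcomm_comm (hEF g1.symm).symm (hEF hjk).symm).symm
  · have := (h.wE i j).inv hq (h.KL i) (h.LK i)
    rw [h2] at this
    unfold W at this
    simp only [neg_zero, zpow_zero, one_smul] at this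
    rw [neg_mul, mul_neg, mul_assoc, h.EE i j h2, ← mul_assoc, ← mul_assoc, this]
  · rw [mul_smul_comm, smul_mul_assoc, qcomm_comm (hEF h1) (hEF hjk)]
  · exact hEF hjk

theorem lus_EF_eq (hq : q ≠ 0) (hq1 : q ^ 2 - 1 ≠ 0) (h : QuantumRelations q E F K L)
    (i j : Fin n) :
    lusE q E F K i j * lusF q E F L i j - lusF q E F L i j * lusE q E F K i j =
      (q - q⁻¹)⁻¹ • (lusK K L i j - lusK L K i j) := by
  by_cases h1 : j = i
  · subst h1
    have e := h.EF j j
    rw [if_pos rfl] at e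
    have e1 : L j * (E j * F j) = E j * F j * L j := by
      have := (((h.wE j j).inv hq (h.KL j) (h.LK j)).mul hq
        ((h.wF j j).inv hq (h.KL j) (h.LK j))).of_eq (m' := 0) (by ring)
      unfold W at this
      simpa using this
    have e2 : L j * E j * (F j * K j) = E j * F j := by
      calc L j * E j * (F j * K j) = L j * (E j * F j) * K j := by simp only [mul_assoc]
        _ = E j * F j := by rw [e1, mul_assoc, h.LK, mul_one]
    have e3 : F j * K j * (L j * E j) = F j * E j := by
      rw [mul_assoc, ← mul_assoc (K j), h.KL, one_mul]
    simp only [lusE, lusF, lusK, if_true, neg_mul_neg, e2, e3]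
    rw [← neg_sub, e, ← smul_neg, neg_sub]
  · have e := h.EF j j
    rw [if_pos rfl] at e
    by_cases h2 : CartanMatrix.A n i j = -1
    · have e1 := h.qcomm_F hq hq1 h1 h2
      have e2 := h.qcomm_F' hq hq1 h1 h2
      have e3 : lusE q E F K i j = qcomm q⁻¹ (E i) (E j) := by simp [lusE, h1, h2, qcomm]
      have e4 := h.EF i i
      rw [if_pos rfl] at e4
      have k1 := h.KF j i
      have k2 := (h.wF i j).inv hq (h.KL i) (h.LK i)
      unfold W at k2
      rw [← cartan_symm, h2] at k1
      rw [h2] at k2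
      norm_num at k1 k2
      have kk := h.KK i j
      have ll := (h.swap hq).KK i j
      have hh : q - q⁻¹ ≠ 0 := by
        intro h0; apply hq1; field_simp at h0; linear_combination h0
      have hd : (q - q⁻¹)⁻¹ = q / (q ^ 2 - 1) := by field_simp
      rw [hd] at e e4 ⊢
      rw [e3]
      simp only [lusF, lusK, h1, h2, if_false, if_true]
      generalize qcomm q⁻¹ (E i) (E j) = x at *
      have kl : K j * L i = L i * K j := by
        calc K j * L i = L i * (K i * K j) * L i := by
              rw [← mul_assoc, h.LK, one_mul]
          _ = L i * K j := by rw [kk, mul_assoc, mul_assoc, h.KL, mul_one]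
      linear_combination (norm := (
        simp only [mul_sub, sub_mul, mul_add, add_mul, smul_mul_assoc, mul_smul_comm, mul_assoc,
          smul_sub, smul_add, smul_smul, smul_zero, mul_zero, zero_mul, mul_neg, neg_mul, neg_neg,
          smul_neg]
        match_scalars <;> field_simp <;> ring))
        e2 * F i + F j * e1 - q • (e1 * F j) - q • (F i * e2) + q⁻¹ • (E i * k1) + q • (E j * k2)
          + e4 * K j + e * L i + (q / (q ^ 2 - 1)) • kk + (q / (q ^ 2 - 1)) • kl
    · simpa [lusE, lusF, lusK, h1, h2] using e

theorem lus_KL (h : QuantumRelations q E F K L) (i j : Fin n) :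
    lusK K L i j * lusK L K i j = 1 := by
  rcases lusK_cases K L i j with ⟨-, -, h3, h4⟩ | ⟨-, -, h3, h4⟩ | ⟨-, -, h3, h4⟩ <;> rw [h3, h4]
  · exact h.LK i
  · rw [h.KK, mul_assoc, ← mul_assoc (K j), h.KL, one_mul, h.KL]
  · exact h.KL j

theorem lus_KK (hq : q ≠ 0) (h : QuantumRelations q E F K L) (i j k : Fin n) :
    Commute (lusK K L i j) (lusK K L i k) := by
  have c : ∀ a b, Commute (K a) (K b) := h.KK
  have l : ∀ a b, Commute (L a) (L b) := (h.swap hq).KK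
  have m : ∀ a b, Commute (K a) (L b) := fun a b => by
    calc K a * L b = L b * (K b * K a) * L b := by rw [← mul_assoc, h.LK, one_mul]
      _ = L b * K a := by rw [h.KK, mul_assoc, mul_assoc, h.KL, mul_one]
  rcases lusK_cases K L i j with ⟨-, -, h3, -⟩ | ⟨-, -, h3, -⟩ | ⟨-, -, h3, -⟩ <;>
  rcases lusK_cases K L i k with ⟨-, -, g3, -⟩ | ⟨-, -, g3, -⟩ | ⟨-, -, g3, -⟩ <;>
  rw [h3, g3]
  · exact ((m _ _).mul_left (m _ _)).symm
  · exact (m _ _).symm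
  · exact (m _ _).mul_left (m _ _)
  · exact ((c _ _).mul_left (c _ _)).mul_right ((c _ _).mul_left (c _ _))
  · exact (c _ _).mul_left (c _ _)
  · exact m _ _
  · exact (c _ _).mul_right (c _ _)
  · exact c _ _

/-- The images of the generators under `T_i` satisfy the defining relations. -/
theorem lusztig (hq : q ≠ 0) (hq1 : q ^ 2 - 1 ≠ 0) (hq2 : q ^ 2 + 1 ≠ 0)
    (h : QuantumRelations q E F K L) (i : Fin n) :
    QuantumRelations q (lusE q E F K i) (lusF q E F L i) (lusK K L i) (lusK L K i) where
  KL := h.lus_KL i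
  LK := (h.swap hq).lus_KL i
  KK := h.lus_KK hq i
  KE := h.w_lus hq i
  KF := fun j k => by
    obtain ⟨t, ht⟩ := h.lusF_eq hq i k
    rw [ht]
    exact (((h.swap hq).w_lus hq i j k).inv hq ((h.swap hq).lus_KL i j) (h.lus_KL i j)).smul t
  EF := fun j k => by
    by_cases e : j = k
    · subst e; rw [if_pos rfl]; exact h.lus_EF_eq hq hq1 i j
    · rw [if_neg e, h.lus_EF_ne hq hq1 i j k e, sub_self]
  EE := h.lus_EE hq hq2 i
  FF := fun j k hjk => by
    obtain ⟨t, ht⟩ := h.lusF_eq hq i j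
    obtain ⟨r, hr⟩ := h.lusF_eq hq i k
    rw [ht, hr, smul_mul_smul_comm, smul_mul_smul_comm, (h.swap hq).lus_EE hq hq2 i j k hjk,
      mul_comm]
  serreE := h.lus_serre hq hq1 hq2 i
  serreF := fun j k hjk => by
    obtain ⟨t, ht⟩ := h.lusF_eq hq i j
    obtain ⟨r, hr⟩ := h.lusF_eq hq i k
    rw [ht, hr]
    exact ((h.swap hq).lus_serre hq hq1 hq2 i j k hjk).smul t r

end QuantumRelations

end Lusztig
/-! ### The ground field `K(q)` -/

section Ground

variable (K : Type u) [Field K]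

/-- The indeterminate `q` of `K(q)`. -/
noncomputable def q : RatFunc K := RatFunc.X

theorem q_poly {p : Polynomial K} (hp : p.Monic) :
    algebraMap (Polynomial K) (RatFunc K) p ≠ 0 := by
  exact RatFunc.algebraMap_ne_zero hp.ne_zero

theorem q_ne : q K ≠ 0 := RatFunc.X_ne_zero

theorem q_sq_sub_one : q K ^ 2 - 1 ≠ 0 := by
  have := q_poly K (Polynomial.monic_X_pow_sub_C (1 : K) two_ne_zero)
  simpa [q] using this

theorem q_sq_add_one : q K ^ 2 + 1 ≠ 0 := by
  have := q_poly K (Polynomial.monic_X_pow_add_C (1 : K) two_ne_zero)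
  simpa [q] using this

theorem q_inv_injective :
    Function.Injective (Polynomial.aeval (R := K) (q K)⁻¹) := by
  rw [← transcendental_iff_injective]
  intro h
  exact RatFunc.transcendental_X (K := K) (IsAlgebraic.inv_iff.mp h)

/-- The bar involution of the ground field: the `K`-algebra map of `K(q)` with `q ↦ q⁻¹`. -/
noncomputable def barScalar : RatFunc K →ₐ[K] RatFunc K :=
  RatFunc.liftAlgHom (Polynomial.aeval (R := K) (q K)⁻¹) (by
    intro p hp
    have hp' : p ≠ 0 := nonZeroDivisors.ne_zero hp
    rw [Submonoid.mem_comap]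
    refine mem_nonZeroDivisors_of_ne_zero fun h0 => hp' ?_
    exact q_inv_injective K (by rw [map_zero]; exact h0))

theorem barScalar_q : barScalar K (q K) = (q K)⁻¹ := by
  have : barScalar K (algebraMap (Polynomial K) (RatFunc K) Polynomial.X) = (q K)⁻¹ := by
    unfold barScalar
    rw [RatFunc.liftAlgHom_apply]
    simp
  simpa [q] using this

end Ground

/-! ### The quantised enveloping algebra `U_q(sl_{n+1})` -/

section Uq

/-- Names of the generators; `L i` stands for the inverse of `K i`. -/
inductive Gen (n : ℕ) : Type
  | E (i : Fin n)
  | F (i : Fin n)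
  | K (i : Fin n)
  | L (i : Fin n)

variable (K : Type u) [Field K] (n : ℕ)

/-- A generator as an element of the free algebra. -/
noncomputable abbrev gen (K : Type u) [Field K] {n : ℕ} (x : Gen n) :
    FreeAlgebra (RatFunc K) (Gen n) :=
  FreeAlgebra.ι (RatFunc K) x

/-- The defining relations of `U_q(sl_{n+1})`. -/
inductive Rel : FreeAlgebra (RatFunc K) (Gen n) → FreeAlgebra (RatFunc K) (Gen n) → Prop
  | KL (i) : Rel (gen K (.K i) * gen K (.L i)) 1
  | LK (i) : Rel (gen K (.L i) * gen K (.K i)) 1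
  | KK (i j) : Rel (gen K (.K i) * gen K (.K j)) (gen K (.K j) * gen K (.K i))
  | KE (i j) : Rel (gen K (.K i) * gen K (.E j))
      (q K ^ (CartanMatrix.A n i j) • (gen K (.E j) * gen K (.K i)))
  | KF (i j) : Rel (gen K (.K i) * gen K (.F j))
      (q K ^ (-CartanMatrix.A n i j) • (gen K (.F j) * gen K (.K i)))
  | EF (i j) : Rel (gen K (.E i) * gen K (.F j) - gen K (.F j) * gen K (.E i))
      (if i = j then (q K - (q K)⁻¹)⁻¹ • (gen K (.K i) - gen K (.L i)) else 0)
  | EE (i j) (h : CartanMatrix.A n i j = 0) :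
      Rel (gen K (.E i) * gen K (.E j)) (gen K (.E j) * gen K (.E i))
  | FF (i j) (h : CartanMatrix.A n i j = 0) :
      Rel (gen K (.F i) * gen K (.F j)) (gen K (.F j) * gen K (.F i))
  | serreE (i j) (h : CartanMatrix.A n i j = -1) :
      Rel (gen K (.E i) * gen K (.E i) * gen K (.E j)
        - (q K + (q K)⁻¹) • (gen K (.E i) * gen K (.E j) * gen K (.E i))
        + gen K (.E j) * gen K (.E i) * gen K (.E i)) 0
  | serreF (i j) (h : CartanMatrix.A n i j = -1) :
      Rel (gen K (.F i) * gen K (.F i) * gen K (.F j)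
        - (q K + (q K)⁻¹) • (gen K (.F i) * gen K (.F j) * gen K (.F i))
        + gen K (.F j) * gen K (.F i) * gen K (.F i)) 0

/-- The algebra `U_q(sl_{n+1})` over `K(q)`. -/
def Uq : Type u := RingQuot (Rel K n)

noncomputable instance : Ring (Uq K n) := inferInstanceAs (Ring (RingQuot (Rel K n)))

noncomputable instance : Algebra (RatFunc K) (Uq K n) :=
  inferInstanceAs (Algebra (RatFunc K) (RingQuot (Rel K n)))

/-- The quotient map from the free algebra. -/
noncomputable def mkUq : FreeAlgebra (RatFunc K) (Gen n) →ₐ[RatFunc K] Uq K n :=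
  RingQuot.mkAlgHom (RatFunc K) (Rel K n)

variable {K n}

/-- The generators `E_i`, `F_i`, `K_i`, `K_i⁻¹` of `U_q(sl_{n+1})`. -/
noncomputable def E (i : Fin n) : Uq K n := mkUq K n (gen K (Gen.E i))
noncomputable def F (i : Fin n) : Uq K n := mkUq K n (gen K (Gen.F i))
noncomputable def Kg (i : Fin n) : Uq K n := mkUq K n (gen K (Gen.K i))
noncomputable def Ki (i : Fin n) : Uq K n := mkUq K n (gen K (Gen.L i))

theorem mkUq_rel {x y : FreeAlgebra (RatFunc K) (Gen n)} (h : Rel K n x y) :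
    mkUq K n x = mkUq K n y :=
  RingQuot.mkAlgHom_rel _ h

theorem Uq_relations : QuantumRelations (q K) (E (K := K) (n := n)) F Kg Ki where
  KL := fun i => by
    have := mkUq_rel (Rel.KL (K := K) i)
    simp only [map_mul, map_smul, map_one] at this
    exact this
  LK := fun i => by
    have := mkUq_rel (Rel.LK (K := K) i)
    simp only [map_mul, map_smul, map_one] at this
    exact this
  KK := fun i j => by
    have := mkUq_rel (Rel.KK (K := K) i j)
    simp only [map_mul, map_smul, map_one] at this
    exact this
  KE := fun i j => by
    have := mkUq_rel (Rel.KE (K := K) i j)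
    simp only [map_mul, map_smul, map_one] at this
    exact this
  KF := fun i j => by
    have := mkUq_rel (Rel.KF (K := K) i j)
    simp only [map_mul, map_smul, map_one] at this
    exact this
  EF := fun i j => by
    have := mkUq_rel (Rel.EF (K := K) i j)
    split_ifs with h
    · rw [if_pos h] at this
      simp only [map_mul, map_smul, map_sub] at this
      exact this
    · rw [if_neg h] at this
      simp only [map_mul, map_sub, map_zero] at this
      exact this
  EE := fun i j h => by
    have := mkUq_rel (Rel.EE (K := K) i j h)
    simp only [map_mul, map_smul, map_sub, map_add, map_zero] at this
    exact this
  FF := fun i j h => by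
    have := mkUq_rel (Rel.FF (K := K) i j h)
    simp only [map_mul, map_smul, map_sub, map_add, map_zero] at this
    exact this
  serreE := fun i j h => by
    have := mkUq_rel (Rel.serreE (K := K) i j h)
    simp only [map_mul, map_smul, map_sub, map_add, map_zero] at this
    exact this
  serreF := fun i j h => by
    have := mkUq_rel (Rel.serreF (K := K) i j h)
    simp only [map_mul, map_smul, map_sub, map_add, map_zero] at this
    exact this

section Lift

variable {A : Type*} [Ring A] [Algebra (RatFunc K) A] {e f k l : Fin n → A}

/-- Assignment of values to the generators. -/
def genMap (e f k l : Fin n → A) : Gen n → A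
  | .E i => e i
  | .F i => f i
  | .K i => k i
  | .L i => l i

/-- The universal property of `U_q(sl_{n+1})`. -/
noncomputable def liftUq (h : QuantumRelations (q K) e f k l) : Uq K n →ₐ[RatFunc K] A :=
  RingQuot.liftAlgHom (RatFunc K) ⟨FreeAlgebra.lift (RatFunc K) (genMap e f k l), by
    intro x y hxy
    induction hxy with
    | KL i => simpa [genMap] using h.KL i
    | LK i => simpa [genMap] using h.LK i
    | KK i j => simpa [genMap] using h.KK i j
    | KE i j => simpa [genMap] using h.KE i j
    | KF i j => simpa only [map_mul, map_smul, FreeAlgebra.lift_ι_apply, genMap] using h.KF i j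
    | EF i j =>
      have := h.EF i j
      split_ifs at this ⊢ <;>
      simpa only [map_mul, map_sub, map_smul, map_zero, FreeAlgebra.lift_ι_apply, genMap] using this
    | EE i j hij => simpa [genMap] using h.EE i j hij
    | FF i j hij => simpa [genMap] using h.FF i j hij
    | serreE i j hij =>
      simpa only [map_mul, map_sub, map_add, map_smul, map_zero, FreeAlgebra.lift_ι_apply,
        genMap] using h.serreE i j hij
    | serreF i j hij =>
      simpa only [map_mul, map_sub, map_add, map_smul, map_zero, FreeAlgebra.lift_ι_apply,
        genMap] using h.serreF i j hij⟩

theorem liftUq_mk (h : QuantumRelations (q K) e f k l) (x : Gen n) :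
    liftUq h (mkUq K n (gen K x)) = genMap e f k l x := by
  unfold liftUq mkUq
  exact (RingQuot.liftAlgHom_mkAlgHom_apply ..).trans (FreeAlgebra.lift_ι_apply ..)

end Lift

/-- Lusztig's automorphism `T_i = T''_{i,1}`:
`E_i ↦ -F_i K_i`, `F_i ↦ -K_i⁻¹ E_i`, `K_j ↦ K_j K_i^{-a_{ij}}`, and for `j ≠ i`
`E_j ↦ E_i E_j - q⁻¹ E_j E_i`, `F_j ↦ F_j F_i - q F_i F_j` if `a_{ij} = -1`, while `E_j` and `F_j`
are fixed if `a_{ij} = 0`. -/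
noncomputable def T (i : Fin n) : Uq K n →ₐ[RatFunc K] Uq K n :=
  liftUq (Uq_relations.lusztig (q_ne K) (q_sq_sub_one K) (q_sq_add_one K) i)

theorem T_E (i j : Fin n) : T i (E j : Uq K n) = if j = i then -(F i * Kg i)
    else if CartanMatrix.A n i j = -1 then E i * E j - (q K)⁻¹ • (E j * E i) else E j :=
  liftUq_mk _ _

theorem T_F (i j : Fin n) : T i (F j : Uq K n) = if j = i then -(Ki i * E i)
    else if CartanMatrix.A n i j = -1 then F j * F i - q K • (F i * F j) else F j :=
  liftUq_mk _ _

theorem T_K (i j : Fin n) : T i (Kg j : Uq K n) = if j = i then Ki i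
    else if CartanMatrix.A n i j = -1 then Kg j * Kg i else Kg j :=
  liftUq_mk _ _

/-! The bar involution of `U_q(sl_{n+1})` is semilinear over `K(q)`; it is obtained from the
universal property with values in the same ring with the twisted scalar action. -/

/-- The ring `U_q(sl_{n+1})` on which `a ∈ K(q)` acts through `barScalar a`. -/
def BarTwist (K : Type u) [Field K] (n : ℕ) : Type u := Uq K n

noncomputable instance : Ring (BarTwist K n) := inferInstanceAs (Ring (Uq K n))

noncomputable instance : Algebra (RatFunc K) (BarTwist K n) :=
  RingHom.toAlgebra' ((algebraMap (RatFunc K) (Uq K n)).comp (barScalar K).toRingHom)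
    (fun a x => Algebra.commutes (A := Uq K n) (barScalar K a) x)

theorem barTwist_smul (a : RatFunc K) (x : Uq K n) :
    (a • (show BarTwist K n from x) : BarTwist K n) = (barScalar K a • x : Uq K n) := by
  rw [Algebra.smul_def, Algebra.smul_def]
  rfl

theorem bar_relations : QuantumRelations (A := BarTwist K n) (q K)
    (fun i => (E i : Uq K n)) (fun i => (F i : Uq K n)) (fun i => (Ki i : Uq K n))
    (fun i => (Kg i : Uq K n)) := by
  have h := Uq_relations (K := K) (n := n)
  have h' := h.swap (q_ne K)
  have hq : barScalar K (q K + (q K)⁻¹) = q K + (q K)⁻¹ := by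
    rw [map_add, map_inv₀, barScalar_q, inv_inv, add_comm]
  have hd : barScalar K ((q K - (q K)⁻¹)⁻¹) = -(q K - (q K)⁻¹)⁻¹ := by
    rw [map_inv₀, map_sub, map_inv₀, barScalar_q, inv_inv, ← neg_sub (q K), inv_neg]
  have hz : ∀ m : ℤ, barScalar K (q K ^ m) = q K ^ (-m) := fun m => by
    rw [map_zpow₀, barScalar_q, inv_zpow']
  refine ⟨h.LK, h.KL, h'.KK, fun i j => ?_, fun i j => ?_, fun i j => ?_, h.EE, h.FF,
    fun i j hij => ?_, fun i j hij => ?_⟩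
  · have e : (Ki i * E j : Uq K n) = barScalar K (q K ^ CartanMatrix.A n i j) • (E j * Ki i) := by
      rw [hz]; exact h'.KF i j
    exact e.trans (barTwist_smul _ _).symm
  · have e : (Ki i * F j : Uq K n) =
        barScalar K (q K ^ (-CartanMatrix.A n i j)) • (F j * Ki i) := by
      rw [hz, neg_neg]; exact h'.KE i j
    exact e.trans (barTwist_smul _ _).symm
  · by_cases hij : i = j
    · have e : (E i * F j - F j * E i : Uq K n) =
          barScalar K ((q K - (q K)⁻¹)⁻¹) • (Ki i - Kg i) := by
        rw [h.EF, if_pos hij, hd, neg_smul, ← smul_neg, neg_sub]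
      rw [if_pos hij]
      exact e.trans (barTwist_smul _ _).symm
    · have e : (E i * F j - F j * E i : Uq K n) = 0 := by rw [h.EF, if_neg hij]
      rw [if_neg hij]
      exact e
  · have e : (E i * E i * E j - barScalar K (q K + (q K)⁻¹) • (E i * E j * E i)
        + E j * E i * E i : Uq K n) = 0 := by
      rw [hq]; exact h.serreE i j hij
    have g : ∀ t t' : Uq K n, t = t' → E i * E i * E j - t + E j * E i * E i =
        E i * E i * E j - t' + E j * E i * E i := fun t t' ht => by rw [ht]
    exact (g _ _ (barTwist_smul _ _)).trans e
  · have e : (F i * F i * F j - barScalar K (q K + (q K)⁻¹) • (F i * F j * F i)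
        + F j * F i * F i : Uq K n) = 0 := by
      rw [hq]; exact h.serreF i j hij
    have g : ∀ t t' : Uq K n, t = t' → F i * F i * F j - t + F j * F i * F i =
        F i * F i * F j - t' + F j * F i * F i := fun t t' ht => by rw [ht]
    exact (g _ _ (barTwist_smul _ _)).trans e

/-- The bar involution of `U_q(sl_{n+1})`: the `K`-linear ring homomorphism with `q ↦ q⁻¹`,
`E_i ↦ E_i`, `F_i ↦ F_i`, `K_i ↦ K_i⁻¹`. -/
noncomputable def bar : Uq K n →+* Uq K n :=
  (liftUq (bar_relations (K := K) (n := n))).toRingHom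

theorem bar_smul (a : RatFunc K) (x : Uq K n) : bar (a • x) = barScalar K a • bar x :=
  (map_smul (liftUq (bar_relations (K := K) (n := n))) a x).trans (barTwist_smul _ _)

theorem bar_E (i : Fin n) : bar (E i : Uq K n) = E i := liftUq_mk bar_relations (Gen.E i)
theorem bar_F (i : Fin n) : bar (F i : Uq K n) = F i := liftUq_mk bar_relations (Gen.F i)
theorem bar_Kg (i : Fin n) : bar (Kg i : Uq K n) = Ki i := liftUq_mk bar_relations (Gen.K i)
theorem bar_Ki (i : Fin n) : bar (Ki i : Uq K n) = Kg i := liftUq_mk bar_relations (Gen.L i)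

end Uq

/-! ### The Satake diagram of type `AIV`

The nodes `1, …, n` of the Dynkin diagram `A_n` are indexed by `Fin n` (node `i + 1` is `i`), the
diagram automorphism `τ` is the flip `Fin.rev`, and `X = {2, …, n - 1}`. -/

section AIV

/-- The set `X` of black nodes: all nodes except the two end nodes. -/
abbrev Black {n : ℕ} (i : Fin n) : Prop := 0 < i.val ∧ i.val + 1 < n

/-- The reduced expression `s_2 (s_3 s_2) (s_4 s_3 s_2) ⋯ (s_{n-1} ⋯ s_2)` of the longest element
`w_X` of the parabolic subgroup `W_X`. -/
def wX (n : ℕ) : List (Fin n) :=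
  ((List.finRange n).filter (fun m => Black m)).flatMap fun m =>
    ((List.finRange n).filter (fun j => Black j ∧ j ≤ m)).reverse

/-- The Lusztig automorphism `T_{w_X}`, the composition of the `T_i` along the expression `wX`. -/
noncomputable def TwX (K : Type u) [Field K] (n : ℕ) : Uq K n →ₐ[RatFunc K] Uq K n :=
  (wX n).foldr (fun i f => (T i).comp f) (AlgHom.id _ _)

/-! Elements of the root lattice `Q` are written in the basis of simple roots, `Q = Fin n → ℤ`. -/

/-- The simple root `α_i`. -/
def alpha {n : ℕ} (i : Fin n) : Fin n → ℤ := Pi.single i 1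

/-- The invariant bilinear form on `Q` with `(α_i, α_j) = a_{ij}`. -/
def form {n : ℕ} (x y : Fin n → ℤ) : ℤ := ∑ i, ∑ j, x i * CartanMatrix.A n i j * y j

/-- The simple reflection `s_i`. -/
def reflection {n : ℕ} (i : Fin n) (x : Fin n → ℤ) : Fin n → ℤ := x - form x (alpha i) • alpha i

/-- The involution `Θ = -w_X ∘ τ` of `Q`. -/
def Theta {n : ℕ} (x : Fin n → ℤ) : Fin n → ℤ :=
  -(wX n).foldr reflection (fun i => x (Fin.rev i))

/-- The positive root `α_j + α_{j+1} + ⋯ + α_k`. -/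
def posRoot {n : ℕ} (j k : Fin n) : Fin n → ℤ := fun l => if j ≤ l ∧ l ≤ k then 1 else 0

/-- `2ρ_X`, the sum of the positive roots `α_j + ⋯ + α_k` with `j ≤ k` in `X`. As all roots have
squared length `2`, one has `α(2ρ_X^∨) = (α, 2ρ_X)`. -/
def twoRhoX (n : ℕ) : Fin n → ℤ :=
  ∑ p ∈ (Finset.univ : Finset (Fin n × Fin n)).filter
    (fun p => Black p.1 ∧ Black p.2 ∧ p.1 ≤ p.2), posRoot p.1 p.2

/-- The conditions on the function `s : I → K^×` entering the construction of the involution. -/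
structure IsSignFunction {K : Type u} [Field K] {n : ℕ} (s : Fin n → K) : Prop where
  ne_zero : ∀ i, s i ≠ 0
  eq_one : ∀ i, Black i ∨ Fin.rev i = i → s i = 1
  ratio : ∀ i, ¬ Black i → Fin.rev i ≠ i →
    s i / s (Fin.rev i) = (-1) ^ form (alpha i) (twoRhoX n)

/-- The conditions on the parameters `c = (c_i)`, `i ∈ I \ X` (the values on `X` are irrelevant):
`c` lies in the parameter set `𝒞` and satisfies the relation that guarantees the existence of the
bar involution. -/
structure IsParameter {K : Type u} [Field K] {n : ℕ} (c : Fin n → RatFunc K) : Prop where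
  ne_zero : ∀ i, ¬ Black i → c i ≠ 0
  mem_C : ∀ i, ¬ Black i → Fin.rev i ≠ i → form (alpha i) (Theta (alpha i)) = 0 →
    c i = c (Fin.rev i)
  bar_rel : ∀ i, ¬ Black i →
    c (Fin.rev i) = q K ^ form (alpha i) (Theta (alpha i) - twoRhoX n) * barScalar K (c i)

variable {K : Type u} [Field K] {n : ℕ}

/-- `K_x = ∏ K_i^{x_i}` for `x` in the root lattice. -/
noncomputable def Kroot (x : Fin n → ℤ) : Uq K n :=
  ((List.finRange n).map fun i => if 0 ≤ x i then Kg i ^ (x i).toNat else Ki i ^ (-x i).toNat).prod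

/-- The generators of `M_X = U_q(g_X)` together with those of
`U_Θ^0 = ⟨K_x | Θ(x) = x⟩`. -/
def leviGenerators (K : Type u) [Field K] (n : ℕ) : Set (Uq K n) :=
  {u | ∃ i, Black i ∧ (u = E i ∨ u = F i ∨ u = Kg i ∨ u = Ki i)} ∪
    {u | ∃ x : Fin n → ℤ, Theta x = x ∧ u = Kroot x}

/-- `B_i = F_i - c_i s(τ(i)) T_{w_X}(E_{τ(i)}) K_i⁻¹` for `i ∈ I \ X`. -/
noncomputable def Bgen (s : Fin n → K) (c : Fin n → RatFunc K) (i : Fin n) : Uq K n :=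
  F i - (c i * RatFunc.C (s (Fin.rev i))) • (TwX K n (E (Fin.rev i)) * Ki i)

/-- The quantum symmetric pair coideal subalgebra `B_{c,0}` of type `AIV`. -/
noncomputable def Bc (s : Fin n → K) (c : Fin n → RatFunc K) :
    Subalgebra (RatFunc K) (Uq K n) :=
  Algebra.adjoin (RatFunc K) (leviGenerators K n ∪ {u | ∃ i, ¬ Black i ∧ u = Bgen s c i})

/-- `ψ` is the bar involution of `B_{c,0}`: it agrees with the bar involution of `U_q` on
`M_X U_Θ^0` (in particular it is `K`-linear with `q ↦ q⁻¹`) and fixes the `B_i`. -/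
def IsBarInvolution (s : Fin n → K) (c : Fin n → RatFunc K) (ψ : Bc s c ≃+* Bc s c) : Prop :=
  (∀ b : Bc s c, (b : Uq K n) ∈ Algebra.adjoin (RatFunc K) (leviGenerators K n) →
    (ψ b : Uq K n) = bar (b : Uq K n)) ∧
  ∀ (b : Bc s c) (i : Fin n), ¬ Black i → (b : Uq K n) = Bgen s c i → ψ b = b

/-! ### The completion and the quasi `K`-matrix -/

/-- The weight space `U^+_μ`, `μ ∈ Q^+`, of the subalgebra `U^+` generated by the `E_i`. -/
def UplusWeight (K : Type u) [Field K] {n : ℕ} (μ : Fin n →₀ ℕ) : Set (Uq K n) :=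
  {u | u ∈ Algebra.adjoin (RatFunc K) (Set.range (E : Fin n → Uq K n)) ∧
    ∀ i, Kg i * u * Ki i = q K ^ form (fun j => (μ j : ℤ)) (alpha i) • u}

/-- A `U_q`-module of the category `O_int`: finite dimensional over `K(q)` and of type `1`, that is
spanned by weight vectors on which each `K_i` acts by an integer power of `q`. -/
def IsTypeOne (K : Type u) [Field K] (n : ℕ) (M : Type u) [AddCommGroup M] [Module (RatFunc K) M]
    [Module (Uq K n) M] : Prop :=
  FiniteDimensional (RatFunc K) M ∧
    Submodule.span (RatFunc K)
      {m : M | ∃ μ : Fin n → ℤ, ∀ i, (Kg i : Uq K n) • m = q K ^ μ i • m} = ⊤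

/-- Families `(X_μ)`, `μ ∈ Q^+`, of elements of `U_q`, with the product
`(X Y)_μ = ∑_{ν + ν' = μ} X_ν Y_{ν'}`. The completion `∏_μ U^+_μ` consists of those families with
`X_μ ∈ U^+_μ` for all `μ`. -/
abbrev Completion (K : Type u) [Field K] (n : ℕ) : Type u := MvPowerSeries (Fin n) (Uq K n)

/-- The action `m ↦ ∑_μ X_μ m` of an element of `∏_μ U^+_μ` on a module in `O_int`; only finitely
many summands are non-zero. -/
noncomputable def act (X : Completion K n) {M : Type u} [AddCommGroup M] [Module (Uq K n) M]
    (m : M) : M :=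
  ∑ᶠ μ : Fin n →₀ ℕ, MvPowerSeries.coeff μ X • m

/-- `X` is the quasi `K`-matrix of `B_{c,0}`: an element of `∏_μ U^+_μ` with `X_0 = 1` such that
`ψ(b) X = X bar(b)` for all `b ∈ B_{c,0}`, where `ψ` is the bar involution of `B_{c,0}`. The
equation is one between endomorphisms of the forgetful functor on `O_int`, that is between
operators on every finite dimensional module of type `1`. -/
def IsQuasiKMatrix (s : Fin n → K) (c : Fin n → RatFunc K) (X : Completion K n) : Prop :=
  MvPowerSeries.coeff 0 X = 1 ∧ (∀ μ, MvPowerSeries.coeff μ X ∈ UplusWeight K μ) ∧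
  ∃ ψ : Bc s c ≃+* Bc s c, IsBarInvolution s c ψ ∧
    ∀ (M : Type u) [AddCommGroup M] [Module (RatFunc K) M] [Module (Uq K n) M]
      [IsScalarTower (RatFunc K) (Uq K n) M], IsTypeOne K n M →
      ∀ (b : Bc s c) (m : M), (ψ b : Uq K n) • act X m = act X (bar (b : Uq K n) • m)

/-- `{k} = 1 + q² + ⋯ + q^{2(k-1)} = q^{k-1} [k]`. -/
noncomputable def qNumber (K : Type u) [Field K] (k : ℕ) : RatFunc K :=
  ∑ j ∈ Finset.range k, q K ^ (2 * j)

/-- `{k}! = {1} {2} ⋯ {k}`. -/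
noncomputable def qFactorial (K : Type u) [Field K] (k : ℕ) : RatFunc K :=
  ∏ j ∈ Finset.range k, qNumber K (j + 1)

/-- The series `∑_{k ≥ 0} a^k / {k}! u^k` for `u` of weight `γ ≠ 0`: its term of index `k` is placed
in degree `kγ`, and all other components vanish. -/
noncomputable def qExp (γ : Fin n →₀ ℕ) (a : RatFunc K) (u : Uq K n) : Completion K n := fun μ =>
  ∑ k ∈ Finset.range (μ.degree + 1), if μ = k • γ then (a ^ k / qFactorial K k) • u ^ k else 0

/-- The highest root `α_1 + ⋯ + α_n`, the weight of `T_1 T_{w_X}(E_n)` and `T_n T_{w_X}(E_1)`. -/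
noncomputable def highestRoot (n : ℕ) : Fin n →₀ ℕ := Finsupp.equivFunOnFinite.symm fun _ => 1

end AIV

end QSP

open QSP

/-!
Write `τ(i) = n + 1 - i` and `D_i = c_i s(τ(i)) T_{w_X}(E_{τ(i)}) K_i⁻¹`, so that `B_i = F_i - D_i`
for `i ∈ {1, n}`. Along the reduced word `s_2 (s_3 s_2) ⋯ (s_{n-1} ⋯ s_2)` of `w_X`, each `T_i`
either lengthens or fixes the iterated `q`-commutators of the `E_j` that occur, and the root vectors
`u = T_1 T_{w_X}(E_n)` and `v = T_n T_{w_X}(E_1)` come out as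
`u = [E_1, [E_2, … [E_{n-1}, E_n]]]` and `v = [E_n, [E_{n-1}, … [E_2, E_1]]]`
(`T_first_TwX`, `T_last_TwX`). Both have the weight of the highest root, they commute
(`highest_commute`), and they commute with all the generators of `B` other than the `B_i`
(`leviGenerators_commute`).

**The intertwining relation.** The commutator of `F_1` with `u` is a multiple of `D_1` and that
with `v` is a multiple of `bar D_1`; moreover `u D_1 = q² D_1 u` and `bar D_1 v = q² v bar D_1`.
Hence `[F_1, u^k]` equals `{k} [F_1, u] u^{k-1}`, and dually for `v`, and these factors are absorbed
by the denominators `{k}!`. With the coefficients of the theorem, the condition on `c_1, c_n` being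
used to identify the factor in front of `bar D_1` (`parameter_first`), the product `𝔛` of
`q`-exponentials satisfies `F_1 𝔛 - 𝔛 F_1 = D_1 𝔛 - 𝔛 bar D_1`, that is, `B_1 𝔛 = 𝔛 bar B_1`.
The case of `B_n` is symmetric (`C_F_first_mul`, `C_F_last_mul`).

**Existence of the bar involution of `B`.** The relation `y 𝔛 = 𝔛 bar(x)` determines each of `x`
and `y` from the other as soon as it is read in a ring that contains `U_q` and in which `𝔛` is
invertible. Such a ring is the ring of Laurent series over `U_q`, with `U_q` embedded by its
principal grading (`grading_injective`). The generators of `B` are related to generators of `B`, so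
the relation restricts to the graph of a ring automorphism `ψ` of `B` (`exists_isBarInvolution`).
On a finite dimensional module of type `1` only finitely many components of `𝔛` act non-trivially,
so the coefficientwise identities give the identity of operators (`isQuasiKMatrix_qExp_mul`).

**Uniqueness.** Let `𝔛` and `𝔛'` be two quasi `K`-matrices, and suppose that their components agree
in degrees below that of `μ ≠ 0`. Put `D_i = 0` for `i ∈ X`. Since `D_i` and `bar D_i` have weight
`θ - α_i` for the highest root `θ`, comparing in `(F_i - D_i) 𝔛 = 𝔛 (F_i - bar D_i)` the components
of weight `μ - α_i` shows that `x = 𝔛_μ - 𝔛'_μ` commutes with every `F_i` as an operator on every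
module. It remains to see that such an `x ∈ U^+_μ` is zero (`eq_zero_of_mem_UplusWeight`).
Tensoring modules with the natural representation turns the coproduct into a homomorphism from
`U_q` to `(n+1) × (n+1)` matrices over `U_q` (`natCoproduct`), and the matrix entries of an element
acting by zero act by zero. On `U^+` the matrices are upper triangular, and on ordered products of
root vectors the entry in position `(j, k + 1)` acts as a skew derivation with respect to the root
vector of `α_j + ⋯ + α_k`, with factors `1 + q⁻² + ⋯ + q^{-2(a-1)}`, which do not vanish
(`natCoproduct_sum`). Peeling off one root vector at a time shows that `U^+` acts faithfully
(`ActsByZero.eq_zero_of_mem_letters`) and that an element whose skew derivations all vanish is a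
scalar (`mem_letters_zero`). Commuting with the `F_i` forces all skew derivations of `x` to vanish,
and a scalar of non-zero weight is zero.

Sequences of generators are indexed from `0` by natural numbers and extended by zero (`natSeq`), so
that `E_1, …, E_n` correspond to the indices `0, …, n - 1`.
-/

namespace QSP

/-! ### Iterated `q`-commutators in type `A` -/

section Chain

variable {𝔽 A : Type*} [Field 𝔽] [Ring A] [Algebra 𝔽 A] {q : 𝔽}

/-- A sequence of elements satisfying the Serre relations of the infinite Dynkin diagram
`0 - 1 - 2 - ⋯`. Finite type `A` is recovered by sequences that vanish from some index on. -/
structure SerreSequence (q : 𝔽) (e : ℕ → A) : Prop where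
  comm : ∀ {i j}, i + 2 ≤ j → e i * e j = e j * e i
  up : ∀ i, Serre q (e i) (e (i + 1))
  down : ∀ i, Serre q (e (i + 1)) (e i)

/-- The iterated `q`-commutator `[e_i, [e_{i+1}, … [e_{i+d-1}, e_{i+d}]]]`, a root vector of weight
`α_i + ⋯ + α_{i+d}`. -/
def chain (q : 𝔽) (e : ℕ → A) : ℕ → ℕ → A
  | i, 0 => e i
  | i, d + 1 => qcomm q⁻¹ (e i) (chain q e (i + 1) d)

/-- The `q`-Jacobi identity in the case where the outer elements commute. -/
theorem qcomm_assoc {r : 𝔽} {a b c : A} (h : a * c = c * a) :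
    qcomm r a (qcomm r b c) = qcomm r (qcomm r a b) c := by
  have hca := fun x => assoc_comm h.symm x
  unfold qcomm
  simp only [mul_sub, sub_mul, smul_mul_assoc, mul_smul_comm, mul_assoc, smul_sub, smul_smul,
    ← h, hca]
  match_scalars <;> ring

/-- A Serre relation for `b` passes to `[b, c]` if `a` commutes with `c`; this makes the first letter
`q`-commute with chains. -/
theorem Serre.qcomm_right {a b c : A} (h : Serre q a b) (hac : a * c = c * a) (r : 𝔽) :
    Serre q a (qcomm r b c) := by
  have hca := fun x => assoc_comm hac.symm x
  unfold Serre at *; unfold qcomm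
  linear_combination (norm := (
    simp only [mul_sub, sub_mul, mul_add, add_mul, smul_mul_assoc, mul_smul_comm, mul_assoc,
      smul_sub, smul_add, smul_smul, smul_zero, mul_zero, zero_mul, ← hac, hca]
    match_scalars <;> ring))
    h * c - r • (c * h)

/-- `f` commutes with `[a, [e, c]]` if `[e, f]` is a combination of `K` and `K⁻¹`, `f` commutes
with `a` and `c`, and `K` scales `a` and `c` by `q⁻¹`. -/
theorem lowering_commute {q : 𝔽} {a e c f y L : A}
    (hy : qcomm q⁻¹ e c * f - f * qcomm q⁻¹ e c = -(c * L)) (hy' : y = qcomm q⁻¹ e c)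
    (hfa : f * a = a * f) (hac : a * c = c * a) (hLa : L * a = q • (a * L)) (hq : q ≠ 0) :
    f * qcomm q⁻¹ a y = qcomm q⁻¹ a y * f := by
  subst hy'
  have hca := fun x => assoc_comm hac.symm x
  have hfa' := fun x => assoc_comm hfa x
  generalize qcomm q⁻¹ e c = y at *
  unfold qcomm
  rw [← sub_eq_zero]
  linear_combination (norm := (
    simp only [mul_sub, sub_mul, mul_add, add_mul, smul_mul_assoc, mul_smul_comm, mul_assoc,
      smul_sub, smul_add, smul_smul, smul_zero, mul_zero, zero_mul, ← hac, hca, mul_neg, neg_mul,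
      smul_neg, hfa, hfa', hLa]
    match_scalars <;> field_simp <;> ring))
    -(a * hy) + q⁻¹ • (hy * a)

variable {e : ℕ → A}

theorem chain_succ (i d : ℕ) :
    chain q e i (d + 1) = qcomm q⁻¹ (e i) (chain q e (i + 1) d) := rfl

theorem first_mul_next (i d : ℕ) :
    e i * chain q e (i + 1) d = chain q e i (d + 1) + q⁻¹ • (chain q e (i + 1) d * e i) := by
  rw [chain_succ, qcomm, sub_add_cancel]

/-- Anything commuting with the letters of a chain commutes with the chain. -/
theorem chain_commute {y : A} {i d : ℕ} (h : ∀ j, i ≤ j → j ≤ i + d → y * e j = e j * y) :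
    y * chain q e i d = chain q e i d * y := by
  induction d generalizing i with
  | zero => exact h i le_rfl le_rfl
  | succ d ih =>
    exact qcomm_comm (h i le_rfl (by omega)) (ih fun j h1 h2 => h j (by omega) (by omega))

theorem map_chain {B : Type*} [Ring B] [Algebra 𝔽 B] (f : A →ₐ[𝔽] B) (i d : ℕ) :
    f (chain q e i d) = chain q (fun j => f (e j)) i d := by
  induction d generalizing i with
  | zero => rfl
  | succ d ih => simp [chain_succ, qcomm, ih]

theorem chain_congr {e' : ℕ → A} {i d : ℕ} (h : ∀ j, i ≤ j → j ≤ i + d → e j = e' j) :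
    chain q e i d = chain q e' i d := by
  induction d generalizing i with
  | zero => exact h i le_rfl le_rfl
  | succ d ih =>
    rw [chain_succ, chain_succ, h i le_rfl (by omega),
      ih fun j h1 h2 => h j (by omega) (by omega)]

theorem chain_mem {S : Subalgebra 𝔽 A} {i d : ℕ} (h : ∀ j, i ≤ j → j ≤ i + d → e j ∈ S) :
    chain q e i d ∈ S := by
  induction d generalizing i with
  | zero => exact h i le_rfl le_rfl
  | succ d ih =>
    have h1 := h i le_rfl (by omega)
    have h2 : chain q e (i + 1) d ∈ S := ih fun j h1 h2 => h j (by omega) (by omega)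
    exact S.sub_mem (S.mul_mem h1 h2) (S.smul_mem (S.mul_mem h2 h1) _)

theorem chain_W {r : 𝔽} {k : A} {m : ℕ → ℤ} (hq : q ≠ 0) {i d : ℕ}
    (h : ∀ j, i ≤ j → j ≤ i + d → W q k (e j) (m j)) :
    W q k (chain r e i d) (∑ j ∈ Finset.range (d + 1), m (i + j)) := by
  induction d generalizing i with
  | zero => simpa [chain] using h i le_rfl le_rfl
  | succ d ih =>
    have h1 := h i le_rfl (by omega)
    have h2 := ih (i := i + 1) fun j h1 h2 => h j (by omega) (by omega)
    refine W.of_eq (m := m i + ∑ j ∈ Finset.range (d + 1), m (i + 1 + j)) ?_ ?_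
    · exact (h1.mul hq h2).sub (((h2.mul hq h1).of_eq (add_comm _ _)).smul _)
    · rw [Finset.sum_range_succ' _ (d + 1), add_comm]
      simp only [add_assoc, add_comm 1, add_zero]

namespace SerreSequence

variable (h : SerreSequence q e)
include h

theorem comm' {i j : ℕ} (hij : i + 2 ≤ j ∨ j + 2 ≤ i) : e i * e j = e j * e i := by
  rcases hij with hij | hij
  · exact h.comm hij
  · exact (h.comm hij).symm

theorem commute_far {i d j : ℕ} (hj : j + 2 ≤ i ∨ i + d + 2 ≤ j) :
    e j * chain q e i d = chain q e i d * e j :=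
  chain_commute fun l h1 h2 => h.comm' (by omega)

theorem chain_commute_far {i d j d' : ℕ} (hj : i + d + 2 ≤ j) :
    chain q e i d * chain q e j d' = chain q e j d' * chain q e i d :=
  chain_commute fun _ h1 h2 => (h.commute_far (by omega)).symm

/-- A chain is the `q`-commutator of any initial and the complementary final segment. -/
theorem chain_split (i d d' : ℕ) :
    chain q e i (d + 1 + d') = qcomm q⁻¹ (chain q e i d) (chain q e (i + d + 1) d') := by
  induction d generalizing i with
  | zero => rw [show 0 + 1 + d' = d' + 1 by omega]; rfl
  | succ d ih =>
    rw [show d + 1 + 1 + d' = (d + 1 + d') + 1 by omega, chain_succ, ih, chain_succ,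
      qcomm_assoc (h.commute_far (by omega))]
    congr 2
    omega

theorem chain_last (i d : ℕ) :
    chain q e i (d + 1) = qcomm q⁻¹ (chain q e i d) (e (i + d + 1)) := h.chain_split i d 0

theorem serre_left (i d : ℕ) : Serre q (e i) (chain q e (i + 1) d) := by
  cases d with
  | zero => exact h.up i
  | succ d => exact (h.up i).qcomm_right (h.commute_far (by omega)) _

theorem serre_right (hq : q ≠ 0) (i d : ℕ) : Serre q (e (i + d + 1)) (chain q e i d) := by
  cases d with
  | zero => exact h.down i
  | succ d =>
    rw [h.chain_last]
    exact serre_chain' hq (h.down _) (h.commute_far (by omega)).symm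

theorem first_mul (hq : q ≠ 0) (i d : ℕ) :
    e i * chain q e i (d + 1) = q • (chain q e i (d + 1) * e i) :=
  (h.serre_left i d).left hq

theorem mul_last (hq : q ≠ 0) (i d : ℕ) :
    chain q e i (d + 1) * e (i + d + 1) = q • (e (i + d + 1) * chain q e i (d + 1)) := by
  rw [h.chain_last]
  exact (h.serre_right hq i d).right hq

/-- The inner letters of a chain commute with it, while the outer ones only `q`-commute with it. -/
theorem commute_inner (hq : q ≠ 0) (hq2 : q ^ 2 + 1 ≠ 0) {i d j : ℕ} (h1 : i < j)
    (h2 : j < i + d) : e j * chain q e i d = chain q e i d * e j := by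
  obtain ⟨a, rfl⟩ : ∃ a, j = i + a + 1 := ⟨j - i - 1, by omega⟩
  obtain ⟨b, rfl⟩ : ∃ b, d = a + 1 + (b + 1) := ⟨d - a - 2, by omega⟩
  have hc := h.chain_commute_far (i := i) (d := a) (j := i + a + 1 + 1) (d' := b) (by omega)
  rw [h.chain_split, chain_succ, qcomm_assoc hc]
  exact middle_commute hq hq2 (h.serre_right hq i a) (h.serre_left _ b) hc

/-- Root vectors with a common last letter `q`-commute. -/
theorem chain_mul_chain (hq : q ≠ 0) (hq2 : q ^ 2 + 1 ≠ 0) {i j d d' : ℕ} (hij : i < j)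
    (hd : i + d = j + d') :
    chain q e i d * chain q e j d' = q • (chain q e j d' * chain q e i d) := by
  induction d' generalizing j with
  | zero =>
    obtain ⟨a, rfl⟩ : ∃ a, d = a + 1 := ⟨d - 1, by omega⟩
    obtain rfl : j = i + a + 1 := by omega
    exact h.mul_last hq i a
  | succ d' ih =>
    have h1 := ih (j := j + 1) (by omega) (by omega)
    have h2 := h.commute_inner hq hq2 (i := i) (d := d) (j := j) hij (by omega)
    rw [chain_succ]
    generalize chain q e (j + 1) d' = y at *
    generalize chain q e i d = x at *
    have h2' := fun z => assoc_comm h2 z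
    have h1' : ∀ z, x * (y * z) = q • (y * (x * z)) := fun z => by
      rw [← mul_assoc, h1, smul_mul_assoc, mul_assoc]
    unfold qcomm
    simp only [mul_sub, sub_mul, mul_assoc, smul_mul_assoc, mul_smul_comm, smul_sub, smul_smul,
      h1, ← h2, ← h2', h1']
    match_scalars <;> ring

end SerreSequence

end Chain

/-! ### Root vectors of the highest root -/

section HighestRoot

variable {𝔽 A : Type*} [Field 𝔽] [Ring A] [Algebra 𝔽 A] {q : 𝔽} {n : ℕ}

/-- Extension of a family indexed by `Fin n` to all natural numbers by zero. -/
def natSeq (e : Fin n → A) (i : ℕ) : A := if h : i < n then e ⟨i, h⟩ else 0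

theorem natSeq_val (e : Fin n → A) (i : Fin n) : natSeq e i = e i := by
  simp [natSeq]

theorem natSeq_of_lt (e : Fin n → A) {i : ℕ} (h : i < n) : natSeq e i = e ⟨i, h⟩ := by
  simp [natSeq, h]

theorem natSeq_of_le (e : Fin n → A) {i : ℕ} (h : n ≤ i) : natSeq e i = 0 := by
  simp [natSeq, h]

theorem natSeq_rev (e : Fin n → A) {i : ℕ} (h : i < n) :
    natSeq (fun i => e i.rev) i = natSeq e (n - 1 - i) := by
  rw [natSeq_of_lt _ h, natSeq_of_lt _ (by omega)]
  congr 1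
  ext
  simp; omega

theorem cartan_of_far {i j : Fin n} (h : i.val + 2 ≤ j.val ∨ j.val + 2 ≤ i.val) :
    CartanMatrix.A n i j = 0 := by
  simp only [CartanMatrix.A, Matrix.of_apply, Fin.ext_iff]
  split_ifs <;> first | rfl | omega

theorem cartan_of_adj {i j : Fin n} (h : i.val + 1 = j.val ∨ j.val + 1 = i.val) :
    CartanMatrix.A n i j = -1 := by
  simp only [CartanMatrix.A, Matrix.of_apply, Fin.ext_iff]
  split_ifs <;> first | rfl | omega

theorem cartan_rev (i j : Fin n) :
    CartanMatrix.A n i.rev j.rev = CartanMatrix.A n i j := by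
  simp only [CartanMatrix.A, Matrix.of_apply, Fin.ext_iff, Fin.val_rev]
  have := i.isLt
  have := j.isLt
  split_ifs <;> first | rfl | omega

/-- `[[e, c]_{q⁻¹}, f] = -c k⁻¹` if `[e, f] = (k - k⁻¹) / (q - q⁻¹)` and `f` commutes with `c`. -/
theorem lower_first {e c f k l : A} (hq : q ≠ 0) (hq1 : q ^ 2 - 1 ≠ 0)
    (hef : e * f - f * e = (q - q⁻¹)⁻¹ • (k - l)) (hfc : f * c = c * f) (hk : W q k c (-1))
    (hl : W q l c 1) :
    qcomm q⁻¹ e c * f - f * qcomm q⁻¹ e c = -(c * l) := by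
  have hh : q - q⁻¹ ≠ 0 := by
    intro h0; apply hq1; field_simp at h0; linear_combination h0
  have hd : (q - q⁻¹)⁻¹ = q / (q ^ 2 - 1) := by field_simp
  rw [hd] at hef
  unfold W at hk hl
  simp only [zpow_neg, zpow_one] at hk hl
  unfold qcomm
  linear_combination (norm := (
      simp only [mul_sub, sub_mul, mul_add, add_mul, smul_mul_assoc, mul_smul_comm, mul_assoc,
        smul_sub, smul_add, smul_smul, smul_zero, mul_zero, zero_mul, mul_neg, neg_mul, neg_neg,
        smul_neg]
      match_scalars <;> field_simp <;> ring))
    hef * c - q⁻¹ • (c * hef) - e * hfc + q⁻¹ • (hfc * e) + (q / (q ^ 2 - 1)) • (hk - hl)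

/-- `[[c, e]_{q⁻¹}, f] = q⁻¹ c k` if `[e, f] = (k - k⁻¹) / (q - q⁻¹)` and `f` commutes with `c`. -/
theorem lower_last {e c f k l : A} (hq : q ≠ 0) (hq1 : q ^ 2 - 1 ≠ 0)
    (hef : e * f - f * e = (q - q⁻¹)⁻¹ • (k - l)) (hfc : f * c = c * f) (hk : W q k c (-1))
    (hl : W q l c 1) :
    qcomm q⁻¹ c e * f - f * qcomm q⁻¹ c e = q⁻¹ • (c * k) := by
  have hh : q - q⁻¹ ≠ 0 := by
    intro h0; apply hq1; field_simp at h0; linear_combination h0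
  have hd : (q - q⁻¹)⁻¹ = q / (q ^ 2 - 1) := by field_simp
  rw [hd] at hef
  unfold W at hk hl
  simp only [zpow_neg, zpow_one] at hk hl
  unfold qcomm
  linear_combination (norm := (
      simp only [mul_sub, sub_mul, mul_add, add_mul, smul_mul_assoc, mul_smul_comm, mul_assoc,
        smul_sub, smul_add, smul_smul, smul_zero, mul_zero, zero_mul, mul_neg, neg_mul, neg_neg,
        smul_neg]
      match_scalars <;> field_simp <;> ring))
    c * hef - q⁻¹ • (hef * c) - hfc * e + q⁻¹ • (e * hfc) - (q⁻¹ * (q / (q ^ 2 - 1))) • (hk - hl)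

namespace QuantumRelations

variable {E F K L : Fin n → A}

/-- The relations are stable under the diagram automorphism, which gives every statement about the
first node a counterpart about the last one. -/
theorem rev (h : QuantumRelations q E F K L) : QuantumRelations q (fun i => E i.rev)
    (fun i => F i.rev) (fun i => K i.rev) (fun i => L i.rev) where
  KL i := h.KL _
  LK i := h.LK _
  KK i j := h.KK _ _
  KE i j := by rw [h.KE, cartan_rev]
  KF i j := by rw [h.KF, cartan_rev]
  EF i j := by rw [h.EF]; simp
  EE i j hij := h.EE _ _ (by rwa [cartan_rev])
  FF i j hij := h.FF _ _ (by rwa [cartan_rev])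
  serreE i j hij := h.serreE _ _ (by rwa [cartan_rev])
  serreF i j hij := h.serreF _ _ (by rwa [cartan_rev])

theorem serreSequence (h : QuantumRelations q E F K L) : SerreSequence q (natSeq E) where
  comm {i j} hij := by
    by_cases hj : j < n
    · rw [natSeq_of_lt _ hj, natSeq_of_lt _ (by omega : i < n)]
      exact h.EE _ _ (cartan_of_far (Or.inl hij))
    · simp [natSeq_of_le E (not_lt.mp hj)]
  up i := by
    by_cases hj : i + 1 < n
    · rw [natSeq_of_lt _ hj, natSeq_of_lt _ (by omega : i < n)]
      exact h.serre (cartan_of_adj (Or.inl rfl))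
    · simp [natSeq_of_le E (not_lt.mp hj), Serre]
  down i := by
    by_cases hj : i + 1 < n
    · rw [natSeq_of_lt _ hj, natSeq_of_lt _ (by omega : i < n)]
      exact h.serre (cartan_of_adj (Or.inr rfl))
    · simp [natSeq_of_le E (not_lt.mp hj), Serre]

theorem wL (hq : q ≠ 0) (h : QuantumRelations q E F K L) (i j : Fin n) :
    W q (L i) (E j) (-CartanMatrix.A n i j) := (h.wE i j).inv hq (h.KL i) (h.LK i)

theorem EF_ne (h : QuantumRelations q E F K L) {i j : Fin n} (hij : i ≠ j) :
    F j * E i = E i * F j := by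
  have := h.EF i j
  rw [if_neg hij, sub_eq_zero] at this
  exact this.symm

theorem F_commute_chain (h : QuantumRelations q E F K L) (j : Fin n) {i d : ℕ}
    (hj : j.val < i ∨ i + d < j.val) :
    F j * chain q (natSeq E) i d = chain q (natSeq E) i d * F j := by
  refine chain_commute fun l h1 h2 => ?_
  by_cases hl : l < n
  · rw [natSeq_of_lt _ hl]
    exact h.EF_ne (by rintro rfl; simp at hj; omega)
  · simp [natSeq_of_le E (not_lt.mp hl)]

/-- The weight of a chain. -/
theorem W_chain (hq : q ≠ 0) (h : QuantumRelations q E F K L) (j : Fin n) {i d : ℕ}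
    (hd : i + d < n) : W q (K j) (chain q (natSeq E) i d)
      (∑ l ∈ Finset.range (d + 1), if j.val = i + l then 2
        else if j.val + 1 = i + l ∨ i + l + 1 = j.val then -1 else 0) := by
  refine (chain_W (m := fun l => if j.val = l then 2
        else if j.val + 1 = l ∨ l + 1 = j.val then -1 else 0) hq fun l h1 h2 => ?_)
  rw [natSeq_of_lt E (by omega : l < n)]
  convert h.wE j _ using 1
  simp only [CartanMatrix.A, Matrix.of_apply, Fin.ext_iff]

theorem W_chain_next (hq : q ≠ 0) (h : QuantumRelations q E F K L) (j : Fin n) {d : ℕ}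
    (hd : j.val + 1 + d < n) : W q (K j) (chain q (natSeq E) (j.val + 1) d) (-1) := by
  refine (h.W_chain hq j hd).of_eq ?_
  rw [Finset.sum_eq_single 0]
  · simp
  · intro l _ hl
    rw [if_neg (by omega), if_neg (by omega)]
  · simp

theorem W_chain_prev (hq : q ≠ 0) (h : QuantumRelations q E F K L) (j : Fin n) {i d : ℕ}
    (hd : i + d + 1 = j.val) : W q (K j) (chain q (natSeq E) i d) (-1) := by
  have := j.isLt
  refine (h.W_chain hq j (by omega)).of_eq ?_
  rw [Finset.sum_eq_single d]
  · rw [if_neg (by omega), if_pos (by omega)]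
  · intro l hl hl'
    simp only [Finset.mem_range] at hl
    rw [if_neg (by omega), if_neg (by omega)]
  · simp

/-- Commuting a chain with `F_j` for its first letter `j` removes that letter. -/
theorem chain_lower_first (hq : q ≠ 0) (hq1 : q ^ 2 - 1 ≠ 0) (h : QuantumRelations q E F K L)
    (j : Fin n) {d : ℕ} (hd : j.val + 1 + d < n) :
    chain q (natSeq E) j (d + 1) * F j - F j * chain q (natSeq E) j (d + 1) =
      -(chain q (natSeq E) (j.val + 1) d * L j) := by
  have h1 := h.W_chain_next hq j hd
  have h2 := h1.inv hq (h.KL j) (h.LK j)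
  have h3 := h.EF j j
  rw [if_pos rfl] at h3
  rw [chain_succ, natSeq_val]
  exact lower_first hq hq1 h3 (h.F_commute_chain j (by omega)) h1 (by simpa using h2)

/-- Commuting a chain with `F_j` for its last letter `j` removes that letter. -/
theorem chain_lower_last (hq : q ≠ 0) (hq1 : q ^ 2 - 1 ≠ 0) (h : QuantumRelations q E F K L)
    (j : Fin n) {i d : ℕ} (hd : i + d + 1 = j.val) :
    chain q (natSeq E) i (d + 1) * F j - F j * chain q (natSeq E) i (d + 1) =
      q⁻¹ • (chain q (natSeq E) i d * K j) := by
  have h1 := h.W_chain_prev hq j hd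
  have h2 := h1.inv hq (h.KL j) (h.LK j)
  have h3 := h.EF j j
  rw [if_pos rfl] at h3
  rw [h.serreSequence.chain_last, hd, natSeq_val]
  exact lower_last hq hq1 h3 (h.F_commute_chain j (by omega)) h1 (by simpa using h2)

/-- `F_j` commutes with a chain if `j` is an inner letter. Together with the two formulas for the outer
letters this determines the commutators of the root vectors with the `F_j`. -/
theorem chain_lower_inner (hq : q ≠ 0) (hq1 : q ^ 2 - 1 ≠ 0) (h : QuantumRelations q E F K L)
    (j : Fin n) {i d : ℕ} (hi : i < j.val) (hj : j.val < i + d) (hd : i + d < n) :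
    F j * chain q (natSeq E) i d = chain q (natSeq E) i d * F j := by
  obtain ⟨a, ha⟩ : ∃ a, j.val = i + a + 1 := ⟨j.val - i - 1, by omega⟩
  obtain ⟨b, rfl⟩ : ∃ b, d = a + 1 + (b + 1) := ⟨d - a - 2, by omega⟩
  have hs := h.serreSequence
  rw [hs.chain_split, ← ha]
  refine lowering_commute (e := E j) (c := chain q (natSeq E) (j.val + 1) b) (L := L j) ?_ ?_
    (h.F_commute_chain j (by omega)) (hs.chain_commute_far (by omega)) ?_ hq
  · have := h.chain_lower_first hq hq1 j (d := b) (by omega)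
    rwa [chain_succ, natSeq_val] at this
  · rw [chain_succ, natSeq_val]
  · have := (h.W_chain_prev hq j ha.symm).inv hq (h.KL j) (h.LK j)
    unfold W at this
    simpa using this

/-- The weight of the root vector of the highest root. -/
theorem W_highest (hq : q ≠ 0) (h : QuantumRelations q E F K L) (hn : 2 ≤ n) (j : Fin n) :
    W q (K j) (chain q (natSeq E) 0 (n - 1))
      ((if j.val = 0 then 1 else 0) + if j.val + 1 = n then 1 else 0) := by
  have hj := j.isLt
  refine (h.W_chain hq j (by omega)).of_eq ?_
  have e : ∀ l, (if j.val = 0 + l then (2 : ℤ) else if j.val + 1 = 0 + l ∨ 0 + l + 1 = j.val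
      then -1 else 0) = (if l = j.val then 2 else 0) + (if l = j.val + 1 then -1 else 0) +
        (if l + 1 = j.val then -1 else 0) := by
    intro l; split_ifs <;> first | rfl | omega
  rw [Finset.sum_congr rfl fun l _ => e l, Finset.sum_add_distrib, Finset.sum_add_distrib,
    Finset.sum_ite_eq', Finset.sum_ite_eq', if_pos (by simp; omega)]
  have e2 : ∑ l ∈ Finset.range (n - 1 + 1), (if l + 1 = j.val then (-1 : ℤ) else 0) =
      if j.val = 0 then 0 else -1 := by
    split_ifs with h0
    · exact Finset.sum_eq_zero fun l _ => if_neg (by omega)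
    · rw [Finset.sum_eq_single (j.val - 1)]
      · rw [if_pos (by omega)]
      · intro l _ hl; rw [if_neg (by omega)]
      · intro hl; simp only [Finset.mem_range] at hl; omega
  rw [e2]
  simp only [Finset.mem_range]
  split_ifs <;> first | rfl | omega

/-- The `q`-commutation relations of the root vector of the highest root with the `E_j`. -/
theorem highest_W (hq : q ≠ 0) (hq2 : q ^ 2 + 1 ≠ 0) (h : QuantumRelations q E F K L)
    (hn : 2 ≤ n) (j : ℕ) (hj : j < n) :
    W q (chain q (natSeq E) 0 (n - 1)) (natSeq E j)
      ((if j + 1 = n then 1 else 0) - if j = 0 then 1 else 0) := by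
  have hs := h.serreSequence
  obtain ⟨m, rfl⟩ : ∃ m, n = m + 2 := ⟨n - 2, by omega⟩
  rcases Nat.eq_zero_or_pos j with rfl | h0
  · have := hs.first_mul hq 0 m
    unfold W
    rw [show m + 2 - 1 = m + 1 by omega, this, smul_smul]
    simp [hq]
  · rcases Nat.lt_or_ge (j + 1) (m + 2) with h1 | h1
    · have := hs.commute_inner hq hq2 (i := 0) (d := m + 2 - 1) (j := j) (by omega) (by omega)
      rw [if_neg (by omega), if_neg (by omega)]
      exact W.comm this.symm
    · obtain rfl : j = m + 1 := by omega
      have := hs.mul_last hq 0 m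
      unfold W
      simp only [zero_add] at this
      simpa using this

/-- The two root vectors of the highest root attached to the two orientations of the diagram
commute: each of them scales the two extreme letters of the other by inverse scalars and commutes
with the remaining letters. -/
theorem highest_commute (hq : q ≠ 0) (hq2 : q ^ 2 + 1 ≠ 0) (h : QuantumRelations q E F K L)
    (hn : 2 ≤ n) : chain q (natSeq E) 0 (n - 1) * chain q (natSeq fun i => E i.rev) 0 (n - 1) =
      chain q (natSeq fun i => E i.rev) 0 (n - 1) * chain q (natSeq E) 0 (n - 1) := by
  have := chain_W (r := q) (e := natSeq fun i => E i.rev) (i := 0) (d := n - 1)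
    (m := fun j => (if j = 0 then 1 else 0) - if j + 1 = n then 1 else 0) hq
    (k := chain q (natSeq E) 0 (n - 1)) (fun j _ hj => by
      rw [natSeq_rev _ (by omega)]
      refine (h.highest_W hq hq2 hn (n - 1 - j) (by omega)).of_eq ?_
      split_ifs <;> first | rfl | omega)
  have e : ∑ j ∈ Finset.range (n - 1 + 1), (fun j => (if j = 0 then (1 : ℤ) else 0) -
      if j + 1 = n then 1 else 0) (0 + j) = 0 := by
    simp only [zero_add]
    rw [Finset.sum_sub_distrib, Finset.sum_ite_eq', if_pos (by simp),
      Finset.sum_eq_single (n - 1)]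
    · rw [if_pos (by omega)]; rfl
    · intro l _ hl; rw [if_neg (by omega)]
    · simp
  rw [e] at this
  unfold W at this
  simpa using this

end QuantumRelations

/-! ### Braid group operators on chains -/

/-- The properties of the braid group operator `T_i` that determine its effect on chains. -/
structure IsBraidAt (q : 𝔽) (e : ℕ → A) (T : A →ₐ[𝔽] A) (i : ℕ) : Prop where
  next : T (e (i + 1)) = qcomm q⁻¹ (e i) (e (i + 1))
  cancel : ∀ j, j + 1 = i → qcomm q⁻¹ (T (e j)) (T (e i)) = e j
  far : ∀ j, j + 2 ≤ i ∨ i + 2 ≤ j → T (e j) = e j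

namespace IsBraidAt

variable {e : ℕ → A} {T : A →ₐ[𝔽] A} {i : ℕ}

theorem map_qcomm (T : A →ₐ[𝔽] A) (r : 𝔽) (a b : A) : T (qcomm r a b) = qcomm r (T a) (T b) := by
  simp [qcomm]

theorem chain_far (h : IsBraidAt q e T i) {j d : ℕ} (hj : j + d + 2 ≤ i ∨ i + 2 ≤ j) :
    T (chain q e j d) = chain q e j d := by
  rw [map_chain]
  exact chain_congr fun l h1 h2 => h.far l (by omega)

/-- `T_i` lengthens a chain that starts right after `i`. -/
theorem chain_next (hs : SerreSequence q e) (h : IsBraidAt q e T i) (d : ℕ) :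
    T (chain q e (i + 1) d) = chain q e i (d + 1) := by
  cases d with
  | zero => exact h.next
  | succ d =>
    rw [chain_succ, map_qcomm, h.next, h.chain_far (by omega), chain_succ, chain_succ,
      qcomm_assoc (hs.commute_far (by omega))]

/-- `T_i` fixes a chain having `i` as an inner letter, as `s_i` fixes its weight. -/
theorem chain_inner (hs : SerreSequence q e) (h : IsBraidAt q e T i) {j d : ℕ} (h1 : j < i)
    (h2 : i < j + d) : T (chain q e j d) = chain q e j d := by
  have key : ∀ a b, i = a + 1 → T (chain q e a (b + 2)) = chain q e a (b + 2) := by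
    rintro a b rfl
    have e1 : chain q e a (b + 2) =
        qcomm q⁻¹ (qcomm q⁻¹ (e a) (e (a + 1))) (chain q e (a + 2) b) := by
      rw [chain_succ, chain_succ, qcomm_assoc (hs.commute_far (by omega))]
    conv_lhs => rw [e1, map_qcomm, map_qcomm, h.cancel a rfl, h.chain_next hs]
    rfl
  obtain ⟨a, rfl⟩ : ∃ a, i = j + a + 1 := ⟨i - j - 1, by omega⟩
  obtain ⟨b, rfl⟩ : ∃ b, d = a + (b + 2) := ⟨d - a - 2, by omega⟩
  cases a with
  | zero => rw [zero_add]; exact key j b rfl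
  | succ a =>
    rw [hs.chain_split, map_qcomm, h.chain_far (by omega), key _ _ (by omega)]

end IsBraidAt

end HighestRoot

/-! ### Reduced words for `w_X` -/

section Words

/-- The word `(1)(2 1)(3 2 1) ⋯ (N ⋯ 1)`. -/
def staircase (N : ℕ) : List ℕ := (List.range' 1 N).flatMap fun m => (List.range' 1 m).reverse

theorem staircase_succ (N : ℕ) :
    staircase (N + 1) = staircase N ++ (List.range' 1 (N + 1)).reverse := by
  unfold staircase
  conv_lhs => rw [List.range'_concat, List.flatMap_append]
  simp [add_comm]

theorem descending_succ (m : ℕ) :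
    (List.range' 1 (m + 1)).reverse = (m + 1) :: (List.range' 1 m).reverse := by
  rw [List.range'_concat, List.reverse_append]
  simp [add_comm]

theorem mem_staircase {N i : ℕ} (h : i ∈ staircase N) : 1 ≤ i ∧ i ≤ N := by
  simp only [staircase, List.mem_flatMap, List.mem_reverse, List.mem_range'_1] at h
  omega

theorem foldr_fixed {X : Type*} {f : ℕ → X → X} {x : X} {l : List ℕ} (h : ∀ i ∈ l, f i x = x) :
    l.foldr f x = x := by
  induction l with
  | nil => rfl
  | cons a l ih =>
    rw [List.foldr_cons, ih fun i hi => h i (List.mem_cons_of_mem _ hi), h a List.mem_cons_self]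

/-- If `f i` extends intervals starting at `i + 1` to the left and fixes intervals far to the right,
then the staircase word extends intervals starting at `N + 1` to intervals starting at `1`. -/
theorem foldr_staircase {X : Type*} {f : ℕ → X → X} {c : ℕ → ℕ → X} {N : ℕ}
    (next : ∀ i d, 1 ≤ i → i ≤ N → f i (c (i + 1) d) = c i (d + 1))
    (far : ∀ i j d, 1 ≤ i → i + 2 ≤ j → j ≤ N + 1 → f i (c j d) = c j d) (d : ℕ) :
    (staircase N).foldr f (c (N + 1) d) = c 1 (N + d) := by
  induction N generalizing d with
  | zero => simp [staircase]
  | succ N ih =>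
    have h1 : ((List.range' 1 N).reverse).foldr f (c (N + 1 + 1) d) = c (N + 1 + 1) d :=
      foldr_fixed fun i hi => by
        simp only [List.mem_reverse, List.mem_range'_1] at hi
        exact far i _ d (by omega) (by omega) le_rfl
    rw [staircase_succ, List.foldr_append, descending_succ, List.foldr_cons, h1,
      next _ _ (by omega) le_rfl,
      ih (fun i d h1 h2 => next i d h1 (by omega)) (fun i j d h1 h2 h3 => far i j d h1 h2 (by omega))]
    congr 1; omega

/-- The same word applied to the letter at the other end: only its last block contributes. -/
theorem foldr_staircase' {X : Type*} {f : ℕ → X → X} {c : ℕ → X} {N : ℕ}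
    (next : ∀ i, i < N → f (i + 1) (c i) = c (i + 1))
    (inner : ∀ i, 1 ≤ i → i < N → f i (c N) = c N) :
    (staircase N).foldr f (c 0) = c N := by
  have h : ∀ m, m ≤ N → ((List.range' 1 m).reverse).foldr f (c 0) = c m := by
    intro m
    induction m with
    | zero => intro _; rfl
    | succ m ih =>
      intro hm
      rw [descending_succ, List.foldr_cons, ih (by omega), next m (by omega)]
  cases N with
  | zero => rfl
  | succ N =>
    rw [staircase_succ, List.foldr_append, h _ le_rfl]
    exact foldr_fixed fun i hi => by
      have := mem_staircase hi
      exact inner i (by omega) (by omega)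

theorem filter_range_eq {n a b : ℕ} {p : ℕ → Prop} [DecidablePred p] (hb : a + b ≤ n)
    (h : ∀ i, i < n → (p i ↔ a ≤ i ∧ i < a + b)) :
    (List.range n).filter (fun i => decide (p i)) = List.range' a b := by
  obtain ⟨c, rfl⟩ : ∃ c, n = a + b + c := ⟨n - a - b, by omega⟩
  have e : List.range (a + b + c) = List.range' 0 a ++ List.range' a b ++ List.range' (a + b) c := by
    have h1 := List.range'_append_1 (s := 0) (m := a) (n := b)
    have h2 := List.range'_append_1 (s := 0) (m := a + b) (n := c)
    rw [List.range_eq_range', ← h2, ← h1]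
    simp
  have h1 : (List.range' 0 a).filter (fun i => decide (p i)) = [] := by
    rw [List.filter_eq_nil_iff]
    intro i hi
    simp only [List.mem_range'_1] at hi
    simp only [decide_eq_true_eq, h i (by omega)]; omega
  have h2 : (List.range' (a + b) c).filter (fun i => decide (p i)) = [] := by
    rw [List.filter_eq_nil_iff]
    intro i hi
    simp only [List.mem_range'_1] at hi
    simp only [decide_eq_true_eq, h i (by omega)]; omega
  have h3 : (List.range' a b).filter (fun i => decide (p i)) = List.range' a b := by
    rw [List.filter_eq_self]
    intro i hi
    simp only [List.mem_range'_1] at hi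
    simp only [decide_eq_true_eq, h i (by omega)]; omega
  rw [e, List.filter_append, List.filter_append, h1, h2, h3]
  simp

theorem filter_finRange_map {n a b : ℕ} {p : Fin n → Prop} [DecidablePred p] (hb : a + b ≤ n)
    (h : ∀ i : Fin n, p i ↔ a ≤ i.val ∧ i.val < a + b) :
    ((List.finRange n).filter (fun i => decide (p i))).map Fin.val = List.range' a b := by
  have e : (List.finRange n).filter (fun i => decide (p i)) =
      (List.finRange n).filter ((fun i : ℕ => decide (a ≤ i ∧ i < a + b)) ∘ Fin.val) :=
    List.filter_congr fun i _ => by simp [h]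
  rw [e, ← List.filter_map, List.map_coe_finRange_eq_range]
  exact filter_range_eq hb fun i _ => Iff.rfl

theorem wX_map_val {n : ℕ} (hn : 2 ≤ n) : (wX n).map Fin.val = staircase (n - 2) := by
  have h1 : ((List.finRange n).filter (fun m => Black m)).map Fin.val = List.range' 1 (n - 2) :=
    filter_finRange_map (by omega) fun i => by simp only [Black]; omega
  unfold wX staircase
  rw [← h1, List.map_flatMap, List.flatMap_map]
  refine List.flatMap_congr fun m hm => ?_
  simp only [List.mem_filter, decide_eq_true_eq, Black] at hm
  rw [List.map_reverse, filter_finRange_map (a := 1) (b := m.val) (by omega)]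
  intro i
  simp only [Black, Fin.le_def]
  omega

/-- Folding along `wX` in terms of natural numbers. -/
theorem foldr_wX {n : ℕ} (hn : 2 ≤ n) {X : Type*} (f : Fin n → X → X) (x : X) :
    (wX n).foldr f x =
      (staircase (n - 2)).foldr (fun i y => if h : i < n then f ⟨i, h⟩ y else y) x := by
  rw [← wX_map_val hn, List.foldr_map]
  simp

theorem mem_wX {n : ℕ} (hn : 2 ≤ n) {i : Fin n} (h : i ∈ wX n) : Black i := by
  have := mem_staircase (wX_map_val hn ▸ List.mem_map_of_mem h)
  simp only [Black]
  omega

end Words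

/-! ### Roots, `Θ` and `2ρ_X` -/

section Roots

variable {n : ℕ}

theorem form_symm (x y : Fin n → ℤ) : form x y = form y x := by
  unfold form
  rw [Finset.sum_comm]
  refine Finset.sum_congr rfl fun i _ => Finset.sum_congr rfl fun j _ => ?_
  rw [cartan_symm]; ring

theorem form_add_left (x y z : Fin n → ℤ) : form (x + y) z = form x z + form y z := by
  simp [form, add_mul, Finset.sum_add_distrib]

theorem form_smul_left (t : ℤ) (x z : Fin n → ℤ) : form (t • x) z = t * form x z := by
  simp [form, mul_assoc, Finset.mul_sum]

theorem form_neg_left (x z : Fin n → ℤ) : form (-x) z = -form x z := by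
  simp [form]

theorem form_sub_left (x y z : Fin n → ℤ) : form (x - y) z = form x z - form y z := by
  rw [sub_eq_add_neg, form_add_left, form_neg_left, sub_eq_add_neg]

theorem form_alpha (x : Fin n → ℤ) (i : Fin n) :
    form x (alpha i) = ∑ j, x j * CartanMatrix.A n j i := by
  unfold form alpha
  refine Finset.sum_congr rfl fun j _ => ?_
  rw [Finset.sum_eq_single i]
  · simp
  · intro k _ hk; simp [Pi.single_eq_of_ne hk]
  · simp

theorem form_alpha_alpha (i j : Fin n) : form (alpha i) (alpha j) = CartanMatrix.A n i j := by
  rw [form_alpha, Finset.sum_eq_single i]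
  · simp [alpha]
  · intro k _ hk; simp [alpha, Pi.single_eq_of_ne hk]
  · simp

theorem form_eq_sum (x y : Fin n → ℤ) : form x y = ∑ i, x i * form (alpha i) y := by
  refine Finset.sum_congr rfl fun i _ => ?_
  rw [form_symm, form_alpha, Finset.mul_sum]
  refine Finset.sum_congr rfl fun j _ => ?_
  rw [cartan_symm]; ring

/-- The pairing with `α_i` as a second difference of coefficients; out of range coefficients are
zero. -/
theorem form_alpha_eq (x : Fin n → ℤ) (i : Fin n) :
    form x (alpha i) = 2 * natSeq x i - (if i.val = 0 then 0 else natSeq x (i.val - 1))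
      - natSeq x (i.val + 1) := by
  have hi := i.isLt
  have e : ∀ j : Fin n, x j * CartanMatrix.A n j i = (if j = i then 2 * x j else 0) -
      (if j.val + 1 = i.val then x j else 0) - (if i.val + 1 = j.val then x j else 0) := by
    intro j
    simp only [CartanMatrix.A, Matrix.of_apply, Fin.ext_iff]
    split_ifs <;> first | (exfalso; omega) | ring
  rw [form_alpha, Finset.sum_congr rfl fun j _ => e j, Finset.sum_sub_distrib,
    Finset.sum_sub_distrib, Finset.sum_ite_eq', if_pos (Finset.mem_univ _), natSeq_val]
  congr 1
  · congr 1
    split_ifs with h0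
    · exact Finset.sum_eq_zero fun j _ => if_neg (by omega)
    · rw [natSeq_of_lt _ (by omega : i.val - 1 < n), Finset.sum_eq_single ⟨i.val - 1, by omega⟩]
      · rw [if_pos (by simp; omega)]
      · intro j _ hj; rw [if_neg]; intro h; apply hj; ext; simp; omega
      · simp
  · by_cases h : i.val + 1 < n
    · rw [natSeq_of_lt _ h, Finset.sum_eq_single ⟨i.val + 1, h⟩]
      · rw [if_pos rfl]
      · intro j _ hj; rw [if_neg]; intro h; apply hj; ext; simp; omega
      · simp
    · rw [natSeq_of_le _ (by omega)]
      exact Finset.sum_eq_zero fun j _ => if_neg (by have := j.isLt; omega)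

/-- The Cartan matrix is nondegenerate. -/
theorem eq_zero_of_form_alpha {x : Fin n → ℤ} (h : ∀ i, form x (alpha i) = 0) : x = 0 := by
  have key : ∀ k, k + 1 ≤ n → natSeq x (k + 1) = (k + 2) * natSeq x 0 := by
    intro k
    induction k using Nat.strong_induction_on with
    | _ k ih =>
      intro hk
      have h1 := h ⟨k, by omega⟩
      rw [form_alpha_eq] at h1
      rcases k with _ | _ | k
      · simp at h1 ⊢; linarith
      · have h2 := ih 0 (by omega) (by omega)
        simp at h1 h2 ⊢; linarith
      · have h2 := ih k (by omega) (by omega)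
        have h3 := ih (k + 1) (by omega) (by omega)
        simp at h1 h2 h3 ⊢; linarith
  by_cases hn : n = 0
  · subst hn; ext i; exact i.elim0
  have h0 : natSeq x 0 = 0 := by
    have := key (n - 1) (by omega)
    rw [natSeq_of_le _ (by omega)] at this
    rcases mul_eq_zero.mp this.symm with h | h
    · omega
    · exact h
  ext i
  rw [← natSeq_val x i]
  rcases Nat.eq_zero_or_pos i.val with hi | hi
  · rw [hi, h0]; rfl
  · obtain ⟨k, hk⟩ : ∃ k, i.val = k + 1 := ⟨i.val - 1, by omega⟩
    rw [hk, key k (by have := i.isLt; omega), h0]; simp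

/-- The root `α_j + ⋯ + α_{j+d}`. -/
def intervalRoot (n j d : ℕ) : Fin n → ℤ := fun l => if j ≤ l.val ∧ l.val ≤ j + d then 1 else 0

theorem natSeq_intervalRoot (j d l : ℕ) :
    natSeq (intervalRoot n j d) l = if l < n ∧ j ≤ l ∧ l ≤ j + d then 1 else 0 := by
  by_cases h : l < n
  · rw [natSeq_of_lt _ h]; simp [intervalRoot, h]
  · rw [natSeq_of_le _ (by omega), if_neg (by omega)]

/-- `s_i` lengthens an interval root that starts right after `i`, in parallel with `T_i` on chains. -/
theorem reflection_next {i : Fin n} {d : ℕ} (h : i.val + 1 < n) :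
    reflection i (intervalRoot n (i.val + 1) d) = intervalRoot n i d.succ := by
  have e : form (intervalRoot n (i.val + 1) d) (alpha i) = -1 := by
    simp only [form_alpha_eq, natSeq_intervalRoot]
    split_ifs <;> first | rfl | omega
  ext l
  rw [reflection, e]
  simp only [alpha, intervalRoot, Pi.sub_apply, Pi.smul_apply, Pi.single_apply, Fin.ext_iff]
  split_ifs <;> first | rfl | (simp; done) | omega

theorem reflection_far {i : Fin n} {j d : ℕ} (h : i.val + 2 ≤ j) :
    reflection i (intervalRoot n j d) = intervalRoot n j d := by
  have e : form (intervalRoot n j d) (alpha i) = 0 := by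
    simp only [form_alpha_eq, natSeq_intervalRoot]
    split_ifs <;> first | rfl | omega
  simp [reflection, e]

theorem Theta_alpha_first (hn : 2 ≤ n) {first : Fin n} (hf : first.val = 0) :
    Theta (alpha first) = -intervalRoot n 1 (n - 2) := by
  unfold Theta
  congr 1
  have e : (fun i => alpha first (Fin.rev i)) = intervalRoot n (n - 2 + 1) 0 := by
    ext i
    have := i.isLt
    simp only [alpha, intervalRoot, Pi.single_apply, Fin.ext_iff, Fin.val_rev, hf]
    split_ifs <;> first | rfl | omega
  rw [e, foldr_wX hn, foldr_staircase (c := intervalRoot n)]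
  · rfl
  · intro i d h1 h2
    rw [dif_pos (by omega : i < n)]
    exact reflection_next (i := ⟨i, by omega⟩) (by simp; omega)
  · intro i j d h1 h2 h3
    rw [dif_pos (by omega : i < n)]
    exact reflection_far (i := ⟨i, by omega⟩) (by simpa using h2)

theorem twoRhoX_apply (l : Fin n) : twoRhoX n l =
    ((Finset.univ : Finset (Fin n × Fin n)).filter
      (fun p => (Black p.1 ∧ Black p.2 ∧ p.1 ≤ p.2) ∧ p.1 ≤ l ∧ l ≤ p.2)).card := by
  unfold twoRhoX
  rw [Finset.sum_apply]
  simp only [posRoot]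
  rw [Finset.sum_boole, Finset.filter_filter]

theorem twoRhoX_zero {l : Fin n} (hl : l.val = 0) : twoRhoX n l = 0 := by
  rw [twoRhoX_apply, Finset.card_eq_zero.mpr]
  · rfl
  · rw [Finset.filter_eq_empty_iff]
    rintro p -
    simp only [Black, Fin.le_def]
    omega

/-- The coefficient of `α_2` in `2ρ_X`, the only one that contributes to the pairing with `α_1`. -/
theorem twoRhoX_one (hn : 2 ≤ n) {l : Fin n} (hl : l.val = 1) :
    twoRhoX n l = (n - 2 : ℕ) := by
  rw [twoRhoX_apply, Nat.cast_inj]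
  have : n - 2 = (Finset.Ico 1 (n - 1)).card := by simp; omega
  rw [this]
  refine Finset.card_bij (fun p _ => p.2.val) ?_ ?_ ?_
  · rintro p hp
    simp only [Finset.mem_filter, Black, Fin.le_def] at hp
    simp only [Finset.mem_Ico]; omega
  · rintro ⟨p, p'⟩ hp ⟨r, r'⟩ hr h
    simp only [Finset.mem_filter, Black, Fin.le_def] at hp hr
    simp only at h
    ext <;> simp only <;> omega
  · intro b hb
    simp only [Finset.mem_Ico] at hb
    refine ⟨(l, ⟨b, by omega⟩), ?_, rfl⟩
    simp only [Finset.mem_filter, Finset.mem_univ, true_and, Black, Fin.le_def]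
    omega

theorem form_alpha_first_twoRhoX (hn : 2 ≤ n) {first : Fin n} (hf : first.val = 0) :
    form (alpha first) (twoRhoX n) = -(n - 2 : ℕ) := by
  rw [form_symm, form_alpha_eq, natSeq_val, if_pos hf, twoRhoX_zero hf,
    natSeq_of_lt _ (by omega : first.val + 1 < n), twoRhoX_one hn (by simp [hf])]
  ring

theorem form_alpha_first_Theta (hn : 2 ≤ n) {first : Fin n} (hf : first.val = 0) :
    form (alpha first) (Theta (alpha first) - twoRhoX n) = (n - 1 : ℕ) := by
  have h := form_alpha_first_twoRhoX hn hf
  rw [form_symm] at h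
  rw [form_symm, form_sub_left, h, Theta_alpha_first hn hf, form_neg_left, form_alpha_eq]
  simp only [natSeq_intervalRoot, hf]
  simp only [if_true]
  rw [if_neg (by omega), if_pos (by omega)]
  omega

/-- The sum `α_1 + ⋯ + α_n` of all simple roots is orthogonal to the lattice `Q^Θ`. -/
theorem form_of_Theta_eq (hn : 2 ≤ n) {x : Fin n → ℤ} (hx : Theta x = x) :
    form x (fun _ => 1) = 0 := by
  have hb : ∀ i : Fin n, Black i → form (alpha i) (fun _ => 1) = 0 := by
    intro i hi
    obtain ⟨h1, h2⟩ := hi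
    have e : ∀ l, natSeq (fun _ : Fin n => (1 : ℤ)) l = if l < n then 1 else 0 := by
      intro l; simp [natSeq]
    rw [form_symm, form_alpha_eq]
    simp only [e]
    split_ifs <;> first | rfl | omega
  have hr : ∀ (l : List (Fin n)) (y : Fin n → ℤ), (∀ i ∈ l, Black i) →
      form (l.foldr reflection y) (fun _ => 1) = form y fun _ => 1 := by
    intro l y hl
    induction l with
    | nil => rfl
    | cons i l ih =>
      rw [List.foldr_cons, reflection, form_sub_left, form_smul_left,
        hb i (hl i List.mem_cons_self), mul_zero, sub_zero,
        ih fun j hj => hl j (List.mem_cons_of_mem _ hj)]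
  have hrev : form (fun i => x (Fin.rev i)) (fun _ => 1) = form x (fun _ => 1) := by
    unfold form
    rw [← Equiv.sum_comp Fin.revPerm]
    refine Finset.sum_congr rfl fun i _ => ?_
    rw [← Equiv.sum_comp Fin.revPerm]
    refine Finset.sum_congr rfl fun j _ => ?_
    simp [cartan_rev]
  have := congrArg (fun y => form y fun _ => 1) hx
  simp only [Theta, form_neg_left, hr _ _ fun i hi => mem_wX hn hi, hrev] at this
  omega

theorem Theta_neg (x : Fin n → ℤ) : Theta (-x) = -Theta x := by
  have h : ∀ (l : List (Fin n)) (y : Fin n → ℤ),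
      l.foldr reflection (-y) = -l.foldr reflection y := by
    intro l y
    induction l with
    | nil => rfl
    | cons i l ih =>
      rw [List.foldr_cons, List.foldr_cons, ih, reflection, reflection, form_neg_left, neg_smul]
      abel
  exact congrArg Neg.neg (h _ fun i => x (Fin.rev i))

end Roots

/-! ### The root vectors `T_1 T_{w_X}(E_n)` and `T_n T_{w_X}(E_1)` -/

section UqRootVectors

variable {K : Type u} [Field K] {n : ℕ}

theorem T_E_adj {i j : Fin n} (h : i.val + 1 = j.val ∨ j.val + 1 = i.val) :
    T i (E j : Uq K n) = qcomm (q K)⁻¹ (E i) (E j) := by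
  rw [T_E, if_neg (by rintro rfl; omega), if_pos (cartan_of_adj h)]
  rfl

theorem T_E_far {i j : Fin n} (h : i.val + 2 ≤ j.val ∨ j.val + 2 ≤ i.val) :
    T i (E j : Uq K n) = E j := by
  rw [T_E, if_neg (by rintro rfl; omega), if_neg (by rw [cartan_of_far h]; decide)]

theorem T_E_cancel {i j : Fin n} (h : i.val + 1 = j.val ∨ j.val + 1 = i.val) :
    qcomm (q K)⁻¹ (T i (E j : Uq K n)) (T i (E i)) = E j := by
  rw [T_E_adj h, T_E, if_pos rfl]
  exact Uq_relations.qcomm_X (q_ne K) (q_sq_sub_one K) (by rintro rfl; omega) (cartan_of_adj h)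

theorem isBraidAt_T (i : Fin n) : IsBraidAt (q K) (natSeq (E : Fin n → Uq K n)) (T i) i where
  next := by
    by_cases h : i.val + 1 < n
    · rw [natSeq_of_lt _ h, natSeq_val]
      exact T_E_adj (Or.inl rfl)
    · simp [natSeq_of_le _ (not_lt.mp h), qcomm]
  cancel j hj := by
    rw [natSeq_of_lt _ (by have := i.isLt; omega : j < n), natSeq_val]
    exact T_E_cancel (Or.inr hj)
  far j hj := by
    by_cases h : j < n
    · rw [natSeq_of_lt _ h]
      exact T_E_far hj.symm
    · simp [natSeq_of_le _ (not_lt.mp h)]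

theorem isBraidAt_T_rev (i : Fin n) :
    IsBraidAt (q K) (natSeq fun j => (E (Fin.rev j) : Uq K n)) (T i) (Fin.rev i) where
  next := by
    have hi := i.isLt
    by_cases h : (Fin.rev i).val + 1 < n
    · rw [natSeq_of_lt _ h, natSeq_val, Fin.rev_rev]
      exact T_E_adj (Or.inr (by simp only [Fin.val_rev] at h ⊢; omega))
    · rw [natSeq_of_le _ (not_lt.mp h)]
      simp [qcomm]
  cancel j hj := by
    have hi := i.isLt
    rw [natSeq_of_lt _ (by have := (Fin.rev i).isLt; omega : j < n), natSeq_val, Fin.rev_rev]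
    exact T_E_cancel (Or.inl (by simp only [Fin.val_rev] at hj ⊢; omega))
  far j hj := by
    have hi := i.isLt
    by_cases h : j < n
    · rw [natSeq_of_lt _ h]
      exact T_E_far (by simp only [Fin.val_rev] at hj ⊢; omega)
    · simp [natSeq_of_le _ (not_lt.mp h)]

/-- The chain of the generators `E_{i+1}, …, E_{i+d+1}` of `U_q`. -/
noncomputable abbrev Echain (K : Type u) [Field K] (n i d : ℕ) : Uq K n :=
  chain (q K) (natSeq E) i d

/-- The chain for the opposite orientation of the diagram, built from
`E_{n-i}, E_{n-i-1}, …, E_{n-i-d}`. -/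
noncomputable abbrev EchainRev (K : Type u) [Field K] (n i d : ℕ) : Uq K n :=
  chain (q K) (natSeq fun j => E (Fin.rev j)) i d

theorem TwX_apply (x : Uq K n) : TwX K n x = (wX n).foldr (fun i y => T i y) x := by
  unfold TwX
  generalize wX n = l
  induction l with
  | nil => rfl
  | cons i l ih => rw [List.foldr_cons, List.foldr_cons, ← ih]; rfl

theorem serreSeq : SerreSequence (q K) (natSeq (E : Fin n → Uq K n)) :=
  Uq_relations.serreSequence

theorem serreSeq_rev : SerreSequence (q K) (natSeq fun j => (E (Fin.rev j) : Uq K n)) :=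
  Uq_relations.rev.serreSequence

theorem TwX_E_last (hn : 2 ≤ n) {last : Fin n} (hl : last.val + 1 = n) :
    TwX K n (E last) = Echain K n 1 (n - 2) := by
  have e : (E last : Uq K n) = Echain K n (n - 2 + 1) 0 := by
    unfold Echain chain
    rw [natSeq_of_lt _ (by omega : n - 2 + 1 < n)]
    congr 1; ext; simp; omega
  rw [TwX_apply, e, foldr_wX hn, foldr_staircase (c := Echain K n)]
  · rfl
  · intro i d h1 h2
    rw [dif_pos (by omega : i < n)]
    exact (isBraidAt_T ⟨i, by omega⟩).chain_next serreSeq d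
  · intro i j d h1 h2 h3
    rw [dif_pos (by omega : i < n)]
    exact (isBraidAt_T ⟨i, by omega⟩).chain_far (by simp; omega)

theorem T_first_TwX (hn : 2 ≤ n) {first last : Fin n} (hf : first.val = 0)
    (hl : last.val + 1 = n) : T first (TwX K n (E last)) = Echain K n 0 (n - 1) := by
  rw [TwX_E_last hn hl]
  have := (isBraidAt_T (K := K) first).chain_next serreSeq (n - 2)
  rw [hf] at this
  rw [show n - 1 = n - 2 + 1 by omega]
  exact this

theorem TwX_E_first (hn : 2 ≤ n) {first : Fin n} (hf : first.val = 0) :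
    TwX K n (E first) = EchainRev K n 1 (n - 2) := by
  have e : (E first : Uq K n) = EchainRev K n (n - 1 - 0) 0 := by
    unfold EchainRev chain
    rw [natSeq_of_lt _ (by omega : n - 1 - 0 < n)]
    congr 1; ext; simp; omega
  rw [TwX_apply, e, foldr_wX hn,
    foldr_staircase' (c := fun m => EchainRev K n (n - 1 - m) m) (N := n - 2)]
  · rw [show n - 1 - (n - 2) = 1 by omega]
  · intro i h2
    rw [dif_pos (by omega : i + 1 < n)]
    have := (isBraidAt_T_rev (K := K) (n := n) ⟨i + 1, by omega⟩).chain_next serreSeq_rev i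
    simp only [Fin.val_rev] at this
    rw [show n - (i + 1 + 1) + 1 = n - 1 - i by omega,
      show n - (i + 1 + 1) = n - 1 - (i + 1) by omega] at this
    exact this
  · intro i h1 h2
    rw [dif_pos (by omega : i < n)]
    exact (isBraidAt_T_rev (K := K) ⟨i, by omega⟩).chain_inner serreSeq_rev
      (by simp only [Fin.val_rev]; omega) (by simp only [Fin.val_rev]; omega)

theorem T_last_TwX (hn : 2 ≤ n) {first last : Fin n} (hf : first.val = 0)
    (hl : last.val + 1 = n) : T last (TwX K n (E first)) = EchainRev K n 0 (n - 1) := by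
  rw [TwX_E_first hn hf]
  have := (isBraidAt_T_rev (K := K) last).chain_next serreSeq_rev (n - 2)
  rw [show (Fin.rev last).val = 0 by simp only [Fin.val_rev]; omega] at this
  rw [show n - 1 = n - 2 + 1 by omega]
  exact this

theorem bar_qcomm (x y : Uq K n) : bar (qcomm (q K)⁻¹ x y) =
    (-q K) • qcomm (q K)⁻¹ (bar y) (bar x) := by
  have hq := q_ne K
  unfold qcomm
  rw [map_sub, map_mul, bar_smul, map_mul, map_inv₀, barScalar_q, inv_inv, smul_sub, smul_smul,
    neg_mul, mul_inv_cancel₀ hq]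
  simp [sub_eq_add_neg, add_comm]

theorem qcomm_smul_left {𝔽 A : Type*} [Field 𝔽] [Ring A] [Algebra 𝔽 A] (r t : 𝔽) (x y : A) :
    qcomm r (t • x) y = t • qcomm r x y := by
  unfold qcomm
  rw [mul_smul_comm, smul_mul_assoc, smul_comm r, ← smul_sub]

/-- The bar involution reverses the orientation of a chain. -/
theorem bar_Echain {i d : ℕ} (h : i + d < n) :
    bar (Echain K n i d) = (-q K) ^ d • EchainRev K n (n - 1 - i - d) d := by
  induction d generalizing i with
  | zero =>
    simp only [chain, pow_zero, one_smul, Nat.sub_zero]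
    rw [natSeq_of_lt _ (by omega : i < n), bar_E, natSeq_of_lt _ (by omega : n - 1 - i < n)]
    congr 1; ext; simp; omega
  | succ d ih =>
    have h1 := serreSeq_rev (K := K) (n := n) |>.chain_last (n - 1 - i - (d + 1)) d
    have h2 : natSeq (fun j => (E (Fin.rev j) : Uq K n)) (n - 1 - i - (d + 1) + d + 1) =
        natSeq E i := by
      rw [natSeq_of_lt _ (by omega), natSeq_of_lt _ (by omega : i < n)]
      congr 1; ext; simp; omega
    have h3 : bar (natSeq (E : Fin n → Uq K n) i) = natSeq E i := by
      rw [natSeq_of_lt _ (by omega : i < n), bar_E]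
    have h4 := ih (i := i + 1) (by omega)
    rw [show n - 1 - (i + 1) - d = n - 1 - i - (d + 1) by omega] at h4
    simp only [Echain, EchainRev] at h4 ⊢
    rw [chain_succ, bar_qcomm, h4, h3, h1, h2, pow_succ', mul_smul]
    rw [qcomm_smul_left]

/-- `bar_Echain` for the opposite orientation. -/
theorem bar_EchainRev {i d : ℕ} (h : i + d < n) :
    bar (EchainRev K n i d) = (-q K) ^ d • Echain K n (n - 1 - i - d) d := by
  induction d generalizing i with
  | zero =>
    simp only [chain, pow_zero, one_smul, Nat.sub_zero]
    rw [natSeq_of_lt _ (by omega : i < n), bar_E, natSeq_of_lt _ (by omega : n - 1 - i < n)]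
    congr 1; ext; simp; omega
  | succ d ih =>
    have h1 := serreSeq (K := K) (n := n) |>.chain_last (n - 1 - i - (d + 1)) d
    have h2 : natSeq (fun j => (E (Fin.rev j) : Uq K n)) i =
        natSeq E (n - 1 - i - (d + 1) + d + 1) := by
      rw [natSeq_of_lt _ (by omega), natSeq_of_lt _ (by omega : n - 1 - i - (d + 1) + d + 1 < n)]
      congr 1; ext; simp; omega
    have h3 : bar (natSeq (fun j => (E (Fin.rev j) : Uq K n)) i) =
        natSeq (fun j => (E (Fin.rev j) : Uq K n)) i := by
      rw [natSeq_of_lt _ (by omega : i < n), bar_E]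
    have h4 := ih (i := i + 1) (by omega)
    rw [show n - 1 - (i + 1) - d = n - 1 - i - (d + 1) by omega] at h4
    simp only [Echain, EchainRev] at h4 ⊢
    rw [chain_succ, bar_qcomm, h4, h3, h1, h2, pow_succ', mul_smul]
    rw [qcomm_smul_left]

end UqRootVectors

/-! ### Involutivity of the bar involutions -/

section BarInvolutive

variable {K : Type u} [Field K] {n : ℕ}

theorem barScalar_C (a : K) : barScalar K (RatFunc.C a) = RatFunc.C a := by
  rw [← RatFunc.algebraMap_eq_C]
  exact (barScalar K).commutes a

theorem barScalar_barScalar (a : RatFunc K) : barScalar K (barScalar K a) = a := by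
  have hp : ∀ p : Polynomial K, barScalar K (barScalar K (algebraMap _ _ p)) =
      algebraMap (Polynomial K) (RatFunc K) p := by
    intro p
    induction p using Polynomial.induction_on' with
    | add p r hp hr => rw [map_add, map_add, map_add, hp, hr]
    | monomial k a =>
      rw [← Polynomial.C_mul_X_pow_eq_monomial, map_mul, map_pow, RatFunc.algebraMap_C,
        RatFunc.algebraMap_X, map_mul, map_mul, map_pow, map_pow, barScalar_C, barScalar_C]
      have : barScalar K (barScalar K (RatFunc.X)) = RatFunc.X := by
        change barScalar K (barScalar K (q K)) = q K
        rw [barScalar_q, map_inv₀, barScalar_q, inv_inv]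
      rw [this]
  induction a using RatFunc.induction_on with
  | f p r hr => rw [map_div₀, map_div₀, hp, hp]

/-- Induction over the generators of `U_q`. -/
theorem Uq_induction {P : Uq K n → Prop} (scalar : ∀ a : RatFunc K, P (algebraMap _ _ a))
    (hE : ∀ i, P (E i)) (hF : ∀ i, P (F i)) (hK : ∀ i, P (Kg i)) (hL : ∀ i, P (Ki i))
    (add : ∀ x y, P x → P y → P (x + y)) (mul : ∀ x y, P x → P y → P (x * y)) (x : Uq K n) :
    P x := by
  obtain ⟨y, rfl⟩ := RingQuot.mkAlgHom_surjective (RatFunc K) (Rel K n) x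
  change P (mkUq K n y)
  induction y using FreeAlgebra.induction with
  | grade0 a => rw [AlgHom.commutes]; exact scalar a
  | grade1 g => cases g; exacts [hE _, hF _, hK _, hL _]
  | mul a b ha hb => rw [map_mul]; exact mul _ _ ha hb
  | add a b ha hb => rw [map_add]; exact add _ _ ha hb

theorem bar_algebraMap (a : RatFunc K) :
    bar (algebraMap (RatFunc K) (Uq K n) a) = algebraMap _ _ (barScalar K a) := by
  rw [Algebra.algebraMap_eq_smul_one, bar_smul, map_one, ← Algebra.algebraMap_eq_smul_one]

theorem bar_bar (x : Uq K n) : bar (bar x) = x := by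
  induction x using Uq_induction with
  | scalar a => rw [bar_algebraMap, bar_algebraMap, barScalar_barScalar]
  | hE i => rw [bar_E, bar_E]
  | hF i => rw [bar_F, bar_F]
  | hK i => rw [bar_Kg, bar_Ki]
  | hL i => rw [bar_Ki, bar_Kg]
  | add x y hx hy => rw [map_add, map_add, hx, hy]
  | mul x y hx hy => rw [map_mul, map_mul, hx, hy]

end BarInvolutive

/-! ### The parameters -/

section Parameters

variable {K : Type u} [Field K] {n : ℕ}

theorem rev_first {first last : Fin n} (hf : first.val = 0) (hl : last.val + 1 = n) :
    Fin.rev first = last := by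
  ext; simp [hf]; omega

theorem rev_last {first last : Fin n} (hf : first.val = 0) (hl : last.val + 1 = n) :
    Fin.rev last = first := by
  ext; simp [hf]; omega

/-- The condition on the parameters in the form in which it enters the recursion for the quasi
`K`-matrix. -/
theorem parameter_first (hn : 2 ≤ n) {s : Fin n → K} (hs : IsSignFunction s)
    {c : Fin n → RatFunc K} (hc : IsParameter c) {first last : Fin n} (hf : first.val = 0)
    (hl : last.val + 1 = n) :
    (q K)⁻¹ * (c last * RatFunc.C (s first)) =
      (-q K) ^ (n - 2) * barScalar K (c first * RatFunc.C (s last)) := by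
  have hb : ¬ Black first := by simp [hf]
  have hr := rev_first hf hl
  have h1 := hc.bar_rel first hb
  have h2 := hs.ratio first hb (by rw [hr]; rintro rfl; omega)
  rw [form_alpha_first_twoRhoX hn hf, hr, div_eq_iff (hs.ne_zero _)] at h2
  rw [form_alpha_first_Theta hn hf, hr] at h1
  have hq := q_ne K
  have h3 : ((-1 : K)) ^ (-((n - 2 : ℕ) : ℤ)) = (-1) ^ (n - 2) := by
    rw [zpow_neg, zpow_natCast, ← inv_pow]; norm_num
  rw [h1, h2, h3, map_mul, map_mul (barScalar K), barScalar_C, map_pow, zpow_natCast,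
    show n - 1 = n - 2 + 1 by omega]
  simp only [map_neg, map_one]
  rw [neg_pow (q K), pow_succ]
  field_simp

theorem parameter_last (hn : 2 ≤ n) {s : Fin n → K} (hs : IsSignFunction s)
    {c : Fin n → RatFunc K} (hc : IsParameter c) {first last : Fin n} (hf : first.val = 0)
    (hl : last.val + 1 = n) :
    (q K)⁻¹ * (c first * RatFunc.C (s last)) =
      (-q K) ^ (n - 2) * barScalar K (c last * RatFunc.C (s first)) := by
  have h := congrArg (barScalar K) (parameter_first hn hs hc hf hl)
  have hq := q_ne K
  rw [map_mul, map_mul _ ((-q K) ^ (n - 2)), barScalar_barScalar, map_inv₀, map_pow, map_neg,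
    barScalar_q, inv_inv] at h
  have h2 : (-q K) ^ (n - 2) * (-(q K)⁻¹) ^ (n - 2) = 1 := by
    rw [← mul_pow]; simp [hq]
  linear_combination (-((-q K) ^ (n - 2) * (q K)⁻¹)) * h
    - ((q K)⁻¹ * (c first * RatFunc.C (s last))) * h2
    + (-q K) ^ (n - 2) * barScalar K (c last * RatFunc.C (s first)) * (inv_mul_cancel₀ hq)

end Parameters

/-! ### `q`-exponentials -/

section HighestRelations

variable {𝔽 A : Type*} [Field 𝔽] [Ring A] [Algebra 𝔽 A] {q : 𝔽} {n : ℕ} {E F K L : Fin n → A}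

namespace QuantumRelations

/-- The first input of the `q`-exponential recursion: the commutator of the first lowering generator
with the root vector of the highest root. -/
theorem lower_highest (hq : q ≠ 0) (hq1 : q ^ 2 - 1 ≠ 0) (h : QuantumRelations q E F K L)
    (hn : 2 ≤ n) {first : Fin n} (hf : first.val = 0) :
    F first * chain q (natSeq E) 0 (n - 1) = chain q (natSeq E) 0 (n - 1) * F first +
      chain q (natSeq E) 1 (n - 2) * L first := by
  have := h.chain_lower_first hq hq1 first (d := n - 2) (by omega)
  rw [hf, show n - 2 + 1 = n - 1 by omega, zero_add] at this
  rw [sub_eq_iff_eq_add] at this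
  rw [this]; abel

/-- The root vector of the highest root `q²`-commutes with its commutator with the first lowering
generator. -/
theorem highest_mul (hq : q ≠ 0) (hq2 : q ^ 2 + 1 ≠ 0) (h : QuantumRelations q E F K L)
    (hn : 2 ≤ n) {first : Fin n} (hf : first.val = 0) :
    chain q (natSeq E) 0 (n - 1) * (chain q (natSeq E) 1 (n - 2) * L first) =
      q ^ 2 • (chain q (natSeq E) 1 (n - 2) * L first * chain q (natSeq E) 0 (n - 1)) := by
  have h1 := h.serreSequence.chain_mul_chain hq hq2 (i := 0) (j := 1) (d := n - 1) (d' := n - 2)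
    (by omega) (by omega)
  have h2 := (h.W_highest hq hn first).inv hq (h.KL _) (h.LK _)
  rw [if_pos hf, if_neg (by omega)] at h2
  unfold W at h2
  simp only [add_zero, zpow_neg, zpow_one] at h2
  rw [← mul_assoc, h1, mul_assoc, h2, smul_mul_assoc, mul_smul_comm, smul_smul, mul_assoc]
  congr 1
  field_simp

/-- The counterpart of `lower_highest` for the last lowering generator. -/
theorem lower_highest_rev (hq : q ≠ 0) (hq1 : q ^ 2 - 1 ≠ 0) (h : QuantumRelations q E F K L)
    (hn : 2 ≤ n) {last : Fin n} (hl : last.val + 1 = n) :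
    F last * chain q (natSeq E) 0 (n - 1) = chain q (natSeq E) 0 (n - 1) * F last -
      q⁻¹ • (chain q (natSeq E) 0 (n - 2) * K last) := by
  have := h.chain_lower_last hq hq1 last (i := 0) (d := n - 2) (by omega)
  rw [show n - 2 + 1 = n - 1 by omega, sub_eq_iff_eq_add] at this
  rw [this]; abel

/-- The counterpart of `highest_mul` for the last lowering generator. -/
theorem mul_highest (hq : q ≠ 0) (hq2 : q ^ 2 + 1 ≠ 0) (h : QuantumRelations q E F K L)
    (hn : 2 ≤ n) {last : Fin n} (hl : last.val + 1 = n) :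
    chain q (natSeq E) 0 (n - 2) * K last * chain q (natSeq E) 0 (n - 1) =
      q ^ 2 • (chain q (natSeq E) 0 (n - 1) * (chain q (natSeq E) 0 (n - 2) * K last)) := by
  have h1 := chain_W (r := q) (e := natSeq E) (i := 0) (d := n - 2)
    (m := fun j => if j = 0 then -1 else 0) hq
    (k := chain q (natSeq E) 0 (n - 1)) (fun j _ hj => by
      refine (h.highest_W hq hq2 hn j (by omega)).of_eq ?_
      split_ifs <;> first | rfl | omega)
  have e : ∑ j ∈ Finset.range (n - 2 + 1), (fun j => if j = 0 then (-1 : ℤ) else 0) (0 + j) =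
      -1 := by simp
  rw [e] at h1
  have h2 := h.W_highest hq hn last
  rw [if_neg (by omega), if_pos hl] at h2
  unfold W at h1 h2
  simp only [zero_add, zpow_neg, zpow_one] at h1 h2
  have h3 : chain q (natSeq E) 0 (n - 2) * chain q (natSeq E) 0 (n - 1) =
      q • (chain q (natSeq E) 0 (n - 1) * chain q (natSeq E) 0 (n - 2)) := by
    rw [h1, smul_smul, mul_inv_cancel₀ hq, one_smul]
  rw [mul_assoc, h2, mul_smul_comm, ← mul_assoc, h3, smul_mul_assoc, smul_smul, ← mul_assoc, pow_two]

theorem highest_commute_black (hq : q ≠ 0) (hq1 : q ^ 2 - 1 ≠ 0) (hq2 : q ^ 2 + 1 ≠ 0)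
    (h : QuantumRelations q E F K L) (hn : 2 ≤ n) {j : Fin n} (hj : Black j) :
    Commute (E j) (chain q (natSeq E) 0 (n - 1)) ∧ Commute (F j) (chain q (natSeq E) 0 (n - 1)) ∧
      Commute (K j) (chain q (natSeq E) 0 (n - 1)) ∧
        Commute (L j) (chain q (natSeq E) 0 (n - 1)) := by
  obtain ⟨h1, h2⟩ := hj
  have hW := h.W_highest hq hn j
  rw [if_neg (by omega), if_neg (by omega)] at hW
  have hW' := hW.inv hq (h.KL _) (h.LK _)
  unfold W at hW hW'
  refine ⟨?_, h.chain_lower_inner hq hq1 j h1 (by omega) (by omega), (by simpa using hW : _ = _),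
    (by simpa using hW' : _ = _)⟩
  have := h.serreSequence.commute_inner hq hq2 (i := 0) (d := n - 1) h1 (by omega)
  rwa [natSeq_val] at this

end QuantumRelations

end HighestRelations

section QExp

open PowerSeries

variable {K : Type u} [Field K]

theorem qNumber_succ (k : ℕ) : qNumber K (k + 1) = qNumber K k + q K ^ (2 * k) := by
  unfold qNumber
  rw [Finset.sum_range_succ]

theorem qNumber_succ' (k : ℕ) : qNumber K (k + 1) = 1 + q K ^ 2 * qNumber K k := by
  unfold qNumber
  rw [Finset.sum_range_succ', Finset.mul_sum, add_comm]
  congr 1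
  exact Finset.sum_congr rfl fun j _ => by ring

/-- `q` is not a root of unity. -/
theorem q_pow_ne_one {k : ℕ} (hk : k ≠ 0) : q K ^ k ≠ 1 := by
  intro h
  have := q_poly K (Polynomial.monic_X_pow_sub_C (1 : K) hk)
  apply this
  simp only [map_sub, map_pow, RatFunc.algebraMap_X, map_one, sub_eq_zero]
  exact h

theorem qNumber_ne_zero (k : ℕ) : qNumber K (k + 1) ≠ 0 := by
  intro h
  have e : ∀ k, qNumber K k * (q K ^ 2 - 1) = q K ^ (2 * k) - 1 := by
    intro k
    induction k with
    | zero => simp [qNumber]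
    | succ k ih => rw [qNumber_succ, add_mul, ih]; ring
  have := e (k + 1)
  rw [h, zero_mul] at this
  exact q_pow_ne_one (K := K) (k := 2 * (k + 1)) (by omega) (by linear_combination -this)

theorem qFactorial_succ (k : ℕ) : qFactorial K (k + 1) = qFactorial K k * qNumber K (k + 1) := by
  unfold qFactorial
  rw [Finset.prod_range_succ]

theorem qFactorial_ne_zero (k : ℕ) : qFactorial K k ≠ 0 :=
  Finset.prod_ne_zero_iff.mpr fun j _ => qNumber_ne_zero j

variable {A : Type*} [Ring A] [Algebra (RatFunc K) A]

/-- If `D = [p, u]` satisfies `u D = q² D u`, then `[p, ·]` differentiates powers of `u` with factor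
`{k}`, the derivative `D` being collected on the left. -/
theorem mul_pow_of_left {p u D : A} (h : p * u = u * p + D) (hD : u * D = q K ^ 2 • (D * u))
    (k : ℕ) : p * u ^ (k + 1) = u ^ (k + 1) * p + qNumber K (k + 1) • (D * u ^ k) := by
  have hk : ∀ k : ℕ, u ^ k * D = q K ^ (2 * k) • (D * u ^ k) := by
    intro k
    induction k with
    | zero => simp
    | succ k ih =>
      rw [pow_succ', mul_assoc, ih, mul_smul_comm, ← mul_assoc, hD, smul_mul_assoc, smul_smul,
        mul_assoc]
      congr 1; ring
  induction k with
  | zero => simp [h, qNumber]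
  | succ k ih =>
    rw [pow_succ u (k + 1), ← mul_assoc, ih, add_mul, mul_assoc, h, mul_add, hk (k + 1),
      qNumber_succ (k + 1), add_smul, smul_mul_assoc, mul_assoc D, ← pow_succ, mul_assoc,
      add_assoc, add_comm (qNumber K (k + 1) • _)]

/-- The mirror image of `mul_pow_of_left`, with the derivative collected on the right. -/
theorem mul_pow_of_right {p v G : A} (h : p * v = v * p - G) (hG : G * v = q K ^ 2 • (v * G))
    (k : ℕ) : p * v ^ (k + 1) = v ^ (k + 1) * p - qNumber K (k + 1) • (v ^ k * G) := by
  induction k with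
  | zero => simp [h, qNumber]
  | succ k ih =>
    rw [pow_succ v (k + 1), ← mul_assoc, ih, sub_mul, mul_assoc, h, mul_sub,
      qNumber_succ' (k + 1), add_smul, one_smul, smul_mul_assoc, mul_assoc (v ^ k), hG,
      mul_smul_comm, ← mul_assoc (v ^ k), ← pow_succ, mul_assoc, smul_smul,
      mul_comm (qNumber K (k + 1)), sub_sub]

/-- The `q`-exponential `∑ a^k / {k}! u^k t^k` as a power series in a central variable `t`. -/
noncomputable def qExpSeries (a : RatFunc K) (u : A) : A⟦X⟧ :=
  PowerSeries.mk fun k => (a ^ k / qFactorial K k) • u ^ k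

/-- The `q`-exponential of `u` solves the differential equation belonging to `D = [p, u]`. -/
theorem C_mul_qExpSeries {p u D : A} (h : p * u = u * p + D) (hD : u * D = q K ^ 2 • (D * u))
    (a : RatFunc K) : C p * qExpSeries a u =
      qExpSeries a u * C p + X * (C (a • D) * qExpSeries a u) := by
  ext k
  cases k with
  | zero => simp [qExpSeries, qFactorial]
  | succ k =>
    rw [map_add, coeff_succ_X_mul]
    simp only [coeff_C_mul, coeff_mul_C, qExpSeries, coeff_mk]
    rw [mul_smul_comm, mul_pow_of_left h hD, smul_add, smul_mul_assoc, smul_mul_assoc,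
      mul_smul_comm, smul_smul, smul_smul, qFactorial_succ]
    have h1 := qFactorial_ne_zero (K := K) k
    have h2 := qNumber_ne_zero (K := K) k
    congr 2
    rw [pow_succ]
    field_simp

/-- The `q`-exponential of `v` solves the differential equation belonging to `-G = [p, v]`. -/
theorem C_mul_qExpSeries' {p v G : A} (h : p * v = v * p - G) (hG : G * v = q K ^ 2 • (v * G))
    (b : RatFunc K) : C p * qExpSeries b v =
      qExpSeries b v * C p - X * (qExpSeries b v * C (b • G)) := by
  ext k
  cases k with
  | zero => simp [qExpSeries, qFactorial]
  | succ k =>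
    rw [map_sub, coeff_succ_X_mul]
    simp only [coeff_C_mul, coeff_mul_C, qExpSeries, coeff_mk]
    rw [mul_smul_comm, mul_pow_of_right h hG, smul_sub, smul_mul_assoc, smul_mul_assoc,
      mul_smul_comm, smul_smul, smul_smul, qFactorial_succ]
    have h1 := qFactorial_ne_zero (K := K) k
    have h2 := qNumber_ne_zero (K := K) k
    congr 2
    rw [pow_succ]
    field_simp

theorem C_commute_qExpSeries {p u : A} (h : Commute p u) (a : RatFunc K) :
    Commute (C p) (qExpSeries a u) := by
  ext k
  simp only [coeff_C_mul, coeff_mul_C, qExpSeries, coeff_mk]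
  rw [mul_smul_comm, smul_mul_assoc, (h.pow_right k).eq]

theorem qExpSeries_commute {u v : A} (h : Commute u v) (a b : RatFunc K) :
    Commute (qExpSeries a u) (qExpSeries b v) := by
  ext k
  rw [coeff_mul, coeff_mul, ← Finset.Nat.sum_antidiagonal_swap]
  refine Finset.sum_congr rfl fun p _ => ?_
  simp only [qExpSeries, coeff_mk, Prod.fst_swap, Prod.snd_swap]
  rw [smul_mul_smul_comm, smul_mul_smul_comm, (h.pow_pow _ _).eq, mul_comm]

/-- Conjugation of `p` by the product of two `q`-exponentials. -/
theorem C_mul_qExpSeries_mul {p u v D G : A} (h : p * u = u * p + D)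
    (hD : u * D = q K ^ 2 • (D * u)) (h' : p * v = v * p - G) (hG : G * v = q K ^ 2 • (v * G))
    (a b : RatFunc K) :
    C (p) * (qExpSeries a u * qExpSeries b v) = qExpSeries a u * qExpSeries b v * C p
      + X * (C (a • D) * (qExpSeries a u * qExpSeries b v))
      - X * (qExpSeries a u * qExpSeries b v * C (b • G)) := by
  have h1 := C_mul_qExpSeries h hD a
  have h2 := C_mul_qExpSeries' h' hG b
  generalize qExpSeries a u = Y at *
  generalize qExpSeries b v = Z at *
  rw [← mul_assoc, h1, add_mul, mul_assoc Y, h2, mul_sub, ← mul_assoc Y X, (commute_X Y).eq]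
  simp only [mul_assoc]
  abel

end QExp

/-! ### The conjugation identities for the quasi `K`-matrix -/

section Conjugation

open PowerSeries

variable {K : Type u} [Field K] {n : ℕ}

/-- The product of `q`-exponentials of the main formula, as a power series over `U_q`. -/
noncomputable def quasiSeries (K : Type u) [Field K] (n : ℕ) (a b : RatFunc K) : (Uq K n)⟦X⟧ :=
  qExpSeries a (Echain K n 0 (n - 1)) * qExpSeries b (EchainRev K n 0 (n - 1))

theorem Echain_commute (hn : 2 ≤ n) :
    Commute (Echain K n 0 (n - 1)) (EchainRev K n 0 (n - 1)) :=
  Uq_relations.highest_commute (q_ne K) (q_sq_add_one K) hn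

theorem C_commute_quasiSeries {p : Uq K n} (hu : Commute p (Echain K n 0 (n - 1)))
    (hv : Commute p (EchainRev K n 0 (n - 1))) (a b : RatFunc K) :
    Commute (C p) (quasiSeries K n a b) :=
  (C_commute_qExpSeries hu a).mul_right (C_commute_qExpSeries hv b)

/-- The coefficient with which `T_{w_X}(E_{τ(i)}) K_i⁻¹` enters `B_i`. -/
noncomputable def Bcoeff (s : Fin n → K) (c : Fin n → RatFunc K) (i : Fin n) : RatFunc K :=
  c i * RatFunc.C (s (Fin.rev i))

/-- The relation `B_1 𝔛 = 𝔛 bar(B_1)`, refined by the variable of the power series. The first factor of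
`𝔛` produces the second summand of `B_1`, the second factor its image under the bar involution. -/
theorem C_F_first_mul (hn : 2 ≤ n) {s : Fin n → K} (hs : IsSignFunction s)
    {c : Fin n → RatFunc K} (hc : IsParameter c) {first last : Fin n} (hf : first.val = 0)
    (hl : last.val + 1 = n) :
    C (F first) * quasiSeries K n (Bcoeff s c first) (Bcoeff s c last) =
      quasiSeries K n (Bcoeff s c first) (Bcoeff s c last) * C (F first)
      + X * (C (Bcoeff s c first • (TwX K n (E last) * Ki first)) *
          quasiSeries K n (Bcoeff s c first) (Bcoeff s c last))
      - X * (quasiSeries K n (Bcoeff s c first) (Bcoeff s c last) *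
          C (bar (Bcoeff s c first • (TwX K n (E last) * Ki first)))) := by
  have h := Uq_relations (K := K) (n := n)
  have hr := rev_first hf hl
  have hr' := rev_last hf hl
  have e : bar (Bcoeff s c first • (TwX K n (E last) * Ki first)) =
      Bcoeff s c last • ((q K)⁻¹ • (EchainRev K n 0 (n - 2) * Kg first)) := by
    rw [bar_smul, map_mul, bar_Ki, TwX_E_last hn hl, bar_Echain (by omega), smul_mul_assoc,
      smul_smul, smul_smul, show n - 1 - 1 - (n - 2) = 0 by omega]
    congr 1
    have := parameter_first hn hs hc hf hl
    unfold Bcoeff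
    rw [hr, hr']
    linear_combination -this
  rw [e, TwX_E_last hn hl]
  have h3 := h.rev.lower_highest_rev (q_ne K) (q_sq_sub_one K) hn hl
  have h4 := h.rev.mul_highest (q_ne K) (q_sq_add_one K) hn hl
  rw [hr'] at h3 h4
  exact C_mul_qExpSeries_mul (h.lower_highest (q_ne K) (q_sq_sub_one K) hn hf)
    (h.highest_mul (q_ne K) (q_sq_add_one K) hn hf) h3
    (by rw [smul_mul_assoc, h4, mul_smul_comm, smul_comm]) _ _

/-- The relation `B_n 𝔛 = 𝔛 bar(B_n)`. The two factors of `𝔛` exchange their roles, which is harmless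
since they commute. -/
theorem C_F_last_mul (hn : 2 ≤ n) {s : Fin n → K} (hs : IsSignFunction s)
    {c : Fin n → RatFunc K} (hc : IsParameter c) {first last : Fin n} (hf : first.val = 0)
    (hl : last.val + 1 = n) :
    C (F last) * quasiSeries K n (Bcoeff s c first) (Bcoeff s c last) =
      quasiSeries K n (Bcoeff s c first) (Bcoeff s c last) * C (F last)
      + X * (C (Bcoeff s c last • (TwX K n (E first) * Ki last)) *
          quasiSeries K n (Bcoeff s c first) (Bcoeff s c last))
      - X * (quasiSeries K n (Bcoeff s c first) (Bcoeff s c last) *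
          C (bar (Bcoeff s c last • (TwX K n (E first) * Ki last)))) := by
  have h := Uq_relations (K := K) (n := n)
  have hr := rev_first hf hl
  have hr' := rev_last hf hl
  have e : bar (Bcoeff s c last • (TwX K n (E first) * Ki last)) =
      Bcoeff s c first • ((q K)⁻¹ • (Echain K n 0 (n - 2) * Kg last)) := by
    rw [bar_smul, map_mul, bar_Ki, TwX_E_first hn hf, bar_EchainRev (by omega), smul_mul_assoc,
      smul_smul, smul_smul, show n - 1 - 1 - (n - 2) = 0 by omega]
    congr 1
    have := parameter_last hn hs hc hf hl
    unfold Bcoeff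
    rw [hr, hr']
    linear_combination -this
  rw [e, TwX_E_first hn hf]
  have h1 := h.rev.lower_highest (q_ne K) (q_sq_sub_one K) hn hf
  have h2 := h.rev.highest_mul (q_ne K) (q_sq_add_one K) hn hf
  rw [hr] at h1 h2
  have h4 := h.mul_highest (q_ne K) (q_sq_add_one K) hn hl
  unfold quasiSeries
  rw [(qExpSeries_commute (Echain_commute hn) _ _).eq]
  exact C_mul_qExpSeries_mul h1 h2 (h.lower_highest_rev (q_ne K) (q_sq_sub_one K) hn hl)
    (by rw [smul_mul_assoc, h4, mul_smul_comm, smul_comm]) _ _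

end Conjugation

/-! ### Comultiplication -/

section Coproduct

variable {𝔽 A : Type*} [Field 𝔽] [Ring A] [Algebra 𝔽 A] {q : 𝔽}

theorem W.add {K u v : A} {m : ℤ} (h : W q K u m) (h' : W q K v m) : W q K (u + v) m := by
  unfold W at *
  rw [mul_add, h, h', add_mul, smul_add]

/-- The Serre relation for sums of `q`-commuting solutions. -/
theorem Serre.add {a a' b b' : A} (hq : q ≠ 0) (ha : Serre q a a') (hb : Serre q b b')
    (h1 : a * b = (q⁻¹ * q⁻¹) • (b * a)) (h2 : a * b' = q • (b' * a)) (h3 : a' * b = q • (b * a')) :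
    Serre q (a + b) (a' + b') := by
  have h1' : ∀ z, a * (b * z) = (q⁻¹ * q⁻¹) • (b * (a * z)) := fun z => by
    rw [← mul_assoc, h1, smul_mul_assoc, mul_assoc]
  have h2' : ∀ z, a * (b' * z) = q • (b' * (a * z)) := fun z => by
    rw [← mul_assoc, h2, smul_mul_assoc, mul_assoc]
  have h3' : ∀ z, a' * (b * z) = q • (b * (a' * z)) := fun z => by
    rw [← mul_assoc, h3, smul_mul_assoc, mul_assoc]
  unfold Serre at *
  linear_combination (norm := (
    simp only [mul_sub, sub_mul, mul_add, add_mul, smul_mul_assoc, mul_smul_comm, mul_assoc,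
      smul_sub, smul_add, smul_smul, smul_zero, mul_zero, zero_mul, h1, h2, h3, h1', h2', h3']
    match_scalars <;> field_simp <;> ring)) ha + hb

theorem Serre.mul_commute {x y z w : A} (h : Serre q x y) (hxz : Commute x z) (hyz : Commute y z)
    (hxw : Commute x w) (hzw : Commute z w) : Serre q (x * z) (y * w) := by
  have c1 := hxz.symm.eq
  have c2 := hyz.symm.eq
  have c3 := hxw.symm.eq
  have c4 := hzw.symm.eq
  have c1' := fun t => assoc_comm c1 t
  have c2' := fun t => assoc_comm c2 t
  have c3' := fun t => assoc_comm c3 t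
  have e1 : x * z * (x * z) * (y * w) = x * x * y * (z * z * w) := by
    simp only [mul_assoc, c1, c2, c3, c4, c1', c2', c3']
  have e2 : x * z * (y * w) * (x * z) = x * y * x * (z * z * w) := by
    simp only [mul_assoc, c1, c2, c3, c4, c1', c2', c3']
  have e3 : y * w * (x * z) * (x * z) = y * x * x * (z * z * w) := by
    simp only [mul_assoc, c1, c2, c3, c4, c1', c2', c3', assoc_comm c4]
  unfold Serre at *
  rw [e1, e2, e3, ← smul_mul_assoc, ← sub_mul, ← add_mul, h, zero_mul]

namespace QuantumRelations

variable {n : ℕ} {E F K L E' F' K' L' : Fin n → A}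

theorem map {B : Type*} [Ring B] [Algebra 𝔽 B] (h : QuantumRelations q E F K L) (f : A →ₐ[𝔽] B) :
    QuantumRelations q (fun i => f (E i)) (fun i => f (F i)) (fun i => f (K i))
      (fun i => f (L i)) where
  KL i := by rw [← map_mul, h.KL, map_one]
  LK i := by rw [← map_mul, h.LK, map_one]
  KK i j := by rw [← map_mul, h.KK, map_mul]
  KE i j := by rw [← map_mul, h.KE, map_smul, map_mul]
  KF i j := by rw [← map_mul, h.KF, map_smul, map_mul]
  EF i j := by
    rw [← map_mul, ← map_mul, ← map_sub, h.EF]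
    split_ifs
    · rw [map_smul, map_sub]
    · exact map_zero _
  EE i j hij := by rw [← map_mul, h.EE i j hij, map_mul]
  FF i j hij := by rw [← map_mul, h.FF i j hij, map_mul]
  serreE i j hij := by
    have := congrArg f (h.serreE i j hij)
    simpa only [map_add, map_sub, map_mul, map_smul, map_zero] using this
  serreF i j hij := by
    have := congrArg f (h.serreF i j hij)
    simpa only [map_add, map_sub, map_mul, map_smul, map_zero] using this

/-- The comultiplication `E ↦ E ⊗ K⁻¹ + 1 ⊗ E`, `F ↦ F ⊗ 1 + K ⊗ F`, `K ↦ K ⊗ K`, for two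
commuting realizations of the relations in one algebra. -/
theorem coproduct (hq : q ≠ 0) (h : QuantumRelations q E F K L)
    (h' : QuantumRelations q E' F' K' L')
    {S S' : Subalgebra 𝔽 A} (hS : ∀ x ∈ S, ∀ y ∈ S', Commute x y)
    (hE : ∀ i, E i ∈ S) (hF : ∀ i, F i ∈ S) (hK : ∀ i, K i ∈ S) (hL : ∀ i, L i ∈ S)
    (hE' : ∀ i, E' i ∈ S') (hF' : ∀ i, F' i ∈ S') (hK' : ∀ i, K' i ∈ S') (hL' : ∀ i, L' i ∈ S') :
    QuantumRelations q (fun i => E i * L' i + E' i) (fun i => F i + K i * F' i)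
      (fun i => K i * K' i) (fun i => L i * L' i) where
  KL i := by
    rw [mul_assoc, ← mul_assoc (K' i), ← (hS _ (hL i) _ (hK' i)).eq, mul_assoc (L i), h'.KL,
      mul_one, h.KL]
  LK i := by
    rw [mul_assoc, ← mul_assoc (L' i), ← (hS _ (hK i) _ (hL' i)).eq, mul_assoc (K i), h'.LK,
      mul_one, h.LK]
  KK i j := by
    exact Commute.mul_left (Commute.mul_right (h.KK i j) (hS _ (hK i) _ (hK' j)))
      (Commute.mul_right (hS _ (hK j) _ (hK' i)).symm (h'.KK i j))
  KE i j := by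
    have w1 : W q (K i) (E j * L' j) (CartanMatrix.A n i j) :=
      ((h.wE i j).mul hq (W.comm (hS _ (hK i) _ (hL' j)).eq)).of_eq (add_zero _)
    have w2 : W q (K' i) (E j * L' j) 0 := by
      refine ((W.comm (hS _ (hE j) _ (hK' i)).symm.eq).mul hq (W.comm ?_)).of_eq (add_zero 0)
      have : W q (L' j) (K' i) 0 :=
        ((W.comm (h'.KK j i)).inv hq (h'.KL j) (h'.LK j)).of_eq neg_zero
      unfold W at this
      simpa using this.symm
    have w3 : W q (K i) (E' j) 0 := W.comm (hS _ (hK i) _ (hE' j)).eq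
    exact ((w1.mulK hq w2).of_eq (add_zero _)).add ((w3.mulK hq (h'.wE i j)).of_eq (zero_add _))
  KF i j := by
    have w1 : W q (K i) (F j) (-CartanMatrix.A n i j) := h.wF i j
    have w2 : W q (K' i) (F j) 0 := W.comm (hS _ (hF j) _ (hK' i)).symm.eq
    have w3 : W q (K i) (K j * F' j) 0 :=
      ((W.comm (h.KK i j)).mul hq (W.comm (hS _ (hK i) _ (hF' j)).eq)).of_eq (add_zero _)
    have w4 : W q (K' i) (K j * F' j) (-CartanMatrix.A n i j) :=
      ((W.comm (hS _ (hK j) _ (hK' i)).symm.eq).mul hq (h'.wF i j)).of_eq (zero_add _)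
    exact ((w1.mulK hq w2).of_eq (add_zero _)).add ((w3.mulK hq w4).of_eq (zero_add _))
  EF i j := by
    have c1 := (hS _ (hF j) _ (hL' i)).eq
    have c2 := (hS _ (hF j) _ (hE' i)).eq
    have c3 := (hS _ (hK j) _ (hE' i)).eq
    have c4 := (hS _ (hK j) _ (hL' i)).eq
    have c5 := (hS _ (hE i) _ (hF' j)).eq
    have e1 : E i * L' i * (K j * F' j) = K j * F' j * (E i * L' i) := by
      have w := (h'.wF i j).inv hq (h'.KL i) (h'.LK i)
      have w' := h.wE j i
      unfold W at w w'
      rw [neg_neg] at w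
      rw [cartan_symm] at w'
      calc E i * L' i * (K j * F' j) = E i * (L' i * K j) * F' j := by simp only [mul_assoc]
        _ = E i * K j * (L' i * F' j) := by rw [← c4]; simp only [mul_assoc]
        _ = K j * E i * (F' j * L' i) := by rw [w, w', mul_smul_comm, smul_mul_assoc]
        _ = K j * (E i * F' j) * L' i := by simp only [mul_assoc]
        _ = _ := by rw [c5]; simp only [mul_assoc]
    have e2 : (E i * L' i + E' i) * (F j + K j * F' j) - (F j + K j * F' j) * (E i * L' i + E' i) =
        (E i * F j - F j * E i) * L' i + K j * (E' i * F' j - F' j * E' i) := by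
      have e3 : E i * L' i * F j = E i * F j * L' i := by rw [mul_assoc, ← c1, mul_assoc]
      have e4 : E' i * (K j * F' j) = K j * (E' i * F' j) := by
        rw [← mul_assoc, ← c3, mul_assoc]
      rw [add_mul, mul_add, mul_add, add_mul, mul_add, mul_add, e1, e3, e4, ← c2]
      simp only [sub_mul, mul_sub, mul_assoc]
      abel
    rw [e2, h.EF, h'.EF]
    by_cases hij : i = j
    · subst hij
      simp only [if_true, smul_mul_assoc, mul_smul_comm, sub_mul, mul_sub, ← smul_add]
      congr 1
      abel
    · simp [hij]
  EE i j hij := by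
    have hji := (cartan_symm j i).trans hij
    have w1 := (h'.wL hq i j)
    have w2 := (h'.wL hq j i)
    rw [hij] at w1
    rw [hji] at w2
    unfold W at w1 w2
    simp only [neg_zero, zpow_zero, one_smul] at w1 w2
    have c0 : Commute (L' i) (L' j) := (h'.swap hq).KK i j
    have a1 : Commute (E i) (E j) := h.EE i j hij
    have a2 : Commute (E' i) (E' j) := h'.EE i j hij
    have b1 : Commute (E i * L' i) (E j * L' j) :=
      ((a1.mul_right (hS _ (hE i) _ (hL' j))).mul_left
        ((hS _ (hE j) _ (hL' i)).symm.mul_right c0))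
    have b2 : Commute (E i * L' i) (E' j) := (hS _ (hE i) _ (hE' j)).mul_left w1
    have b3 : Commute (E' i) (E j * L' j) :=
      (hS _ (hE j) _ (hE' i)).symm.mul_right (show Commute (L' j) (E' i) from w2).symm
    exact (b1.add_right b2).add_left (b3.add_right a2)
  FF i j hij := by
    have hji := (cartan_symm j i).trans hij
    have w1 := (h.wF i j)
    have w2 := (h.wF j i)
    rw [hij] at w1
    rw [hji] at w2
    unfold W at w1 w2
    simp only [neg_zero, zpow_zero, one_smul] at w1 w2
    have a1 : Commute (F i) (F j) := h.FF i j hij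
    have a2 : Commute (F' i) (F' j) := h'.FF i j hij
    have b1 : Commute (K i * F' i) (K j * F' j) :=
      ((Commute.mul_right (h.KK i j) (hS _ (hK i) _ (hF' j))).mul_left
        ((hS _ (hK j) _ (hF' i)).symm.mul_right a2))
    have b2 : Commute (K i * F' i) (F j) :=
      (show Commute (K i) (F j) from w1).mul_left (hS _ (hF j) _ (hF' i)).symm
    have b3 : Commute (F i) (K j * F' j) :=
      (show Commute (K j) (F i) from w2).symm.mul_right (hS _ (hF i) _ (hF' j))
    exact (a1.add_right b3).add_left (b2.add_right b1)
  serreE i j hij := by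
    have hji := (cartan_symm j i).trans hij
    have w1 := (h'.wL hq i i)
    have w2 := (h'.wL hq i j)
    have w3 := (h'.wL hq j i)
    rw [cartan_self] at w1
    rw [hij] at w2
    rw [hji] at w3
    unfold W at w1 w2 w3
    simp only [neg_neg, zpow_one] at w2 w3
    rw [show (q : 𝔽) ^ (-2 : ℤ) = q⁻¹ * q⁻¹ by rw [zpow_neg]; norm_cast; rw [pow_two, mul_inv]] at w1
    refine Serre.add hq ?_ (h'.serreE i j hij) ?_ ?_ ?_
    · exact (h.serre hij).mul_commute (hS _ (hE i) _ (hL' i)) (hS _ (hE j) _ (hL' i))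
        (hS _ (hE i) _ (hL' j)) ((h'.swap hq).KK i j)
    · rw [mul_assoc, w1, mul_smul_comm, ← mul_assoc, (hS _ (hE i) _ (hE' i)).eq, mul_assoc]
    · rw [mul_assoc, w2, mul_smul_comm, ← mul_assoc, (hS _ (hE i) _ (hE' j)).eq, mul_assoc]
    · rw [mul_assoc, w3, mul_smul_comm, ← mul_assoc, (hS _ (hE j) _ (hE' i)).eq, mul_assoc]
  serreF i j hij := by
    have hji := (cartan_symm j i).trans hij
    have w1 := (h.wF i i)
    have w2 := (h.wF i j)
    have w3 := (h.wF j i)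
    rw [cartan_self] at w1
    rw [hij] at w2
    rw [hji] at w3
    unfold W at w1 w2 w3
    simp only [neg_neg, zpow_one] at w2 w3
    rw [show (q : 𝔽) ^ (-2 : ℤ) = q⁻¹ * q⁻¹ by rw [zpow_neg]; norm_cast; rw [pow_two, mul_inv]] at w1
    rw [add_comm (F i), add_comm (F j)]
    refine Serre.add hq ?_ (h.serreF i j hij) ?_ ?_ ?_
    · have := (show Serre q (F' i) (F' j) from h'.serreF i j hij).mul_commute
        (hS _ (hK i) _ (hF' i)).symm (hS _ (hK i) _ (hF' j)).symm
        (hS _ (hK j) _ (hF' i)).symm (h.KK i j)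
      rwa [(hS _ (hK i) _ (hF' i)).eq, (hS _ (hK j) _ (hF' j)).eq]
    · rw [mul_assoc, ← (hS _ (hF i) _ (hF' i)).eq, ← mul_assoc, w1, smul_mul_assoc, mul_assoc]
    · rw [mul_assoc, ← (hS _ (hF j) _ (hF' i)).eq, ← mul_assoc, w2, smul_mul_assoc, mul_assoc]
    · rw [mul_assoc, ← (hS _ (hF i) _ (hF' j)).eq, ← mul_assoc, w3, smul_mul_assoc, mul_assoc]

end QuantumRelations

end Coproduct

/-! ### Tensor products with the natural representation -/

section Natural

variable {K : Type u} [Field K] {n : ℕ}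

/-- The weight of the `l`-th basis vector of the natural representation, as a power of `q`. -/
noncomputable def natWeight (K : Type u) [Field K] {n : ℕ} (i : Fin n) (l : Fin (n + 1)) : ℤ :=
  if l.val = i.val then 1 else if l.val = i.val + 1 then -1 else 0

/-- The natural representation of `U_q(sl_{n+1})` on `K(q)^{n+1}`. -/
theorem natural_relations : QuantumRelations (q K)
    (fun i : Fin n => Matrix.single i.castSucc i.succ (1 : RatFunc K))
    (fun i : Fin n => Matrix.single i.succ i.castSucc (1 : RatFunc K))
    (fun i => Matrix.diagonal fun l => q K ^ natWeight K i l)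
    (fun i => Matrix.diagonal fun l => q K ^ (-natWeight K i l)) where
  KL i := by
    rw [Matrix.diagonal_mul_diagonal, ← Matrix.diagonal_one]
    congr 1; ext l
    rw [← zpow_add₀ (q_ne K), add_neg_cancel, zpow_zero]
  LK i := by
    rw [Matrix.diagonal_mul_diagonal, ← Matrix.diagonal_one]
    congr 1; ext l
    rw [← zpow_add₀ (q_ne K), neg_add_cancel, zpow_zero]
  KK i j := by
    rw [Matrix.diagonal_mul_diagonal, Matrix.diagonal_mul_diagonal]
    congr 1; ext l
    rw [mul_comm]
  KE i j := by
    ext l m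
    rw [Matrix.diagonal_mul, Matrix.smul_apply, Matrix.mul_diagonal, Matrix.single_apply]
    split_ifs with h
    · obtain ⟨rfl, rfl⟩ := h
      rw [mul_one, one_mul, smul_eq_mul, ← zpow_add₀ (q_ne K)]
      congr 1
      simp only [natWeight, CartanMatrix.A, Matrix.of_apply, Fin.ext_iff, Fin.val_castSucc,
        Fin.val_succ]
      split_ifs <;> first | rfl | omega
    · simp
  KF i j := by
    ext l m
    rw [Matrix.diagonal_mul, Matrix.smul_apply, Matrix.mul_diagonal, Matrix.single_apply]
    split_ifs with h
    · obtain ⟨rfl, rfl⟩ := h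
      rw [mul_one, one_mul, smul_eq_mul, ← zpow_add₀ (q_ne K)]
      congr 1
      simp only [natWeight, CartanMatrix.A, Matrix.of_apply, Fin.ext_iff, Fin.val_castSucc,
        Fin.val_succ]
      split_ifs <;> first | rfl | omega
    · simp
  EF i j := by
    by_cases hij : i = j
    · subst hij
      rw [if_pos rfl, Matrix.single_mul_single_same, Matrix.single_mul_single_same, mul_one]
      ext l m
      rw [Matrix.sub_apply, Matrix.smul_apply, Matrix.sub_apply, Matrix.single_apply,
        Matrix.single_apply, Matrix.diagonal_apply, Matrix.diagonal_apply]
      have hq := q_ne K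
      have hq1 := q_sq_sub_one K
      have hh : q K - (q K)⁻¹ ≠ 0 := by
        intro h0; apply hq1; field_simp at h0; linear_combination h0
      by_cases hlm : l = m
      · subst hlm
        simp only [natWeight, Fin.ext_iff, Fin.val_castSucc, Fin.val_succ, if_true]
        by_cases h1 : l.val = i.val
        · rw [if_pos (by omega), if_neg (by omega), if_pos h1]
          simp only [zpow_one, zpow_neg, smul_eq_mul, sub_zero]
          rw [inv_mul_cancel₀ hh]
        · by_cases h2 : l.val = i.val + 1
          · rw [if_neg (by omega), if_pos (by omega), if_neg h1, if_pos h2]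
            simp only [zpow_one, zpow_neg, neg_neg, smul_eq_mul, zero_sub, inv_inv]
            rw [← neg_sub (q K), mul_neg, inv_mul_cancel₀ hh]
          · rw [if_neg (by omega), if_neg (by omega), if_neg h1, if_neg h2]
            simp
      · rw [if_neg (by rintro ⟨h1, h2⟩; exact hlm (h1.symm.trans h2)),
          if_neg (by rintro ⟨h1, h2⟩; exact hlm (h1.symm.trans h2)), if_neg hlm, if_neg hlm]
        simp
    · rw [if_neg hij, Matrix.single_mul_single_of_ne, Matrix.single_mul_single_of_ne, sub_zero]
      · intro h; apply hij; simpa [Fin.ext_iff] using h.symm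
      · intro h; apply hij; simpa [Fin.ext_iff] using h
  EE i j hij := by
    rw [Matrix.single_mul_single_of_ne, Matrix.single_mul_single_of_ne] <;>
    · intro h
      rw [cartan_of_adj (by simp [Fin.ext_iff] at h; omega)] at hij
      omega
  FF i j hij := by
    rw [Matrix.single_mul_single_of_ne, Matrix.single_mul_single_of_ne] <;>
    · intro h
      rw [cartan_of_adj (by simp [Fin.ext_iff] at h; omega)] at hij
      omega
  serreE i j hij := by
    have h1 : Matrix.single i.castSucc i.succ (1 : RatFunc K) * Matrix.single i.castSucc i.succ (1 : RatFunc K) = 0 :=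
      Matrix.single_mul_single_of_ne _ _ _ _ (by simp [Fin.ext_iff]) _
    have h2 : Matrix.single i.castSucc i.succ (1 : RatFunc K) * Matrix.single j.castSucc j.succ (1 : RatFunc K) * Matrix.single i.castSucc i.succ (1 : RatFunc K) = 0 := by
      by_cases h : i.succ = j.castSucc
      · have h3 : Matrix.single j.castSucc j.succ (1 : RatFunc K) * Matrix.single i.castSucc i.succ (1 : RatFunc K) = 0 :=
          Matrix.single_mul_single_of_ne _ _ _ _
            (by intro h'; simp [Fin.ext_iff] at h h'; omega) _
        rw [mul_assoc, h3, mul_zero]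
      · rw [Matrix.single_mul_single_of_ne _ _ _ _ h, zero_mul]
    rw [h2, mul_assoc _ (Matrix.single i.castSucc i.succ (1 : RatFunc K)) (Matrix.single i.castSucc i.succ (1 : RatFunc K)), h1]
    simp
  serreF i j hij := by
    have h1 : Matrix.single i.succ i.castSucc (1 : RatFunc K) * Matrix.single i.succ i.castSucc (1 : RatFunc K) = 0 :=
      Matrix.single_mul_single_of_ne _ _ _ _ (by simp [Fin.ext_iff]) _
    have h2 : Matrix.single i.succ i.castSucc (1 : RatFunc K) * Matrix.single j.succ j.castSucc (1 : RatFunc K) * Matrix.single i.succ i.castSucc (1 : RatFunc K) = 0 := by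
      by_cases h : i.castSucc = j.succ
      · have h3 : Matrix.single j.succ j.castSucc (1 : RatFunc K) * Matrix.single i.succ i.castSucc (1 : RatFunc K) = 0 :=
          Matrix.single_mul_single_of_ne _ _ _ _
            (by intro h'; simp [Fin.ext_iff] at h h'; omega) _
        rw [mul_assoc, h3, mul_zero]
      · rw [Matrix.single_mul_single_of_ne _ _ _ _ h, zero_mul]
    rw [h2, mul_assoc _ (Matrix.single i.succ i.castSucc (1 : RatFunc K)) (Matrix.single i.succ i.castSucc (1 : RatFunc K)), h1]
    simp

/-- The inclusion of scalar matrices. -/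
noncomputable abbrev toMat : Matrix (Fin (n + 1)) (Fin (n + 1)) (RatFunc K) →ₐ[RatFunc K]
    Matrix (Fin (n + 1)) (Fin (n + 1)) (Uq K n) :=
  (Algebra.ofId (RatFunc K) (Uq K n)).mapMatrix

/-- The natural representation tensored with `U_q`, with values in matrices over `U_q`. -/
theorem natCoproduct_relations : QuantumRelations (q K)
    (fun i : Fin n => toMat (Matrix.single i.castSucc i.succ (1 : RatFunc K)) *
      Matrix.scalarAlgHom (Fin (n + 1)) (RatFunc K) (Ki i : Uq K n) +
        Matrix.scalarAlgHom (Fin (n + 1)) (RatFunc K) (E i : Uq K n))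
    (fun i : Fin n => toMat (Matrix.single i.succ i.castSucc (1 : RatFunc K)) +
      toMat (Matrix.diagonal fun l => q K ^ natWeight K i l) *
        Matrix.scalarAlgHom (Fin (n + 1)) (RatFunc K) (F i : Uq K n))
    (fun i => toMat (Matrix.diagonal fun l => q K ^ natWeight K i l) *
      Matrix.scalarAlgHom (Fin (n + 1)) (RatFunc K) (Kg i : Uq K n))
    (fun i => toMat (Matrix.diagonal fun l => q K ^ (-natWeight K i l)) *
      Matrix.scalarAlgHom (Fin (n + 1)) (RatFunc K) (Ki i : Uq K n)) := by
  refine (natural_relations.map toMat).coproduct (q_ne K)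
    (Uq_relations.map (Matrix.scalarAlgHom (Fin (n + 1)) (RatFunc K)))
    (S := toMat.range) (S' := (Matrix.scalarAlgHom (Fin (n + 1)) (RatFunc K)).range) ?_
    (fun i => ⟨_, rfl⟩) (fun i => ⟨_, rfl⟩) (fun i => ⟨_, rfl⟩) (fun i => ⟨_, rfl⟩)
    (fun i => ⟨_, rfl⟩) (fun i => ⟨_, rfl⟩) (fun i => ⟨_, rfl⟩) (fun i => ⟨_, rfl⟩)
  rintro _ ⟨x, rfl⟩ _ ⟨y, rfl⟩
  refine (Matrix.scalar_commute_iff.mpr ?_).symm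
  ext l m
  exact (Algebra.commutes (x l m) y).symm

/-- The algebra homomorphism `U_q → End(V) ⊗ U_q = Mat_{n+1}(U_q)` obtained from the comultiplication
and the natural representation `V`. -/
noncomputable def natCoproduct (K : Type u) [Field K] (n : ℕ) :
    Uq K n →ₐ[RatFunc K] Matrix (Fin (n + 1)) (Fin (n + 1)) (Uq K n) :=
  liftUq natCoproduct_relations

theorem natCoproduct_E (i : Fin n) (l m : Fin (n + 1)) : natCoproduct K n (E i) l m =
    (if l.val = i.val ∧ m.val = i.val + 1 then Ki i else 0) + if l = m then E i else 0 := by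
  have h : natCoproduct K n (E i) = _ := liftUq_mk natCoproduct_relations (Gen.E i)
  rw [h]
  simp only [genMap, Matrix.add_apply, Matrix.scalarAlgHom_apply, Matrix.scalar_apply,
    Matrix.mul_diagonal, AlgHom.mapMatrix_apply, Matrix.map_apply, Matrix.single_apply,
    Matrix.diagonal_apply, Fin.ext_iff, Fin.val_castSucc, Fin.val_succ]
  congr 1
  by_cases h : l.val = i.val ∧ m.val = i.val + 1
  · rw [if_pos h, if_pos (by omega), map_one, one_mul]
  · rw [if_neg h, if_neg (by omega), map_zero, zero_mul]

theorem natCoproduct_F (i : Fin n) (l m : Fin (n + 1)) : natCoproduct K n (F i) l m =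
    (if l.val = i.val + 1 ∧ m.val = i.val then 1 else 0) +
      if l = m then q K ^ natWeight K i l • F i else 0 := by
  have h : natCoproduct K n (F i) = _ := liftUq_mk natCoproduct_relations (Gen.F i)
  rw [h]
  simp only [genMap, Matrix.add_apply, Matrix.scalarAlgHom_apply, Matrix.scalar_apply,
    Matrix.mul_diagonal, AlgHom.mapMatrix_apply, Matrix.map_apply, Matrix.single_apply,
    Matrix.diagonal_apply, Fin.ext_iff, Fin.val_castSucc, Fin.val_succ]
  congr 1
  · by_cases h : l.val = i.val + 1 ∧ m.val = i.val
    · rw [if_pos h, if_pos (by omega), map_one]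
    · rw [if_neg h, if_neg (by omega), map_zero]
  · split_ifs with h
    · rw [Algebra.ofId_apply, ← Algebra.smul_def]
    · rw [map_zero, zero_mul]

theorem natCoproduct_Kg (i : Fin n) (l m : Fin (n + 1)) : natCoproduct K n (Kg i) l m =
    if l = m then q K ^ natWeight K i l • Kg i else 0 := by
  have h : natCoproduct K n (Kg i) = _ := liftUq_mk natCoproduct_relations (Gen.K i)
  rw [h]
  simp only [genMap, Matrix.scalarAlgHom_apply, Matrix.scalar_apply,
    Matrix.mul_diagonal, AlgHom.mapMatrix_apply, Matrix.map_apply,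
    Matrix.diagonal_apply]
  split_ifs with h
  · rw [Algebra.ofId_apply, ← Algebra.smul_def]
  · rw [map_zero, zero_mul]

end Natural

/-! ### Elements acting by zero on all modules -/

section Kills

variable {K : Type u} [Field K] {n : ℕ}

/-- `u` acts by zero on every finite dimensional module of type `1`. -/
def ActsByZero (u : Uq K n) : Prop :=
  ∀ (M : Type u) [AddCommGroup M] [Module (RatFunc K) M] [Module (Uq K n) M]
    [IsScalarTower (RatFunc K) (Uq K n) M], IsTypeOne K n M → ∀ m : M, u • m = 0

namespace ActsByZero

theorem zero : ActsByZero (0 : Uq K n) := fun _ _ _ _ _ _ _ => zero_smul _ _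

theorem add {u v : Uq K n} (hu : ActsByZero u) (hv : ActsByZero v) : ActsByZero (u + v) :=
  fun M _ _ _ _ hM m => by rw [add_smul, hu M hM, hv M hM, add_zero]

theorem mul_left {u : Uq K n} (hu : ActsByZero u) (v : Uq K n) : ActsByZero (v * u) :=
  fun M _ _ _ _ hM m => by rw [mul_smul, hu M hM, smul_zero]

theorem mul_right {u : Uq K n} (hu : ActsByZero u) (v : Uq K n) : ActsByZero (u * v) :=
  fun M _ _ _ _ hM m => by rw [mul_smul, hu M hM]

theorem neg {u : Uq K n} (hu : ActsByZero u) : ActsByZero (-u) :=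
  fun M _ _ _ _ hM m => by rw [neg_smul, hu M hM, neg_zero]

theorem sub {u v : Uq K n} (hu : ActsByZero u) (hv : ActsByZero v) : ActsByZero (u - v) :=
  sub_eq_add_neg u v ▸ hu.add hv.neg

theorem smul {u : Uq K n} (hu : ActsByZero u) (r : RatFunc K) : ActsByZero (r • u) :=
  fun M _ _ _ _ hM m => by rw [smul_assoc, hu M hM, smul_zero]

theorem of_smul {u : Uq K n} {r : RatFunc K} (hr : r ≠ 0) (hu : ActsByZero (r • u)) :
    ActsByZero u := by
  have := hu.smul r⁻¹
  rwa [smul_smul, inv_mul_cancel₀ hr, one_smul] at this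

theorem sum {ι : Type*} {s : Finset ι} {f : ι → Uq K n} (h : ∀ i ∈ s, ActsByZero (f i)) :
    ActsByZero (∑ i ∈ s, f i) :=
  Finset.sum_induction f ActsByZero (fun _ _ => add) zero h

end ActsByZero

theorem trivial_relations : QuantumRelations (q K) (fun _ : Fin n => (0 : RatFunc K))
    (fun _ => 0) (fun _ => 1) (fun _ => 1) where
  KL := by simp
  LK := by simp
  KK := by simp
  KE := by simp
  KF := by simp
  EF i j := by split_ifs <;> simp
  EE := by simp
  FF := by simp
  serreE := by simp
  serreF := by simp

/-- Scalars are detected by the trivial module. -/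
theorem ActsByZero.algebraMap_eq_zero {a : RatFunc K}
    (h : ActsByZero (algebraMap (RatFunc K) (Uq K n) a)) : a = 0 := by
  let _ : Module (Uq K n) (RatFunc K) :=
    Module.compHom (RatFunc K) (liftUq (n := n) trivial_relations).toRingHom
  have hs : ∀ (u : Uq K n) (x : RatFunc K), u • x = liftUq trivial_relations u * x :=
    fun _ _ => rfl
  have _ : IsScalarTower (RatFunc K) (Uq K n) (RatFunc K) :=
    ⟨fun r u x => by rw [hs, hs, map_smul, smul_mul_assoc]⟩
  have hM : IsTypeOne K n (RatFunc K) := by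
    refine ⟨inferInstance, ?_⟩
    rw [eq_top_iff]
    rintro x -
    refine Submodule.subset_span ⟨0, fun i => ?_⟩
    have e : liftUq trivial_relations (Kg i : Uq K n) = (1 : RatFunc K) :=
      liftUq_mk trivial_relations (Gen.K i)
    rw [hs, e]
    simp
  have := h (RatFunc K) hM 1
  rw [hs, AlgHom.commutes, mul_one] at this
  exact this

/-- The tensor product of the natural representation with a module `M`. -/
def NatTensor (n : ℕ) (M : Type u) : Type u := Fin (n + 1) → M

section NatTensor

variable {M : Type u} [AddCommGroup M] [Module (Uq K n) M]

instance : AddCommGroup (NatTensor n M) := inferInstanceAs (AddCommGroup (Fin (n + 1) → M))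

open scoped Matrix.Module in
noncomputable instance : Module (Uq K n) (NatTensor n M) :=
  Module.compHom (Fin (n + 1) → M) (natCoproduct K n).toRingHom

theorem natTensor_smul (u : Uq K n) (v : NatTensor n M) (l : Fin (n + 1)) :
    (u • v) l = ∑ m, natCoproduct K n u l m • v m := rfl

variable [Module (RatFunc K) M]

instance : Module (RatFunc K) (NatTensor n M) :=
  inferInstanceAs (Module (RatFunc K) (Fin (n + 1) → M))

instance [IsScalarTower (RatFunc K) (Uq K n) M] :
    IsScalarTower (RatFunc K) (Uq K n) (NatTensor n M) :=
  ⟨fun r u v => by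
    refine funext fun l => ?_
    change _ = r • (u • v) l
    rw [natTensor_smul, natTensor_smul, map_smul, Finset.smul_sum]
    exact Finset.sum_congr rfl fun m _ => by rw [Matrix.smul_apply, smul_assoc]⟩

theorem isTypeOne_natTensor [IsScalarTower (RatFunc K) (Uq K n) M] (hM : IsTypeOne K n M) :
    IsTypeOne K n (NatTensor n M) := by
  obtain ⟨h1, h2⟩ := hM
  refine ⟨inferInstanceAs (Module.Finite (RatFunc K) (Fin (n + 1) → M)), ?_⟩
  rw [eq_top_iff]
  rintro v -
  have hv : v = ∑ l, LinearMap.single (RatFunc K) (fun _ : Fin (n + 1) => M) l (v l) :=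
    (Finset.univ_sum_single v).symm
  rw [hv]
  refine Submodule.sum_mem _ fun l _ => ?_
  have h3 : v l ∈ (⊤ : Submodule (RatFunc K) M) := trivial
  rw [← h2] at h3
  have h4 := Submodule.mem_map_of_mem
    (f := LinearMap.single (RatFunc K) (fun _ : Fin (n + 1) => M) l) h3
  rw [Submodule.map_span] at h4
  refine Submodule.span_mono ?_ h4
  rintro _ ⟨m, ⟨μ, hμ⟩, rfl⟩
  refine ⟨fun i => natWeight K i l + μ i, fun i => ?_⟩
  refine funext fun p => ?_
  let w : NatTensor n M := (Pi.single l m : Fin (n + 1) → M)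
  change (Kg i • w) p = q K ^ (natWeight K i l + μ i) • w p
  rw [natTensor_smul, Finset.sum_eq_single p]
  · rw [natCoproduct_Kg, if_pos rfl, smul_assoc]
    by_cases h : p = l
    · subst h
      have e : w p = m := Pi.single_eq_same (M := fun _ => M) p m
      rw [e, hμ, smul_smul, zpow_add₀ (q_ne K)]
    · have e : w p = 0 := Pi.single_eq_of_ne (M := fun _ => M) h m
      rw [e, smul_zero, smul_zero, smul_zero]
  · intro r _ hr
    rw [natCoproduct_Kg, if_neg hr.symm, zero_smul]
  · simp

end NatTensor

/-- The matrix entries under `natCoproduct` of an element acting by zero act by zero. -/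
theorem ActsByZero.natCoproduct {u : Uq K n} (hu : ActsByZero u) (p r : Fin (n + 1)) :
    ActsByZero (natCoproduct K n u p r) := by
  intro M _ _ _ _ hM m
  let v : NatTensor n M := (Pi.single r m : Fin (n + 1) → M)
  have h : (u • v) p = 0 := congrFun (hu (NatTensor n M) (isTypeOne_natTensor hM) v) p
  rw [natTensor_smul, Finset.sum_eq_single r] at h
  · have e : v r = m := Pi.single_eq_same (M := fun _ => M) r m
    rwa [e] at h
  · intro b _ hb
    have e : v b = 0 := Pi.single_eq_of_ne (M := fun _ => M) hb m
    rw [e, smul_zero]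
  · simp

end Kills

/-! ### Ordered products of root vectors -/

section RootSpan

variable {𝔽 A : Type*} [Field 𝔽] [Ring A] [Algebra 𝔽 A] {q : 𝔽} {e : ℕ → A}

/-- The subalgebra generated by `e_0, …, e_{k-1}`. -/
def letters (𝔽 : Type*) {A : Type*} [Field 𝔽] [Ring A] [Algebra 𝔽 A] (e : ℕ → A) (k : ℕ) :
    Subalgebra 𝔽 A :=
  Algebra.adjoin 𝔽 {x | ∃ i, i < k ∧ x = e i}

/-- The span of the products `x_{j-1}^{a_{j-1}} ⋯ x_0^{a_0} w`, where `x_i` is the root vector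
of `α_i + ⋯ + α_k` and `w` lies in the algebra generated by `e_0, …, e_{k-1}`. -/
def rootSpan (q : 𝔽) (e : ℕ → A) (k : ℕ) : ℕ → Submodule 𝔽 A
  | 0 => (letters 𝔽 e k).toSubmodule
  | j + 1 => Submodule.span 𝔽
      {x | ∃ (a : ℕ) (s : A), s ∈ rootSpan q e k j ∧ x = chain q e j (k - j) ^ a * s}

theorem mem_letters {k i : ℕ} (hi : i < k) : e i ∈ letters 𝔽 e k :=
  Algebra.subset_adjoin (show e i ∈ {x | ∃ i, i < k ∧ x = e i} from ⟨i, hi, rfl⟩)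

theorem pow_mul_mem_rootSpan {k j : ℕ} (a : ℕ) {s : A} (hs : s ∈ rootSpan q e k j) :
    chain q e j (k - j) ^ a * s ∈ rootSpan q e k (j + 1) :=
  Submodule.subset_span ⟨a, s, hs, rfl⟩

theorem rootSpan_le_succ (k j : ℕ) : rootSpan q e k j ≤ rootSpan q e k (j + 1) := fun s hs => by
  simpa using pow_mul_mem_rootSpan 0 hs

/-- Left multiplication by `y` preserves `rootSpan q e k (j + 1)` if it does so on generators. -/
theorem mul_mem_rootSpan_succ {k j : ℕ} {y : A}
    (h : ∀ (a : ℕ), ∀ s ∈ rootSpan q e k j,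
      y * (chain q e j (k - j) ^ a * s) ∈ rootSpan q e k (j + 1)) :
    ∀ x ∈ rootSpan q e k (j + 1), y * x ∈ rootSpan q e k (j + 1) := by
  intro x hx
  induction hx using Submodule.span_induction with
  | mem x hx => obtain ⟨a, s, hs, rfl⟩ := hx; exact h a s hs
  | zero => rw [mul_zero]; exact zero_mem _
  | add x x' _ _ h1 h2 => rw [mul_add]; exact add_mem h1 h2
  | smul r x _ h1 => rw [mul_smul_comm]; exact Submodule.smul_mem _ _ h1

/-- An element that `q`-commutes with the last root vector may be moved past its powers. -/
theorem mul_mem_rootSpan_of_comm {k j : ℕ} {y : A} {r : 𝔽}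
    (hr : y * chain q e j (k - j) = r • (chain q e j (k - j) * y))
    (h : ∀ s ∈ rootSpan q e k j, y * s ∈ rootSpan q e k j) :
    ∀ x ∈ rootSpan q e k (j + 1), y * x ∈ rootSpan q e k (j + 1) := by
  have hp : ∀ a : ℕ, y * chain q e j (k - j) ^ a = r ^ a • (chain q e j (k - j) ^ a * y) := by
    intro a
    induction a with
    | zero => simp
    | succ a ih =>
      rw [pow_succ, ← mul_assoc, ih, smul_mul_assoc, mul_assoc, hr, mul_smul_comm, smul_smul,
        mul_assoc, pow_succ]
  refine mul_mem_rootSpan_succ fun a s hs => ?_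
  rw [← mul_assoc, hp, smul_mul_assoc, mul_assoc]
  exact Submodule.smul_mem _ _ (pow_mul_mem_rootSpan a (h s hs))

/-- The span is stable under the root vectors `x_l`, `l < j`. -/
theorem chain_mul_mem_rootSpan (hq : q ≠ 0) (hq2 : q ^ 2 + 1 ≠ 0) (h : SerreSequence q e)
    {k l j : ℕ} (hl : l < j) (hj : j ≤ k + 1) :
    ∀ x ∈ rootSpan q e k j, chain q e l (k - l) * x ∈ rootSpan q e k j := by
  induction j with
  | zero => omega
  | succ j ih =>
    rcases Nat.lt_or_ge l j with hlj | hlj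
    · exact mul_mem_rootSpan_of_comm (h.chain_mul_chain hq hq2 hlj (by omega)) (ih hlj (by omega))
    · obtain rfl : l = j := by omega
      refine mul_mem_rootSpan_succ fun a s hs => ?_
      rw [← mul_assoc, ← pow_succ']
      exact pow_mul_mem_rootSpan _ hs

/-- The span is stable under the letters `e_i`, `i < k`. -/
theorem letter_mul_mem_rootSpan (hq : q ≠ 0) (hq2 : q ^ 2 + 1 ≠ 0) (h : SerreSequence q e)
    {k i j : ℕ} (hi : i < k) (hj : j ≤ k + 1) :
    ∀ x ∈ rootSpan q e k j, e i * x ∈ rootSpan q e k j := by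
  induction j with
  | zero => exact fun x hx => (letters 𝔽 e k).mul_mem (mem_letters hi) hx
  | succ j ih =>
    have ih := ih (by omega)
    have hcomm : ∀ r : 𝔽, e i * chain q e j (k - j) = r • (chain q e j (k - j) * e i) →
      ∀ x ∈ rootSpan q e k (j + 1), e i * x ∈ rootSpan q e k (j + 1) :=
        fun r hr => mul_mem_rootSpan_of_comm hr ih
    rcases lt_trichotomy i j with h1 | h1 | h1
    · rcases Nat.lt_or_ge (i + 1) j with h2 | h2
      · exact hcomm 1 (by rw [one_smul]; exact h.commute_far (by omega))
      · -- here `e_i x_{i+1} = x_i + q⁻¹ x_{i+1} e_i`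
        obtain rfl : j = i + 1 := by omega
        refine mul_mem_rootSpan_succ fun a s hs => ?_
        induction a with
        | zero =>
          rw [pow_zero, one_mul]
          exact rootSpan_le_succ _ _ (ih s hs)
        | succ a iha =>
          have h3 : chain q e i (k - i) = chain q e i (k - (i + 1) + 1) := by congr 1; omega
          have h4 := pow_mul_mem_rootSpan (k := k) a hs
          rw [pow_succ', mul_assoc, ← mul_assoc, first_mul_next, add_mul, smul_mul_assoc, mul_assoc,
            ← h3]
          exact add_mem (chain_mul_mem_rootSpan hq hq2 h (by omega) hj _ h4)
            (Submodule.smul_mem _ _ (chain_mul_mem_rootSpan hq hq2 h (by omega) hj _ iha))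
    · subst h1
      refine hcomm q ?_
      obtain ⟨d, hd⟩ : ∃ d, k - i = d + 1 := ⟨k - i - 1, by omega⟩
      rw [hd]
      exact h.first_mul hq i d
    · exact hcomm 1 (by rw [one_smul]; exact h.commute_inner hq hq2 h1 (by omega))

/-- The ordered products span the algebra generated by `e_0, …, e_k`. -/
theorem letters_le_rootSpan (hq : q ≠ 0) (hq2 : q ^ 2 + 1 ≠ 0) (h : SerreSequence q e) (k : ℕ) :
    (letters 𝔽 e (k + 1)).toSubmodule ≤ rootSpan q e k (k + 1) := by
  have h0 : ∀ j, (1 : A) ∈ rootSpan q e k j := by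
    intro j
    induction j with
    | zero => exact one_mem (letters 𝔽 e k)
    | succ j ih => exact rootSpan_le_succ _ _ ih
  have h1 : ∀ y ∈ letters 𝔽 e (k + 1), ∀ x ∈ rootSpan q e k (k + 1),
      y * x ∈ rootSpan q e k (k + 1) := by
    intro y hy
    induction hy using Algebra.adjoin_induction with
    | mem y hy =>
      obtain ⟨i, hi, rfl⟩ := hy
      rcases Nat.lt_or_ge i k with hik | hik
      · exact letter_mul_mem_rootSpan hq hq2 h hik le_rfl
      · obtain rfl : i = k := by omega
        have := chain_mul_mem_rootSpan hq hq2 h (k := i) (l := i) (j := i + 1) (by omega) le_rfl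
        rwa [Nat.sub_self] at this
    | algebraMap r =>
      intro x hx
      rw [← Algebra.smul_def]
      exact Submodule.smul_mem _ _ hx
    | add y y' _ _ h1 h2 => intro x hx; rw [add_mul]; exact add_mem (h1 x hx) (h2 x hx)
    | mul y y' _ _ h1 h2 => intro x hx; rw [mul_assoc]; exact h1 _ (h2 x hx)
  intro y hy
  simpa using h1 y hy 1 (h0 _)

/-- An element of the span is a polynomial in the outermost root vector whose coefficients, on the
right, lie in the previous span. -/
theorem exists_sum_of_mem_rootSpan {k j : ℕ} {x : A} (hx : x ∈ rootSpan q e k (j + 1)) :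
    ∃ (N : ℕ) (s : ℕ → A), (∀ a, s a ∈ rootSpan q e k j) ∧
      x = ∑ a ∈ Finset.range (N + 1), chain q e j (k - j) ^ a * s a := by
  have key : ∃ f : ℕ →₀ A, (∀ a, f a ∈ rootSpan q e k j) ∧
      x = f.sum fun a s => chain q e j (k - j) ^ a * s := by
    induction hx using Submodule.span_induction with
    | mem x hx =>
      obtain ⟨a, s, hs, rfl⟩ := hx
      refine ⟨Finsupp.single a s, fun b => ?_, ?_⟩
      · rw [Finsupp.single_apply]
        split_ifs
        exacts [hs, zero_mem _]
      · rw [Finsupp.sum_single_index (mul_zero _)]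
    | zero => exact ⟨0, fun a => zero_mem _, by simp⟩
    | add x y _ _ h1 h2 =>
      obtain ⟨f, hf, rfl⟩ := h1
      obtain ⟨g, hg, rfl⟩ := h2
      refine ⟨f + g, fun a => add_mem (hf a) (hg a), ?_⟩
      rw [Finsupp.sum_add_index' (fun a => mul_zero _) (fun a b c => mul_add _ _ _)]
    | smul r x _ h1 =>
      obtain ⟨f, hf, rfl⟩ := h1
      refine ⟨r • f, fun a => Submodule.smul_mem _ _ (hf a), ?_⟩
      rw [Finsupp.sum_smul_index' (fun a => mul_zero _), Finsupp.smul_sum]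
      simp
  obtain ⟨f, hf, rfl⟩ := key
  refine ⟨f.support.sup id, f, hf, ?_⟩
  refine Finsupp.sum_of_support_subset f (fun a ha => ?_) _ fun a _ => mul_zero _
  rw [Finset.mem_range, Nat.lt_succ_iff]
  exact Finset.le_sup (f := id) ha

/-- Conjugation by an invertible element that scales the letters preserves the span. -/
theorem conj_mem_rootSpan (hq : q ≠ 0) {c c' : A} (hcc : c * c' = 1) (hcc' : c' * c = 1) {k : ℕ}
    (m : ℕ → ℤ) (hw : ∀ i, i ≤ k → W q c (e i) (m i)) {j : ℕ} (hj : j ≤ k + 1) {x : A}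
    (hx : x ∈ rootSpan q e k j) : c * x * c' ∈ rootSpan q e k j := by
  have hmul : ∀ x y, c * (x * y) * c' = c * x * c' * (c * y * c') := fun x y => by
    rw [mul_assoc (c * x), ← mul_assoc c', ← mul_assoc c', hcc', one_mul]; simp only [mul_assoc]
  have hscale : ∀ {x : A} {m : ℤ}, W q c x m → c * x * c' = q ^ m • x := fun h => by
    unfold W at h
    rw [h, smul_mul_assoc, mul_assoc, hcc, mul_one]
  induction j generalizing x with
  | zero =>
    change c * x * c' ∈ letters 𝔽 e k
    change x ∈ letters 𝔽 e k at hx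
    induction hx using Algebra.adjoin_induction with
    | mem y hy =>
      obtain ⟨i, hi, rfl⟩ := hy
      rw [hscale (hw i hi.le)]
      exact Subalgebra.smul_mem _ (mem_letters hi) _
    | algebraMap r =>
      rw [← Algebra.commutes, mul_assoc, hcc, mul_one]
      exact Subalgebra.algebraMap_mem _ _
    | add y y' _ _ h1 h2 => rw [mul_add, add_mul]; exact add_mem h1 h2
    | mul y y' _ _ h1 h2 => rw [hmul]; exact mul_mem h1 h2
  | succ j ih =>
    have hX := hscale (chain_W (r := q) (i := j) (d := k - j) hq
      fun p _ h2 => hw p (by omega))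
    have hpow : ∀ a : ℕ, ∃ t : 𝔽, c * chain q e j (k - j) ^ a * c' =
        t • chain q e j (k - j) ^ a := by
      intro a
      induction a with
      | zero => exact ⟨1, by rw [pow_zero, mul_one, hcc, one_smul]⟩
      | succ a iha =>
        obtain ⟨t, ht⟩ := iha
        exact ⟨_, by rw [pow_succ, hmul, ht, hX, smul_mul_smul_comm]⟩
    induction hx using Submodule.span_induction with
    | mem x hx =>
      obtain ⟨a, s, hs, rfl⟩ := hx
      obtain ⟨t, ht⟩ := hpow a
      rw [hmul, ht, smul_mul_assoc]
      exact Submodule.smul_mem _ _ (pow_mul_mem_rootSpan a (ih (by omega) hs))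
    | zero => rw [mul_zero, zero_mul]; exact zero_mem _
    | add x x' _ _ h1 h2 => rw [mul_add, add_mul]; exact add_mem h1 h2
    | smul r x _ h1 =>
      rw [mul_smul_comm, smul_mul_assoc]
      exact Submodule.smul_mem _ _ h1

end RootSpan

/-! ### The algebra `U^+` acts faithfully on modules of type `1` -/

section Faithful

variable {K : Type u} [Field K] {n : ℕ}

/-- The product `K_i⁻¹ K_{i+1}⁻¹ ⋯ K_{i+d}⁻¹`. -/
noncomputable def torusChain (K : Type u) [Field K] (n : ℕ) : ℕ → ℕ → Uq K n
  | i, 0 => natSeq Ki i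
  | i, d + 1 => natSeq Ki i * torusChain K n (i + 1) d

theorem torusChain_isUnit {i d : ℕ} (h : i + d < n) : IsUnit (torusChain K n i d) := by
  have h0 : ∀ {i : ℕ}, i < n → IsUnit (natSeq Ki i : Uq K n) := fun hi => by
    rw [natSeq_of_lt _ hi]
    exact ⟨⟨_, _, Uq_relations.LK _, Uq_relations.KL _⟩, rfl⟩
  induction d generalizing i with
  | zero => exact h0 h
  | succ d ih => exact (h0 (by omega)).mul (ih (by omega))

theorem torusChain_W {i d p : ℕ} (h : i + d < n) (hp : p < n) :
    W (q K) (torusChain K n i d) (natSeq E p)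
      ((if p + 1 = i then 1 else 0) - (if p = i then 1 else 0) - (if p = i + d then 1 else 0)
        + if p = i + d + 1 then 1 else 0) := by
  have h0 : ∀ {i : ℕ}, i < n → W (q K) (natSeq Ki i : Uq K n) (natSeq E p)
      (if p = i then -2 else if p + 1 = i ∨ p = i + 1 then 1 else 0) := fun hi => by
    rw [natSeq_of_lt _ hi, natSeq_of_lt _ hp]
    refine (Uq_relations.wL (q_ne K) ⟨_, hi⟩ ⟨p, hp⟩).of_eq ?_
    simp only [CartanMatrix.A, Matrix.of_apply, Fin.ext_iff]
    split_ifs <;> omega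
  induction d generalizing i with
  | zero =>
    refine (h0 h).of_eq ?_
    split_ifs <;> omega
  | succ d ih =>
    refine ((h0 (by omega)).mulK (q_ne K) (ih (i := i + 1) (by omega))).of_eq ?_
    split_ifs <;> omega

theorem torusChain_mul_Echain {i d : ℕ} (h : i + d < n) :
    torusChain K n i d * Echain K n i d = (q K ^ 2)⁻¹ • (Echain K n i d * torusChain K n i d) := by
  have h1 := chain_W (r := q K) (q_ne K) (i := i) (d := d) fun p _ h2 =>
    torusChain_W (K := K) (p := p) h (by omega)
  have e : ∑ j ∈ Finset.range (d + 1), (((if i + j + 1 = i then (1 : ℤ) else 0) -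
      (if i + j = i then 1 else 0) - (if i + j = i + d then 1 else 0)
        + if i + j = i + d + 1 then 1 else 0)) = -2 := by
    have : ∀ j ∈ Finset.range (d + 1), (((if i + j + 1 = i then (1 : ℤ) else 0) -
      (if i + j = i then 1 else 0) - (if i + j = i + d then 1 else 0)
        + if i + j = i + d + 1 then 1 else 0)) = -(if j = 0 then 1 else 0) - if j = d then 1 else 0 := by
      intro j hj
      rw [Finset.mem_range] at hj
      split_ifs <;> omega
    rw [Finset.sum_congr rfl this, Finset.sum_sub_distrib, Finset.sum_neg_distrib,
      Finset.sum_ite_eq', Finset.sum_ite_eq']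
    simp
  rw [e] at h1
  unfold W at h1
  rw [h1, zpow_neg]
  norm_cast

/-- A column of `natCoproduct K n v` with two entries determines the same column of the matrix of
`u * v`. -/
theorem natCoproduct_mul_col {u v w : Uq K n} {m p : Fin (n + 1)}
    (h : ∀ l, natCoproduct K n v l m = (if l = m then v else 0) + if l = p then w else 0)
    (l : Fin (n + 1)) : natCoproduct K n (u * v) l m =
      natCoproduct K n u l m * v + natCoproduct K n u l p * w := by
  rw [map_mul, Matrix.mul_apply]
  simp only [h, mul_add, Finset.sum_add_distrib, mul_ite, mul_zero, Finset.sum_ite_eq',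
    Finset.mem_univ, if_true]

theorem natCoproduct_mul_col' {u v : Uq K n} {m : Fin (n + 1)}
    (h : ∀ l, natCoproduct K n v l m = if l = m then v else 0)
    (l : Fin (n + 1)) : natCoproduct K n (u * v) l m = natCoproduct K n u l m * v := by
  rw [natCoproduct_mul_col (p := m) (w := 0) (by simpa using h), mul_zero, add_zero]

theorem natCoproduct_qcomm {r : RatFunc K} (u v : Uq K n) (l m : Fin (n + 1)) :
    natCoproduct K n (qcomm r u v) l m =
      natCoproduct K n (u * v) l m - r • natCoproduct K n (v * u) l m := by
  rw [qcomm, map_sub, map_smul]; rfl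

/-- A chain has no off-diagonal entries in the columns up to its first letter. -/
theorem natCoproduct_Echain_of_le {i d : ℕ} (h : i + d < n) {m : Fin (n + 1)} (hm : m.val ≤ i)
    (l : Fin (n + 1)) :
    natCoproduct K n (Echain K n i d) l m = if l = m then Echain K n i d else 0 := by
  have h0 : ∀ {i : ℕ}, i < n → m.val ≤ i → ∀ l, natCoproduct K n (natSeq E i) l m =
      if l = m then natSeq E i else 0 := fun hi hm l => by
    rw [natSeq_of_lt _ hi, natCoproduct_E, if_neg (by simp only; omega), zero_add]
  induction d generalizing i l with
  | zero => exact h0 h hm l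
  | succ d ih =>
    have ih := ih (i := i + 1) (by omega) (by omega)
    unfold Echain at *
    rw [chain_succ, natCoproduct_qcomm, natCoproduct_mul_col' ih,
      natCoproduct_mul_col' (h0 (by omega) hm), ih, h0 (by omega) hm, qcomm]
    split_ifs <;> simp

/-- In the column right after its last letter, a chain has a single off-diagonal entry, in the row of its
first letter. -/
theorem natCoproduct_Echain_top {i d : ℕ} (h : i + d < n) {m p : Fin (n + 1)}
    (hm : m.val = i + d + 1) (hp : p.val = i) (l : Fin (n + 1)) :
    natCoproduct K n (Echain K n i d) l m =
      (if l = m then Echain K n i d else 0) + if l = p then torusChain K n i d else 0 := by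
  induction d generalizing i l p with
  | zero =>
    change natCoproduct K n (natSeq E i) l m = (if l = m then natSeq E i else 0) +
      if l = p then natSeq Ki i else 0
    rw [add_zero] at h
    rw [natSeq_of_lt _ h, natSeq_of_lt _ h, natCoproduct_E, add_comm]
    congr 1
    refine if_congr ?_ rfl rfl
    rw [Fin.ext_iff]; simp only; omega
  | succ d ih =>
    have hi : i < n := by omega
    have ih := ih (i := i + 1) (p := ⟨i + 1, by omega⟩) (by omega) (by omega) rfl
    have h0 : ∀ l, natCoproduct K n (natSeq E i) l m = if l = m then natSeq E i else 0 := fun l => by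
      rw [natSeq_of_lt _ hi, natCoproduct_E, if_neg (by simp only; omega), zero_add]
    have h1 : natCoproduct K n (natSeq E i) l ⟨i + 1, by omega⟩ = (if l = p then natSeq Ki i else 0)
        + if l = ⟨i + 1, by omega⟩ then natSeq E i else 0 := by
      rw [natSeq_of_lt _ hi, natSeq_of_lt _ hi, natCoproduct_E]
      congr 1
      exact if_congr (by simp [Fin.ext_iff, hp]) rfl rfl
    have h2 := torusChain_W (K := K) (i := i + 1) (d := d) (p := i) (by omega) hi
    rw [if_pos rfl, if_neg (by omega), if_neg (by omega), if_neg (by omega)] at h2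
    unfold W at h2
    simp only [sub_zero, add_zero, zpow_one] at h2
    unfold Echain at *
    rw [chain_succ, natCoproduct_qcomm, natCoproduct_mul_col ih, natCoproduct_mul_col' h0, ih, h0,
      h1, qcomm, torusChain]
    have hq := q_ne K
    split_ifs <;> simp_all [add_mul, h2, smul_smul] <;> abel

theorem natCoproduct_Echain_pow_low {i d : ℕ} (h : i + d < n) {m : Fin (n + 1)} (hm : m.val ≤ i)
    (a : ℕ) (l : Fin (n + 1)) :
    natCoproduct K n (Echain K n i d ^ a) l m = if l = m then Echain K n i d ^ a else 0 := by
  induction a generalizing l with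
  | zero => rw [pow_zero, map_one, Matrix.one_apply]
  | succ a ih =>
    rw [pow_succ, natCoproduct_mul_col' (natCoproduct_Echain_of_le h hm), ih, ite_mul, zero_mul]

/-- The `a`-th power acquires the factor `1 + q⁻² + ⋯ + q^{-2(a-1)}`, the image of `{a}` under
`q ↦ q⁻¹`, in its off-diagonal entry. -/
theorem natCoproduct_Echain_pow {i d : ℕ} (h : i + d < n) {m p : Fin (n + 1)}
    (hm : m.val = i + d + 1) (hp : p.val = i) (a : ℕ) (l : Fin (n + 1)) :
    natCoproduct K n (Echain K n i d ^ a) l m = (if l = m then Echain K n i d ^ a else 0) +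
      if l = p then barScalar K (qNumber K a) • (Echain K n i d ^ (a - 1) * torusChain K n i d)
        else 0 := by
  induction a with
  | zero =>
    rw [pow_zero, map_one, Matrix.one_apply]
    simp [qNumber]
  | succ a ih =>
    rw [pow_succ, natCoproduct_mul_col (natCoproduct_Echain_top h hm hp), ih,
      natCoproduct_Echain_pow_low h hp.le, add_mul, ite_mul, zero_mul, add_assoc]
    congr 1
    by_cases hl : l = p
    · rw [if_pos hl, if_pos hl, if_pos hl, smul_mul_assoc, mul_assoc, torusChain_mul_Echain h,
        qNumber_succ', map_add, map_one, map_mul, map_pow, barScalar_q, mul_smul_comm, smul_smul,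
        add_smul, one_smul, Nat.add_sub_cancel, add_comm]
      congr 1
      cases a with
      | zero => simp [qNumber]
      | succ a =>
        rw [Nat.add_sub_cancel, ← mul_assoc, ← pow_succ, inv_pow, mul_comm]
    · simp [hl]

theorem natCoproduct_pow_mul {k j : ℕ} (hk : k < n) (hj : j ≤ k) {m : Fin (n + 1)} {x : Uq K n}
    (h : ∀ l : Fin (n + 1), j ≤ l.val → natCoproduct K n x l m = if l = m then x else 0) (a : ℕ)
    {l : Fin (n + 1)} (hl : j ≤ l.val) : natCoproduct K n (Echain K n j (k - j) ^ a * x) l m =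
      natCoproduct K n (Echain K n j (k - j) ^ a) l m * x := by
  rw [map_mul, Matrix.mul_apply, Finset.sum_eq_single m]
  · rcases Nat.lt_or_ge m.val j with hm | hm
    · rw [natCoproduct_Echain_pow_low (by omega) hm.le, if_neg (by rintro rfl; omega), zero_mul,
        zero_mul]
    · rw [h m hm, if_pos rfl]
  · intro r _ hr
    rcases Nat.lt_or_ge r.val j with hrj | hrj
    · rw [natCoproduct_Echain_pow_low (by omega) hrj.le, if_neg (by rintro rfl; omega), zero_mul]
    · rw [h r hrj, if_neg hr, mul_zero]
  · simp

/-- The part of column `k + 1` on and below row `j` is trivial on `rootSpan _ _ k j`. -/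
theorem natCoproduct_rootSpan {k j : ℕ} (hk : k < n) (hj : j ≤ k + 1) {m : Fin (n + 1)}
    (hm : m.val = k + 1) {x : Uq K n} (hx : x ∈ rootSpan (q K) (natSeq E) k j)
    {l : Fin (n + 1)} (hl : j ≤ l.val) :
    natCoproduct K n x l m = if l = m then x else 0 := by
  induction j generalizing x l with
  | zero =>
    change x ∈ letters _ _ k at hx
    clear hl
    induction hx using Algebra.adjoin_induction generalizing l with
    | mem y hy =>
      obtain ⟨i, hi, rfl⟩ := hy
      rw [natSeq_of_lt _ (by omega), natCoproduct_E, if_neg (by simp only; omega), zero_add]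
    | algebraMap r =>
      rw [AlgHom.commutes, Matrix.algebraMap_matrix_apply]
    | add y y' _ _ h1 h2 =>
      rw [map_add, Matrix.add_apply, h1, h2]
      split_ifs <;> simp
    | mul y y' _ _ h1 h2 =>
      rw [natCoproduct_mul_col' fun l => h2, h1]
      split_ifs <;> simp
  | succ j ih =>
    induction hx using Submodule.span_induction with
    | mem x hx =>
      obtain ⟨a, s, hs, rfl⟩ := hx
      obtain ⟨p, hp⟩ : ∃ p : Fin (n + 1), p.val = j := ⟨⟨j, by omega⟩, rfl⟩
      have hlj : l ≠ p := by rintro rfl; omega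
      rw [natCoproduct_pow_mul hk (by omega) (fun l hl => ih (by omega) hs hl) a (by omega),
        natCoproduct_Echain_pow (p := p) (by omega) (by omega) hp,
        if_neg hlj, add_zero]
      split_ifs <;> simp
    | zero => simp
    | add y y' _ _ h1 h2 =>
      rw [map_add, Matrix.add_apply, h1, h2]
      split_ifs <;> simp
    | smul r y _ h1 =>
      rw [map_smul, Matrix.smul_apply, h1]
      split_ifs <;> simp

/-- The `(j, k+1)` entry differentiates with respect to the root vector of `α_j + ⋯ + α_k`. -/
theorem natCoproduct_sum {k j : ℕ} (hk : k < n) (hj : j ≤ k) {l m : Fin (n + 1)}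
    (hl : l.val = j) (hm : m.val = k + 1) {s : ℕ → Uq K n}
    (hs : ∀ a, s a ∈ rootSpan (q K) (natSeq E) k j) (N : ℕ) :
    natCoproduct K n (∑ a ∈ Finset.range (N + 1), Echain K n j (k - j) ^ a * s a) l m =
      ∑ a ∈ Finset.range N, Echain K n j (k - j) ^ a *
        (barScalar K (qNumber K (a + 1)) • (torusChain K n j (k - j) * s (a + 1))) := by
  rw [map_sum, Matrix.sum_apply]
  have h : ∀ a, natCoproduct K n (Echain K n j (k - j) ^ a * s a) l m =
      barScalar K (qNumber K a) • (Echain K n j (k - j) ^ (a - 1) * torusChain K n j (k - j))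
        * s a := by
    intro a
    rw [natCoproduct_pow_mul hk hj (fun l hl => natCoproduct_rootSpan hk (by omega) hm (hs a) hl)
      a hl.ge, natCoproduct_Echain_pow (p := l) (by omega) (by omega) hl, if_pos rfl,
      if_neg (by rintro rfl; omega), zero_add]
  rw [Finset.sum_congr rfl fun a _ => h a, Finset.sum_range_succ']
  rw [show qNumber K 0 = 0 by simp [qNumber], map_zero, zero_smul, zero_mul, add_zero]
  refine Finset.sum_congr rfl fun a _ => ?_
  rw [Nat.add_sub_cancel, smul_mul_assoc, mul_smul_comm, mul_assoc]

/-- If the derivative of `∑ x_j^a s_a` acts by zero, so do the `s_a` with `a > 0`, provided that sums of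
fewer terms may be separated. -/
theorem ActsByZero.of_entry {k j : ℕ} (hk : k < n) (hj : j ≤ k) {l m : Fin (n + 1)}
    (hl : l.val = j) (hm : m.val = k + 1) {N : ℕ}
    (ih : ∀ s : ℕ → Uq K n, (∀ a, s a ∈ rootSpan (q K) (natSeq E) k j) →
      ActsByZero (∑ a ∈ Finset.range N, Echain K n j (k - j) ^ a * s a) →
        ∀ a < N, ActsByZero (s a)) {s : ℕ → Uq K n}
    (hs : ∀ a, s a ∈ rootSpan (q K) (natSeq E) k j)
    (h : ActsByZero (QSP.natCoproduct K n
      (∑ a ∈ Finset.range (N + 1), Echain K n j (k - j) ^ a * s a) l m)) :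
    ∀ a < N, ActsByZero (s (a + 1)) := by
  rw [natCoproduct_sum hk hj hl hm hs] at h
  obtain ⟨⟨c, c', h3, h4⟩, h5⟩ := torusChain_isUnit (K := K) (n := n) (i := j) (d := k - j)
    (by omega)
  simp only at h5
  subst h5
  -- moving the torus element to the right replaces the coefficients by conjugates in the same span
  have h6 := h.mul_right c'
  rw [Finset.sum_mul] at h6
  simp only [mul_assoc] at h6
  intro a ha
  have h7 := ih (fun a => barScalar K (qNumber K (a + 1)) •
    (torusChain K n j (k - j) * s (a + 1)) * c') (fun a => ?_) h6 a ha
  · simp only [smul_mul_assoc] at h7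
    have h8 := (h7.of_smul ((map_ne_zero _).mpr (qNumber_ne_zero a))).mul_left c'
      |>.mul_right (torusChain K n j (k - j))
    rwa [mul_assoc, mul_assoc, mul_assoc, h4, mul_one, ← mul_assoc, h4, one_mul] at h8
  · rw [smul_mul_assoc]
    exact Submodule.smul_mem _ _ (conj_mem_rootSpan (q_ne K) h3 h4 _
      (fun i hi => torusChain_W (by omega) (by omega)) (by omega) (hs _))

/-- Sums of distinct powers of a root vector, with coefficients in the previous span, may be separated
modulo elements acting by zero, by repeated differentiation. -/
theorem ActsByZero.of_sum {k j : ℕ} (hk : k < n) (hj : j ≤ k) (N : ℕ) (s : ℕ → Uq K n)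
    (hs : ∀ a, s a ∈ rootSpan (q K) (natSeq E) k j)
    (h : ActsByZero (∑ a ∈ Finset.range N, Echain K n j (k - j) ^ a * s a)) :
    ∀ a < N, ActsByZero (s a) := by
  induction N generalizing s with
  | zero => intro a ha; omega
  | succ N ih =>
    have h1 := ActsByZero.of_entry hk hj rfl rfl ih hs
      (h.natCoproduct ⟨j, by omega⟩ ⟨k + 1, by omega⟩)
    intro a ha
    cases a with
    | succ a => exact h1 a (by omega)
    | zero =>
      rw [Finset.sum_range_succ'] at h
      have := h.sub (ActsByZero.sum fun a ha => (h1 a (Finset.mem_range.mp ha)).mul_left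
        (Echain K n j (k - j) ^ (a + 1)))
      rwa [add_sub_cancel_left, pow_zero, one_mul] at this

theorem rootSpan_le_letters (k : ℕ) {j : ℕ} (hj : j ≤ k + 1) :
    rootSpan (q K) (natSeq (E : Fin n → Uq K n)) k j ≤
      (letters (RatFunc K) (natSeq E) (k + 1)).toSubmodule := by
  induction j with
  | zero =>
    exact Algebra.adjoin_mono fun x ⟨i, hi, hx⟩ => ⟨i, by omega, hx⟩
  | succ j ih =>
    refine Submodule.span_le.mpr ?_
    rintro _ ⟨a, s, hs, rfl⟩
    exact Subalgebra.mul_mem _ (Subalgebra.pow_mem _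
      (chain_mem fun i _ h2 => mem_letters (by omega)) _) (ih (by omega) hs)

/-- `U^+` acts faithfully on the finite dimensional modules of type `1`. -/
theorem ActsByZero.eq_zero_of_mem_letters {k : ℕ} (hk : k ≤ n) {x : Uq K n}
    (hx : x ∈ letters (RatFunc K) (natSeq E) k) (h : ActsByZero x) : x = 0 := by
  induction k generalizing x with
  | zero =>
    have h0 : letters (RatFunc K) (natSeq (E : Fin n → Uq K n)) 0 = ⊥ := by
      simp [letters]
    rw [h0] at hx
    obtain ⟨a, rfl⟩ := hx
    rw [h.algebraMap_eq_zero, map_zero]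
  | succ k ih =>
    have key : ∀ j ≤ k + 1, ∀ x ∈ rootSpan (q K) (natSeq E) k j, ActsByZero (x : Uq K n) →
        x = 0 := by
      intro j
      induction j with
      | zero => exact fun _ x hx h => ih (by omega) hx h
      | succ j ihj =>
        intro hj x hx h
        obtain ⟨N, s, hs, rfl⟩ := exists_sum_of_mem_rootSpan hx
        refine Finset.sum_eq_zero fun a ha => ?_
        rw [ihj (by omega) _ (hs a) (h.of_sum (by omega) (by omega) _ _ hs a
          (Finset.mem_range.mp ha)), mul_zero]
    exact key _ le_rfl x (letters_le_rootSpan (q_ne K) (q_sq_add_one K) serreSeq k hx) h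

/-- An element of `U^+` annihilated by all skew derivations is a scalar. -/
theorem mem_letters_zero {x : Uq K n} {k : ℕ} (hk : k ≤ n)
    (hx : x ∈ letters (RatFunc K) (natSeq E) k)
    (h : ∀ l m : Fin (n + 1), l < m → ActsByZero (natCoproduct K n x l m)) :
    x ∈ letters (RatFunc K) (natSeq E) 0 := by
  induction k with
  | zero => exact hx
  | succ k ih =>
    refine ih (by omega) ?_
    have key : ∀ j ≤ k + 1, x ∈ rootSpan (q K) (natSeq E) k j → x ∈ rootSpan (q K) (natSeq E) k 0 := by
      intro j
      induction j with
      | zero => exact fun _ hx => hx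
      | succ j ihj =>
        intro hj hx
        refine ihj (by omega) ?_
        obtain ⟨N, s, hs, rfl⟩ := exists_sum_of_mem_rootSpan hx
        have h1 := h ⟨j, by omega⟩ ⟨k + 1, by omega⟩ (by simp; omega)
        have h1 := ActsByZero.of_entry (k := k) (j := j) (N := N) hk (by omega) rfl rfl
          (ActsByZero.of_sum hk (by omega) N) hs h1
        have h2 : ∀ a < N, s (a + 1) = 0 := fun a ha =>
          ActsByZero.eq_zero_of_mem_letters hk (rootSpan_le_letters k (by omega) (hs _)) (h1 a ha)
        have h3 : ∑ a ∈ Finset.range N, Echain K n j (k - j) ^ (a + 1) * s (a + 1) = 0 :=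
          Finset.sum_eq_zero fun a ha => by rw [h2 a (Finset.mem_range.mp ha), mul_zero]
        rw [Finset.sum_range_succ', h3, zero_add, pow_zero, one_mul]
        exact hs 0
    exact key _ le_rfl (letters_le_rootSpan (q_ne K) (q_sq_add_one K) serreSeq k hx)

/-- The matrices of elements of `U^+` are upper triangular, with the element itself on the diagonal. -/
theorem natCoproduct_letters {x : Uq K n} (hx : x ∈ letters (RatFunc K) (natSeq E) n)
    {l m : Fin (n + 1)} (h : m ≤ l) : natCoproduct K n x l m = if l = m then x else 0 := by
  induction hx using Algebra.adjoin_induction generalizing l m with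
  | mem y hy =>
    obtain ⟨i, hi, rfl⟩ := hy
    rw [Fin.le_def] at h
    rw [natSeq_of_lt _ hi, natCoproduct_E, if_neg (by simp only; omega), zero_add]
  | algebraMap r => rw [AlgHom.commutes, Matrix.algebraMap_matrix_apply]
  | add y y' _ _ h1 h2 =>
    rw [map_add, Matrix.add_apply, h1 h, h2 h]
    split_ifs <;> simp
  | mul y y' _ _ h1 h2 =>
    rw [map_mul, Matrix.mul_apply, Finset.sum_eq_single m]
    · rw [h1 h, h2 le_rfl, if_pos rfl]
      split_ifs <;> simp
    · intro r _ hr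
      rcases lt_or_gt_of_ne hr with h3 | h3
      · rw [h1 (h3.le.trans h), if_neg (by rintro rfl; exact absurd h (not_le.mpr h3)), zero_mul]
      · rw [h2 h3.le, if_neg hr, mul_zero]
    · simp

/-- If `x ∈ U^+` commutes with all `F_i` on every module, then its skew derivations vanish. -/
theorem actsByZero_natCoproduct {x : Uq K n} (hx : x ∈ letters (RatFunc K) (natSeq E) n)
    (h : ∀ i, ActsByZero (x * F i - F i * x)) (l m : Fin (n + 1)) (hlm : l < m) :
    ActsByZero (natCoproduct K n x l m) := by
  have key : ∀ i : Fin n, l ≤ i.castSucc → natCoproduct K n (x * F i - F i * x) l i.castSucc =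
      natCoproduct K n x l i.succ + q K ^ natWeight K i i.castSucc •
        (natCoproduct K n x l i.castSucc * F i) -
          q K ^ natWeight K i l • (F i * natCoproduct K n x l i.castSucc) := by
    intro i hli
    rw [Fin.le_def, Fin.val_castSucc] at hli
    rw [map_sub, Matrix.sub_apply, map_mul, map_mul, Matrix.mul_apply, Matrix.mul_apply]
    have h1 : ∀ r : Fin (n + 1), natCoproduct K n (F i) r i.castSucc =
        (if r = i.succ then 1 else 0) +
          if r = i.castSucc then q K ^ natWeight K i i.castSucc • F i else 0 := by
      intro r
      rw [natCoproduct_F]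
      refine congrArg₂ _ (if_congr (by simp [Fin.ext_iff]) rfl rfl) ?_
      split_ifs with h
      · rw [h]
      · rfl
    have h2 : ∀ r : Fin (n + 1), natCoproduct K n (F i) l r =
        if l = r then q K ^ natWeight K i l • F i else 0 := by
      intro r
      rw [natCoproduct_F, if_neg (by omega), zero_add]
    simp only [h1, h2, mul_add, Finset.sum_add_distrib, mul_ite, ite_mul, mul_zero, zero_mul,
      Finset.sum_ite_eq, Finset.sum_ite_eq', Finset.mem_univ, if_true, mul_one, mul_smul_comm,
      smul_mul_assoc]
  obtain ⟨d, hd⟩ : ∃ d, m.val = l.val + d + 1 := ⟨m.val - l.val - 1, by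
    have := Fin.lt_def.mp hlm; omega⟩
  have hi : l.val + d < n := by omega
  induction d generalizing m with
  | zero =>
    obtain rfl : m = Fin.succ ⟨l.val, hi⟩ := Fin.ext hd
    have h1 : Fin.castSucc ⟨l.val, hi⟩ = l := rfl
    have h2 := key ⟨l.val, hi⟩ le_rfl
    rw [h1, natCoproduct_letters hx le_rfl, if_pos rfl, add_sub_assoc, ← smul_sub] at h2
    have h3 := ((h ⟨l.val, hi⟩).natCoproduct l l).sub ((h ⟨l.val, hi⟩).smul (q K ^ natWeight K ⟨l.val, hi⟩ l))
    rwa [h2, add_sub_cancel_right] at h3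
  | succ d ih =>
    obtain rfl : m = Fin.succ ⟨l.val + (d + 1), hi⟩ := Fin.ext hd
    have h0 := ih (Fin.castSucc ⟨l.val + (d + 1), hi⟩) (by rw [Fin.lt_def]; simp) (by simp; omega)
      (by omega)
    have h2 := key ⟨l.val + (d + 1), hi⟩ (by rw [Fin.le_def]; simp)
    have h3 := (((h ⟨l.val + (d + 1), hi⟩).natCoproduct l (Fin.castSucc ⟨l.val + (d + 1), hi⟩)).add
      ((h0.mul_left (F ⟨l.val + (d + 1), hi⟩)).smul (q K ^ natWeight K ⟨l.val + (d + 1), hi⟩ l))).sub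
        ((h0.mul_right (F ⟨l.val + (d + 1), hi⟩)).smul (q K ^ natWeight K ⟨l.val + (d + 1), hi⟩
          (Fin.castSucc ⟨l.val + (d + 1), hi⟩)))
    rwa [h2, sub_add_cancel, add_sub_cancel_right] at h3

theorem q_zpow_eq_one {m : ℤ} (h : q K ^ m = 1) : m = 0 := by
  by_contra hm
  have h1 : q K ^ m.natAbs = 1 := by
    rcases Int.natAbs_eq m with h2 | h2
    · rw [h2, zpow_natCast] at h; exact h
    · rw [h2, zpow_neg, zpow_natCast, inv_eq_one] at h; exact h
  exact q_pow_ne_one (by omega) h1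

theorem mem_letters_of_mem_UplusWeight {μ : Fin n →₀ ℕ} {x : Uq K n} (hx : x ∈ UplusWeight K μ) :
    x ∈ letters (RatFunc K) (natSeq E) n := by
  refine Algebra.adjoin_mono ?_ hx.1
  rintro _ ⟨i, rfl⟩
  exact ⟨i, i.isLt, (natSeq_val _ _).symm⟩

/-- An element of `U^+` of non-zero weight that commutes with all `F_i` on every module is zero. -/
theorem eq_zero_of_mem_UplusWeight {μ : Fin n →₀ ℕ} (hμ : μ ≠ 0) {x : Uq K n} (hx : x ∈ UplusWeight K μ)
    (h : ∀ i, ActsByZero (x * F i - F i * x)) : x = 0 := by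
  have h0 := mem_letters_zero le_rfl (mem_letters_of_mem_UplusWeight hx)
    (actsByZero_natCoproduct (mem_letters_of_mem_UplusWeight hx) h)
  have h1 : letters (RatFunc K) (natSeq (E : Fin n → Uq K n)) 0 = ⊥ := by
    simp [letters]
  rw [h1] at h0
  obtain ⟨a, rfl⟩ := h0
  by_contra ha
  apply hμ
  have h2 : (fun j => (μ j : ℤ)) = 0 := by
    refine eq_zero_of_form_alpha fun i => q_zpow_eq_one (K := K) ?_
    have h3 := hx.2 i
    change Kg i * algebraMap _ _ a * Ki i = _ • algebraMap _ _ a at h3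
    rw [← Algebra.commutes, mul_assoc, Uq_relations.KL, mul_one, ← sub_eq_zero] at h3
    rw [Algebra.smul_def, ← map_mul, ← map_sub] at h3
    have h4 : a ≠ 0 := by
      rintro rfl
      exact ha (map_zero (algebraMap (RatFunc K) (Uq K n)))
    have h5 : a - q K ^ form (fun j => (μ j : ℤ)) (alpha i) * a = 0 :=
      ActsByZero.algebraMap_eq_zero (n := n) (h3 ▸ ActsByZero.zero)
    have h6 : (1 - q K ^ form (fun j => (μ j : ℤ)) (alpha i)) * a = 0 := by
      rw [sub_mul, one_mul, h5]
    exact (sub_eq_zero.mp ((mul_eq_zero.mp h6).resolve_right h4)).symm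
  ext j
  have := congrFun h2 j
  simpa using this

end Faithful

/-! ### The principal grading and Laurent series over `U_q` -/

section Grading

open HahnSeries

variable {K : Type u} [Field K] {n : ℕ}

theorem smul_single_eq {A : Type*} [Ring A] [Algebra (RatFunc K) A] (r : RatFunc K) (d : ℤ)
    (x : A) : r • (single d x : HahnSeries ℤ A) = single d (r • x) :=
  ((single.linearMap (R := RatFunc K) d).map_smul r x).symm

theorem grading_relations : QuantumRelations (q K)
    (fun i : Fin n => (single 1 (E i) : HahnSeries ℤ (Uq K n)))
    (fun i => single (-1) (F i)) (fun i => single 0 (Kg i)) (fun i => single 0 (Ki i)) := by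
  have h := Uq_relations (K := K) (n := n)
  refine ⟨fun i => ?_, fun i => ?_, fun i j => ?_, fun i j => ?_, fun i j => ?_, fun i j => ?_,
    fun i j hij => ?_, fun i j hij => ?_, fun i j hij => ?_, fun i j hij => ?_⟩
  · rw [single_mul_single, h.KL]; rfl
  · rw [single_mul_single, h.LK]; rfl
  · rw [single_mul_single, single_mul_single, h.KK]
  · rw [single_mul_single, single_mul_single, smul_single_eq, h.KE]; rfl
  · rw [single_mul_single, single_mul_single, smul_single_eq, h.KF]; rfl
  · have := h.EF i j
    rw [single_mul_single, single_mul_single, show (-1 + 1 : ℤ) = 1 + -1 by ring, ← single_sub, this,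
      show (1 + -1 : ℤ) = 0 by ring]
    split_ifs
    · rw [← single_sub, smul_single_eq]
    · exact single_eq_zero
  · rw [single_mul_single, single_mul_single, h.EE i j hij]
  · rw [single_mul_single, single_mul_single, h.FF i j hij]
  · simp only [single_mul_single]
    rw [smul_single_eq, ← single_sub, ← single_add, h.serreE i j hij, single_eq_zero]
  · simp only [single_mul_single]
    rw [smul_single_eq, ← single_sub, ← single_add, h.serreF i j hij, single_eq_zero]

/-- The homomorphism `x ↦ ∑ x_d t^d` from `U_q` to Laurent series over `U_q`, where `x_d` is the
component of `x` of degree `d` for the grading with `E_i` of degree `1` and `F_i` of degree `-1`. -/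
noncomputable def grading (K : Type u) [Field K] (n : ℕ) :
    Uq K n →ₐ[RatFunc K] HahnSeries ℤ (Uq K n) :=
  liftUq grading_relations

theorem grading_E (i : Fin n) : grading K n (E i) = single 1 (E i) :=
  liftUq_mk grading_relations (Gen.E i)
theorem grading_F (i : Fin n) : grading K n (F i) = single (-1) (F i) :=
  liftUq_mk grading_relations (Gen.F i)
theorem grading_Kg (i : Fin n) : grading K n (Kg i) = single 0 (Kg i) :=
  liftUq_mk grading_relations (Gen.K i)
theorem grading_Ki (i : Fin n) : grading K n (Ki i) = single 0 (Ki i) :=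
  liftUq_mk grading_relations (Gen.L i)

theorem grading_algebraMap (a : RatFunc K) :
    grading K n (algebraMap _ _ a) = single 0 (algebraMap _ _ a) :=
  (grading K n).commutes a

theorem grading_mul {x y : Uq K n} {d d' : ℤ} (hx : grading K n x = single d x)
    (hy : grading K n y = single d' y) : grading K n (x * y) = single (d + d') (x * y) := by
  rw [map_mul, hx, hy, single_mul_single]

theorem grading_smul {x : Uq K n} {d : ℤ} (hx : grading K n x = single d x) (r : RatFunc K) :
    grading K n (r • x) = single d (r • x) := by
  rw [map_smul, hx, smul_single_eq]

theorem grading_chain {e : ℕ → Uq K n} (he : ∀ i, grading K n (e i) = single 1 (e i)) (i d : ℕ) :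
    grading K n (chain (q K) e i d) = single (d + 1 : ℤ) (chain (q K) e i d) := by
  induction d generalizing i with
  | zero => simpa [chain] using he i
  | succ d ih =>
    have h := grading_mul (he i) (ih (i + 1))
    have h' := grading_smul (grading_mul (ih (i + 1)) (he i)) (q K)⁻¹
    rw [chain_succ, qcomm, map_sub, h, h', single_sub]
    push_cast
    rw [add_comm (1 : ℤ)]

theorem grading_natSeq {e : Fin n → Uq K n} (he : ∀ i, grading K n (e i) = single 1 (e i)) (i : ℕ) :
    grading K n (natSeq e i) = single 1 (natSeq e i) := by
  unfold natSeq
  split_ifs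
  · exact he _
  · rw [map_zero, single_eq_zero]

theorem grading_Echain (i d : ℕ) :
    grading K n (Echain K n i d) = single (d + 1 : ℤ) (Echain K n i d) :=
  grading_chain (grading_natSeq grading_E) i d

theorem grading_EchainRev (i d : ℕ) :
    grading K n (EchainRev K n i d) = single (d + 1 : ℤ) (EchainRev K n i d) :=
  grading_chain (grading_natSeq fun _ => grading_E _) i d

/-- The expansion into homogeneous components is injective: it has finitely many terms, and an element
is recovered as their sum. -/
theorem grading_injective : Function.Injective (grading K n) := by
  let ι : AddMonoidAlgebra (Uq K n) ℤ →+* HahnSeries ℤ (Uq K n) :=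
    AddMonoidAlgebra.liftNCRingHom C
      { toFun := fun d => single d.toAdd 1
        map_one' := rfl
        map_mul' := fun d d' => by rw [single_mul_single, mul_one]; rfl }
      fun x d => by
        change single 0 x * single _ 1 = single _ 1 * single 0 x
        rw [single_mul_single, single_mul_single, mul_one, one_mul, add_comm]
  let ev : AddMonoidAlgebra (Uq K n) ℤ →+* Uq K n :=
    AddMonoidAlgebra.liftNCRingHom (RingHom.id _) 1 fun x d => Commute.one_right x
  have hι : ∀ d x, ι (AddMonoidAlgebra.single d x) = single d x := fun d x => by
    rw [AddMonoidAlgebra.liftNCRingHom_single]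
    change single 0 x * single d 1 = _
    rw [single_mul_single, zero_add, mul_one]
  have hev : ∀ d x, ev (AddMonoidAlgebra.single d x) = x := fun d x => by
    rw [AddMonoidAlgebra.liftNCRingHom_single]
    exact mul_one x
  have hcoeff : ∀ p d, (ι p).coeff d = p.coeff d := by
    intro p d
    induction p using AddMonoidAlgebra.induction_linear with
    | zero => rw [map_zero]; rfl
    | add p p' h h' => rw [map_add, coeff_add, h, h']; rfl
    | single d' x =>
      rw [hι, AddMonoidAlgebra.coeff_single, Finsupp.single_apply]
      rcases eq_or_ne d' d with h | h
      · rw [if_pos h, h, coeff_single_same]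
      · rw [if_neg h, coeff_single_of_ne h.symm]
  have hinj : Function.Injective ι := by
    intro p p' h
    ext d
    rw [← hcoeff, h, hcoeff]
  have key : ∀ x : Uq K n, ∃ p, ι p = grading K n x ∧ ev p = x := by
    intro x
    induction x using Uq_induction with
    | scalar a => exact ⟨AddMonoidAlgebra.single 0 (algebraMap _ _ a), by rw [hι, grading_algebraMap], hev _ _⟩
    | hE i => exact ⟨AddMonoidAlgebra.single 1 (E i), by rw [hι, grading_E], hev _ _⟩
    | hF i => exact ⟨AddMonoidAlgebra.single (-1) (F i), by rw [hι, grading_F], hev _ _⟩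
    | hK i => exact ⟨AddMonoidAlgebra.single 0 (Kg i), by rw [hι, grading_Kg], hev _ _⟩
    | hL i => exact ⟨AddMonoidAlgebra.single 0 (Ki i), by rw [hι, grading_Ki], hev _ _⟩
    | add x y hx hy =>
      obtain ⟨p, h1, h2⟩ := hx
      obtain ⟨p', h3, h4⟩ := hy
      exact ⟨p + p', by rw [map_add, map_add, h1, h3], by rw [map_add, h2, h4]⟩
    | mul x y hx hy =>
      obtain ⟨p, h1, h2⟩ := hx
      obtain ⟨p', h3, h4⟩ := hy
      exact ⟨p * p', by rw [map_mul, map_mul, h1, h3], by rw [map_mul, h2, h4]⟩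
  intro x y hxy
  obtain ⟨p, h1, h2⟩ := key x
  obtain ⟨p', h3, h4⟩ := key y
  rw [← h2, ← h4, hinj (h1.trans (hxy.trans h3.symm))]

/-- Multiplication by `n`, as a homomorphism `ℕ → ℤ`. -/
def natMul (n : ℕ) : ℕ →+ ℤ := (AddMonoidHom.mulLeft (n : ℤ)).comp (Nat.castAddMonoidHom ℤ)

theorem natMul_injective (hn : 0 < n) : Function.Injective (natMul n) := by
  intro a b h
  have h' : (n : ℤ) * a = n * b := h
  have : (n : ℤ) ≠ 0 := by omega
  exact_mod_cast mul_left_cancel₀ this h'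

theorem natMul_le_natMul (hn : 0 < n) (a b : ℕ) : natMul n a ≤ natMul n b ↔ a ≤ b := by
  have : (0 : ℤ) < n := by omega
  change (n : ℤ) * a ≤ n * b ↔ a ≤ b
  rw [mul_le_mul_iff_right₀ this, Nat.cast_le]

/-- The homomorphism `∑ x_k t^k ↦ ∑ x_k t^{nk}` from power series to Laurent series. -/
noncomputable def substPow {A : Type*} [Ring A] {n : ℕ} (hn : 0 < n) :
    PowerSeries A →+* HahnSeries ℤ A :=
  (embDomainRingHom (natMul n) (natMul_injective hn) (natMul_le_natMul hn)).comp
    (RingEquiv.toRingHom toPowerSeries.symm)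

theorem substPow_C {A : Type*} [Ring A] (hn : 0 < n) (x : A) :
    substPow hn (PowerSeries.C x) = single 0 x := by
  have : toPowerSeries.symm (PowerSeries.C x) = C x := by
    ext k
    rw [coeff_toPowerSeries_symm, PowerSeries.coeff_C, C_apply, coeff_single]
    split_ifs <;> rfl
  unfold substPow
  rw [RingHom.comp_apply]
  change embDomainRingHom _ _ _ (toPowerSeries.symm (PowerSeries.C x)) = _
  rw [this, embDomainRingHom_C]
  rfl

theorem substPow_X {A : Type*} [Ring A] (hn : 0 < n) :
    substPow hn (PowerSeries.X : PowerSeries A) = single (n : ℤ) 1 := by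
  have : toPowerSeries.symm (PowerSeries.X : PowerSeries A) = single 1 1 := by
    ext k
    rw [coeff_toPowerSeries_symm, PowerSeries.coeff_X, coeff_single]
    split_ifs <;> rfl
  unfold substPow
  rw [RingHom.comp_apply]
  change embDomainRingHom _ _ _ (toPowerSeries.symm (PowerSeries.X : PowerSeries A)) = _
  rw [this, embDomainRingHom_apply, embDomain_single]
  simp [natMul]

end Grading

/-! ### Weights -/

section Weights

variable {K : Type u} [Field K] {n : ℕ}

/-- `x` has weight `β` in the root lattice. -/
def HasWeight (x : Uq K n) (β : Fin n → ℤ) : Prop :=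
  ∀ i, W (q K) (Kg i) x (form β (alpha i))

namespace HasWeight

variable {x y : Uq K n} {β β' : Fin n → ℤ}

theorem mul (hx : HasWeight x β) (hy : HasWeight y β') : HasWeight (x * y) (β + β') :=
  fun i => ((hx i).mul (q_ne K) (hy i)).of_eq (form_add_left _ _ _).symm

theorem smul (hx : HasWeight x β) (r : RatFunc K) : HasWeight (r • x) β :=
  fun i => (hx i).smul r

theorem one : HasWeight (1 : Uq K n) 0 :=
  fun i => (W.comm (by simp)).of_eq (by simp [form])

theorem pow (hx : HasWeight x β) (k : ℕ) : HasWeight (x ^ k) (k • β) := by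
  induction k with
  | zero => rw [pow_zero, zero_smul]; exact one
  | succ k ih => rw [pow_succ, succ_nsmul]; exact ih.mul hx

theorem bar (hx : HasWeight x β) : HasWeight (QSP.bar x) β := by
  intro i
  have h : W (q K) (Ki i) (QSP.bar x) (-form β (alpha i)) := by
    have h1 := congrArg QSP.bar (hx i)
    rw [bar_smul, map_mul, map_mul, bar_Kg, map_zpow₀, barScalar_q, inv_zpow'] at h1
    exact h1
  exact (h.inv (q_ne K) (Uq_relations.LK i) (Uq_relations.KL i)).of_eq (neg_neg _)

theorem E (i : Fin n) : HasWeight (E i : Uq K n) (alpha i) := fun j =>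
  (Uq_relations.wE j i).of_eq (by rw [form_alpha_alpha, cartan_symm])

theorem F (i : Fin n) : HasWeight (F i : Uq K n) (-alpha i) := fun j =>
  (Uq_relations.wF j i).of_eq (by rw [form_neg_left, form_alpha_alpha, cartan_symm])

theorem Ki (i : Fin n) : HasWeight (Ki i : Uq K n) 0 := fun j => by
  have h : W (q K) (Kg i) (Kg j : Uq K n) 0 := W.comm (Uq_relations.KK i j)
  have h1 := h.inv (q_ne K) (Uq_relations.KL i) (Uq_relations.LK i)
  unfold W at h1
  rw [neg_zero, zpow_zero, one_smul] at h1
  exact (W.comm h1.symm).of_eq (by simp [form])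

theorem chain {e : ℕ → Uq K n} {β : ℕ → Fin n → ℤ} {i d : ℕ}
    (h : ∀ j, i ≤ j → j ≤ i + d → HasWeight (e j) (β j)) :
    HasWeight (chain (q K) e i d) (∑ j ∈ Finset.range (d + 1), β (i + j)) := fun l =>
  (chain_W (r := q K) (q_ne K) fun j h1 h2 => h j h1 h2 l).of_eq (by
    generalize Finset.range (d + 1) = t
    induction t using Finset.cons_induction with
    | empty => simp [form]
    | cons a t _ ih => rw [Finset.sum_cons, Finset.sum_cons, form_add_left, ih])

end HasWeight

theorem sum_natSeq_alpha (σ : Fin n ≃ Fin n) :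
    ∑ j ∈ Finset.range n, natSeq (fun i => alpha (σ i)) j = fun _ => 1 := by
  rw [Finset.sum_range]
  simp only [natSeq_val]
  rw [σ.sum_comp fun i => alpha i]
  ext l
  simp [alpha, Finset.sum_apply, Pi.single_apply]

theorem hasWeight_natSeq (σ : Fin n ≃ Fin n) {j : ℕ} (hj : j < n) :
    HasWeight (natSeq (fun i => (E (σ i) : Uq K n)) j) (natSeq (fun i => alpha (σ i)) j) := by
  rw [natSeq_of_lt _ hj, natSeq_of_lt _ hj]
  exact HasWeight.E _

theorem hasWeight_highest (hn : 2 ≤ n) (σ : Fin n ≃ Fin n) :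
    HasWeight (chain (q K) (natSeq fun i => (E (σ i) : Uq K n)) 0 (n - 1)) (fun _ => 1) := by
  have := HasWeight.chain (K := K) (i := 0) (d := n - 1) fun j _ hj =>
    hasWeight_natSeq (K := K) σ (j := j) (by omega)
  rw [show n - 1 + 1 = n by omega] at this
  simp only [zero_add] at this
  rwa [sum_natSeq_alpha] at this

theorem hasWeight_Echain (hn : 2 ≤ n) : HasWeight (Echain K n 0 (n - 1)) fun _ => 1 :=
  hasWeight_highest hn (Equiv.refl _)

theorem hasWeight_EchainRev (hn : 2 ≤ n) : HasWeight (EchainRev K n 0 (n - 1)) fun _ => 1 :=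
  hasWeight_highest hn Fin.revPerm

theorem hasWeight_next (hn : 2 ≤ n) (σ : Fin n ≃ Fin n) {i : Fin n} (hi : i.val = 0) :
    HasWeight (chain (q K) (natSeq fun i => (E (σ i) : Uq K n)) 1 (n - 2))
      ((fun _ => 1) - alpha (σ i)) := by
  have := HasWeight.chain (K := K) (i := 1) (d := n - 2) fun j _ hj =>
    hasWeight_natSeq (K := K) σ (j := j) (by omega)
  have h2 := sum_natSeq_alpha σ
  rw [show Finset.range n = Finset.range (n - 2 + 1 + 1) by congr 1; omega,
    Finset.sum_range_succ'] at h2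
  rw [← h2, natSeq_of_lt _ (by omega : 0 < n), show (⟨0, by omega⟩ : Fin n) = i from
    Fin.ext hi.symm, add_sub_cancel_right]
  simpa only [add_comm 1] using this

/-- The weight of the second summand of `B_i`. -/
theorem hasWeight_Bgen (hn : 2 ≤ n) {i : Fin n} (hi : ¬ Black i) :
    HasWeight (TwX K n (E (Fin.rev i)) * Ki i) ((fun _ => 1) - alpha i) := by
  have h0 := i.isLt
  rw [← add_zero ((fun _ => 1) - alpha i)]
  refine HasWeight.mul ?_ (HasWeight.Ki i)
  by_cases h : i.val = 0
  · rw [TwX_E_last hn (by rw [Fin.val_rev]; omega)]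
    exact hasWeight_next hn (Equiv.refl _) h
  · have h1 : i.val + 1 = n := by
      by_contra h1
      exact hi ⟨by omega, by omega⟩
    have h2 : (Fin.rev i).val = 0 := by rw [Fin.val_rev]; omega
    rw [TwX_E_first hn h2]
    have := hasWeight_next (K := K) hn Fin.revPerm h2
    rw [Fin.revPerm_apply, Fin.rev_rev] at this
    exact this

theorem Kroot_W {y : Uq K n} {β : Fin n → ℤ} (hy : HasWeight y β) (x : Fin n → ℤ) :
    W (q K) (Kroot x) y (form x β) := by
  have h0 : W (q K) 1 y 0 := W.comm (by simp)
  have hp : ∀ {k : Uq K n} {m : ℤ} (t : ℕ), W (q K) k y m → W (q K) (k ^ t) y (t * m) := by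
    intro k m t h
    induction t with
    | zero => simpa using h0
    | succ t ih =>
      rw [pow_succ]
      exact (ih.mulK (q_ne K) h).of_eq (by push_cast; ring)
  rw [form_eq_sum, Fin.sum_univ_def]
  unfold Kroot
  generalize List.finRange n = l
  induction l with
  | nil => simpa using h0
  | cons i l ih =>
    rw [List.map_cons, List.prod_cons, List.map_cons, List.sum_cons]
    refine W.mulK (q_ne K) ?_ ih
    have h1 := hy i
    have h2 := h1.inv (q_ne K) (Uq_relations.KL i) (Uq_relations.LK i)
    rw [form_symm β] at h1 h2
    split_ifs with hx
    · refine (hp _ h1).of_eq ?_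
      rw [Int.toNat_of_nonneg hx]
    · refine (hp _ h2).of_eq ?_
      rw [Int.toNat_of_nonneg (by omega)]
      ring

theorem bar_Kroot (x : Fin n → ℤ) : bar (Kroot x : Uq K n) = Kroot (-x) := by
  unfold Kroot
  rw [map_list_prod, List.map_map]
  congr 1
  refine List.map_congr_left fun i _ => ?_
  simp only [Function.comp_apply, Pi.neg_apply]
  rcases lt_trichotomy (x i) 0 with h | h | h
  · rw [if_neg (by omega), if_pos (by omega), map_pow, bar_Ki]
  · simp [h]
  · rw [if_pos (by omega), if_neg (by omega), map_pow, bar_Kg, neg_neg]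

end Weights

/-! ### The bar involution of the coideal subalgebra -/

section BarInvolution

variable {K : Type u} [Field K] {n : ℕ}

theorem bar_mem_leviGenerators {x : Uq K n} (hx : x ∈ leviGenerators K n) :
    bar x ∈ leviGenerators K n := by
  rcases hx with ⟨i, hi, h⟩ | ⟨x, hx, rfl⟩
  · refine Or.inl ⟨i, hi, ?_⟩
    rcases h with rfl | rfl | rfl | rfl
    · exact Or.inl (bar_E i)
    · exact Or.inr (Or.inl (bar_F i))
    · exact Or.inr (Or.inr (Or.inr (bar_Kg i)))
    · exact Or.inr (Or.inr (Or.inl (bar_Ki i)))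
  · exact Or.inr ⟨-x, by rw [Theta_neg, hx], bar_Kroot x⟩

theorem leviGenerators_commute (hn : 2 ≤ n) {x : Uq K n} (hx : x ∈ leviGenerators K n) :
    Commute x (Echain K n 0 (n - 1)) ∧ Commute x (EchainRev K n 0 (n - 1)) := by
  rcases hx with ⟨i, hi, h⟩ | ⟨x, hx, rfl⟩
  · obtain ⟨h1, h2, h3, h4⟩ := Uq_relations.highest_commute_black (q_ne K) (q_sq_sub_one K)
      (q_sq_add_one K) hn hi
    have hi' : Black (Fin.rev i) := by
      rw [Black, Fin.val_rev] at *
      omega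
    obtain ⟨h1', h2', h3', h4'⟩ := Uq_relations.rev.highest_commute_black (q_ne K)
      (q_sq_sub_one K) (q_sq_add_one K) hn hi'
    rw [Fin.rev_rev] at h1' h2' h3' h4'
    rcases h with rfl | rfl | rfl | rfl
    exacts [⟨h1, h1'⟩, ⟨h2, h2'⟩, ⟨h3, h3'⟩, ⟨h4, h4'⟩]
  · have h1 := Kroot_W (hasWeight_Echain (K := K) hn) x
    have h2 := Kroot_W (hasWeight_EchainRev (K := K) hn) x
    rw [form_of_Theta_eq hn hx] at h1 h2
    unfold W at h1 h2
    rw [zpow_zero, one_smul] at h1 h2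
    exact ⟨h1, h2⟩

end BarInvolution

/-! ### Existence of the bar involution of the coideal subalgebra -/

section BarExistence

open PowerSeries

variable {K : Type u} [Field K] {n : ℕ}

theorem grading_leviGenerators {x : Uq K n} (hx : x ∈ leviGenerators K n) :
    ∃ d : ℤ, grading K n x = HahnSeries.single d x := by
  have hpow : ∀ {x : Uq K n}, grading K n x = HahnSeries.single 0 x → ∀ k : ℕ,
      grading K n (x ^ k) = HahnSeries.single 0 (x ^ k) := by
    intro x hx k
    rw [map_pow, hx, HahnSeries.single_pow, smul_zero]
  rcases hx with ⟨i, hi, h⟩ | ⟨x, hx, rfl⟩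
  · rcases h with rfl | rfl | rfl | rfl
    exacts [⟨_, grading_E i⟩, ⟨_, grading_F i⟩, ⟨_, grading_Kg i⟩, ⟨_, grading_Ki i⟩]
  · refine ⟨0, ?_⟩
    unfold Kroot
    generalize List.finRange n = l
    induction l with
    | nil => rw [List.map_nil, List.prod_nil, map_one]; rfl
    | cons i l ih =>
      rw [List.map_cons, List.prod_cons]
      refine grading_mul (d := 0) (d' := 0) ?_ ih
      split_ifs
      · exact hpow (grading_Kg i) _
      · exact hpow (grading_Ki i) _

/-- The second summand of `B_i` and its image under the bar involution are homogeneous. -/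
theorem grading_Bgen (hn : 2 ≤ n) {i : Fin n} (hi : ¬ Black i) (r : RatFunc K) :
    grading K n (r • (TwX K n (E (Fin.rev i)) * Ki i)) =
        HahnSeries.single (n - 1 : ℤ) (r • (TwX K n (E (Fin.rev i)) * Ki i)) ∧
      grading K n (bar (r • (TwX K n (E (Fin.rev i)) * Ki i))) =
        HahnSeries.single (n - 1 : ℤ) (bar (r • (TwX K n (E (Fin.rev i)) * Ki i))) := by
  have h0 := i.isLt
  have hd : ((n - 2 : ℕ) + 1 : ℤ) = n - 1 := by omega
  have key : ∀ x y : Uq K n, grading K n x = HahnSeries.single (n - 1 : ℤ) x →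
      grading K n y = HahnSeries.single (n - 1 : ℤ) y → bar x = (-q K) ^ (n - 2) • y →
      grading K n (r • (x * Ki i)) = HahnSeries.single (n - 1 : ℤ) (r • (x * Ki i)) ∧
        grading K n (bar (r • (x * Ki i))) = HahnSeries.single (n - 1 : ℤ) (bar (r • (x * Ki i))) := by
    intro x y hx hy hxy
    rw [bar_smul, map_mul, bar_Ki, hxy]
    have h1 := grading_smul (grading_mul hx (grading_Ki i)) r
    have h2 := grading_smul (grading_mul (grading_smul hy ((-q K) ^ (n - 2))) (grading_Kg i))
      (barScalar K r)
    rw [add_zero] at h1 h2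
    exact ⟨h1, h2⟩
  have g1 := grading_Echain (K := K) (n := n) 1 (n - 2)
  have g2 := grading_EchainRev (K := K) (n := n) 0 (n - 2)
  have g3 := grading_EchainRev (K := K) (n := n) 1 (n - 2)
  have g4 := grading_Echain (K := K) (n := n) 0 (n - 2)
  rw [hd] at g1 g2 g3 g4
  by_cases h : i.val = 0
  · rw [TwX_E_last hn (by rw [Fin.val_rev]; omega)]
    refine key _ _ g1 g2 ?_
    rw [bar_Echain (by omega), show n - 1 - 1 - (n - 2) = 0 by omega]
  · have h1 : i.val + 1 = n := by
      by_contra h1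
      exact hi ⟨by omega, by omega⟩
    rw [TwX_E_first hn (by rw [Fin.val_rev]; omega)]
    refine key _ _ g3 g4 ?_
    rw [bar_EchainRev (by omega), show n - 1 - 1 - (n - 2) = 0 by omega]

/-- The quasi `K`-matrix as a power series in a variable that records multiples of the highest
root. -/
noncomputable abbrev quasiK (s : Fin n → K) (c : Fin n → RatFunc K) (first last : Fin n) :
    (Uq K n)⟦X⟧ :=
  quasiSeries K n (Bcoeff s c first) (Bcoeff s c last)

variable {s : Fin n → K} {c : Fin n → RatFunc K} {first last : Fin n}

/-- The relation `B_i 𝔛 = 𝔛 bar(B_i)` for both white nodes. -/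
theorem C_F_mul (hn : 2 ≤ n) (hs : IsSignFunction s) (hc : IsParameter c) (hf : first.val = 0)
    (hl : last.val + 1 = n) {i : Fin n} (hi : ¬ Black i) :
    C (F i) * quasiK s c first last = quasiK s c first last * C (F i)
      + X * (C (Bcoeff s c i • (TwX K n (E (Fin.rev i)) * Ki i)) * quasiK s c first last)
      - X * (quasiK s c first last *
          C (bar (Bcoeff s c i • (TwX K n (E (Fin.rev i)) * Ki i)))) := by
  have h0 := i.isLt
  by_cases h : i.val = 0
  · obtain rfl : i = first := Fin.ext (h.trans hf.symm)
    rw [rev_first hf hl]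
    exact C_F_first_mul hn hs hc hf hl
  · obtain rfl : i = last := Fin.ext (by
      by_contra h1
      exact hi ⟨by omega, by omega⟩)
    rw [rev_last hf hl]
    exact C_F_last_mul hn hs hc hf hl

theorem single_one_commute {A : Type*} [Ring A] (d : ℤ) (y : HahnSeries ℤ A) :
    Commute (HahnSeries.single d 1) y := by
  ext a
  rw [HahnSeries.coeff_single_mul, HahnSeries.coeff_mul_single, one_mul, mul_one]

theorem single_eq_mul {A : Type*} [Ring A] (d : ℤ) (x : A) :
    (HahnSeries.single d x : HahnSeries ℤ A) =
      HahnSeries.single d 1 * HahnSeries.single 0 x := by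
  rw [HahnSeries.single_mul_single, add_zero, one_mul]

/-- `y 𝔛 = 𝔛 bar(x)` as Laurent series over `U_q`. -/
def Intertwines (hn : 0 < n) (Q : (Uq K n)⟦X⟧) (x y : Uq K n) : Prop :=
  grading K n y * substPow hn Q = substPow hn Q * grading K n (bar x)

namespace Intertwines

variable {hn : 0 < n} {Q : (Uq K n)⟦X⟧} {x y x' y' : Uq K n}

theorem add (h : Intertwines hn Q x y) (h' : Intertwines hn Q x' y') :
    Intertwines hn Q (x + x') (y + y') := by
  unfold Intertwines at *
  rw [map_add, map_add, map_add, add_mul, mul_add, h, h']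

theorem mul (h : Intertwines hn Q x y) (h' : Intertwines hn Q x' y') :
    Intertwines hn Q (x * x') (y * y') := by
  unfold Intertwines at *
  rw [map_mul, map_mul, map_mul, mul_assoc, h', ← mul_assoc, h, mul_assoc]

theorem scalar (a : RatFunc K) :
    Intertwines hn Q (algebraMap _ _ a) (algebraMap _ _ (barScalar K a)) := by
  unfold Intertwines
  rw [bar_algebraMap, AlgHom.commutes]
  exact Algebra.commutes _ _

/-- The relation is the graph of an injective partial map, since `𝔛` is invertible. -/
theorem left_unique (hQ : constantCoeff Q = 1) (h : Intertwines hn Q x y)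
    (h' : Intertwines hn Q x' y) : x = x' := by
  unfold Intertwines at *
  have h1 := h.symm.trans h'
  have h2 := congrArg (substPow hn (invOfUnit Q 1) * ·) h1
  simp only [← mul_assoc, ← map_mul] at h2
  rw [invOfUnit_mul Q 1 hQ, map_one, one_mul, one_mul] at h2
  have h3 := congrArg bar (grading_injective h2)
  rwa [bar_bar, bar_bar] at h3

theorem right_unique (hQ : constantCoeff Q = 1) (h : Intertwines hn Q x y)
    (h' : Intertwines hn Q x y') : y = y' := by
  unfold Intertwines at *
  have h1 := h.trans h'.symm
  have h2 := congrArg (· * substPow hn (invOfUnit Q 1)) h1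
  simp only [mul_assoc, ← map_mul] at h2
  rw [mul_invOfUnit Q 1 hQ, map_one, mul_one, mul_one] at h2
  exact grading_injective h2

end Intertwines

theorem intertwines_leviGenerators (hn : 2 ≤ n) {x : Uq K n} (hx : x ∈ leviGenerators K n) :
    Intertwines (by omega) (quasiK s c first last) x (bar x) := by
  obtain ⟨d, hd⟩ := grading_leviGenerators (bar_mem_leviGenerators hx)
  obtain ⟨h1, h2⟩ := leviGenerators_commute hn (bar_mem_leviGenerators hx)
  have h3 := congrArg (substPow (A := Uq K n) (by omega : 0 < n))
    (C_commute_quasiSeries h1 h2 (Bcoeff s c first) (Bcoeff s c last)).eq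
  rw [map_mul, map_mul, substPow_C] at h3
  unfold Intertwines
  rw [hd, single_eq_mul, mul_assoc, h3, ← mul_assoc, ← mul_assoc, (single_one_commute d _).eq]

/-- In Laurent series `t^n` marks the highest root, so that the factor `t` of the power series identity
turns the degree `-1` of `F_i` into the degree `n - 1` of the second summand of `B_i`. -/
theorem intertwines_Bgen (hn : 2 ≤ n) (hs : IsSignFunction s) (hc : IsParameter c)
    (hf : first.val = 0) (hl : last.val + 1 = n) {i : Fin n} (hi : ¬ Black i) :
    Intertwines (by omega) (quasiK s c first last) (Bgen s c i) (Bgen s c i) := by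
  obtain ⟨g1, g2⟩ := grading_Bgen hn hi (Bcoeff s c i)
  have h := congrArg (substPow (A := Uq K n) (by omega : 0 < n)) (C_F_mul hn hs hc hf hl hi)
  unfold Intertwines
  change grading K n (F i - Bcoeff s c i • _) * _ = _ * grading K n (bar (F i - Bcoeff s c i • _))
  rw [map_sub bar, bar_F, map_sub, map_sub, g1, g2, grading_F]
  generalize Bcoeff s c i • (TwX K n (E (Fin.rev i)) * Ki i) = D at *
  generalize bar D = D' at *
  generalize quasiK s c first last = Q at *
  simp only [map_add, map_sub, map_mul, substPow_C, substPow_X] at h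
  generalize substPow _ Q = Y at *
  have e : ∀ x : Uq K n, (HahnSeries.single (n - 1 : ℤ) x : HahnSeries ℤ (Uq K n)) =
      HahnSeries.single (-1) 1 * (HahnSeries.single (n : ℤ) 1 * HahnSeries.single 0 x) := by
    intro x
    rw [HahnSeries.single_mul_single, HahnSeries.single_mul_single, add_zero, one_mul, one_mul]
    congr 1
  have h1 := (single_one_commute (-1) Y).eq
  have h2 := (single_one_commute (n : ℤ) Y).eq
  rw [e, e, single_eq_mul (-1)]
  generalize (HahnSeries.single (-1) 1 : HahnSeries ℤ (Uq K n)) = t at *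
  generalize (HahnSeries.single (n : ℤ) 1 : HahnSeries ℤ (Uq K n)) = w at *
  rw [← mul_sub, ← mul_sub, mul_assoc, ← mul_assoc Y, ← h1, mul_assoc t, sub_mul, h, mul_sub Y,
    ← mul_assoc Y w, ← h2]
  simp only [mul_assoc]
  congr 1
  abel

/-- The bar involution of the coideal subalgebra exists. -/
theorem exists_isBarInvolution (hn : 2 ≤ n) (hs : IsSignFunction s) (hc : IsParameter c) :
    ∃ ψ : Bc s c ≃+* Bc s c, IsBarInvolution s c ψ := by
  obtain ⟨first, hf⟩ : ∃ i : Fin n, i.val = 0 := ⟨⟨0, by omega⟩, rfl⟩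
  obtain ⟨last, hl⟩ : ∃ i : Fin n, i.val + 1 = n := ⟨⟨n - 1, by omega⟩, by simp only; omega⟩
  have hn0 : 0 < n := by omega
  let R := Intertwines hn0 (quasiK s c first last)
  have hQ : constantCoeff (quasiK s c first last) = 1 := by
    simp [quasiSeries, qExpSeries, qFactorial]
  -- both projections of the graph contain the subalgebra
  have key : ∀ x ∈ Bc s c, (∃ y ∈ Bc s c, R x y) ∧ ∃ y ∈ Bc s c, R y x := by
    intro x hx
    induction hx using Algebra.adjoin_induction with
    | mem x hx =>
      rcases hx with hx | ⟨i, hi, rfl⟩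
      · have h1 : bar x ∈ Bc s c := Algebra.subset_adjoin (Or.inl (bar_mem_leviGenerators hx))
        have h2 : R x (bar x) := intertwines_leviGenerators hn hx
        have h3 : R (bar x) (bar (bar x)) :=
          intertwines_leviGenerators hn (bar_mem_leviGenerators hx)
        rw [bar_bar] at h3
        exact ⟨⟨_, h1, h2⟩, _, h1, h3⟩
      · have h1 : Bgen s c i ∈ Bc s c := Algebra.subset_adjoin (Or.inr ⟨i, hi, rfl⟩)
        have h2 := intertwines_Bgen hn hs hc hf hl hi
        exact ⟨⟨_, h1, h2⟩, _, h1, h2⟩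
    | algebraMap a =>
      have h2 : R (algebraMap _ _ (barScalar K a)) (algebraMap _ _ (barScalar K (barScalar K a))) :=
        Intertwines.scalar _
      rw [barScalar_barScalar] at h2
      exact ⟨⟨_, Subalgebra.algebraMap_mem _ _, Intertwines.scalar a⟩, _,
        Subalgebra.algebraMap_mem _ _, h2⟩
    | add x x' _ _ h h' =>
      obtain ⟨⟨y, hy, h1⟩, z, hz, h2⟩ := h
      obtain ⟨⟨y', hy', h1'⟩, z', hz', h2'⟩ := h'
      exact ⟨⟨_, add_mem hy hy', h1.add h1'⟩, _, add_mem hz hz', h2.add h2'⟩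
    | mul x x' _ _ h h' =>
      obtain ⟨⟨y, hy, h1⟩, z, hz, h2⟩ := h
      obtain ⟨⟨y', hy', h1'⟩, z', hz', h2'⟩ := h'
      exact ⟨⟨_, mul_mem hy hy', h1.mul h1'⟩, _, mul_mem hz hz', h2.mul h2'⟩
  have hex : ∀ x : Bc s c, ∃ y : Bc s c, R x y := fun x => by
    obtain ⟨y, hy, h⟩ := (key x x.2).1
    exact ⟨⟨y, hy⟩, h⟩
  choose f hf' using hex
  have huniq : ∀ {x y : Bc s c}, R x y → f x = y := fun {x y} h =>
    Subtype.ext ((hf' x).right_unique hQ h)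
  let ψ : Bc s c →+* Bc s c :=
    { toFun := f
      map_one' := huniq (by
        have : R (algebraMap (RatFunc K) _ 1) (algebraMap _ _ (barScalar K 1)) := Intertwines.scalar 1
        rwa [map_one, map_one, map_one] at this)
      map_zero' := huniq (by
        have : R (algebraMap (RatFunc K) _ 0) (algebraMap _ _ (barScalar K 0)) := Intertwines.scalar 0
        rwa [map_zero, map_zero, map_zero] at this)
      map_add' := fun x y => huniq ((hf' x).add (hf' y))
      map_mul' := fun x y => huniq ((hf' x).mul (hf' y)) }
  have hbij : Function.Bijective ψ := by
    refine ⟨fun x y h => ?_, fun y => ?_⟩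
    · have h1 := hf' x
      have h2 : R y (f x) := (show f x = f y from h) ▸ hf' y
      exact Subtype.ext (h1.left_unique hQ h2)
    · obtain ⟨x, hx, h⟩ := (key y y.2).2
      exact ⟨⟨x, hx⟩, huniq h⟩
  refine ⟨RingEquiv.ofBijective ψ hbij, fun b hb => ?_, fun b i hi hb => ?_⟩
  · have h1 : ∀ x ∈ Algebra.adjoin (RatFunc K) (leviGenerators K n), R x (bar x) := by
      intro x hx
      induction hx using Algebra.adjoin_induction with
      | mem x hx => exact intertwines_leviGenerators hn hx
      | algebraMap a => rw [bar_algebraMap]; exact Intertwines.scalar a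
      | add x x' _ _ h h' => rw [map_add]; exact h.add h'
      | mul x x' _ _ h h' => rw [map_mul]; exact h.mul h'
    exact (hf' b).right_unique hQ (h1 b hb)
  · exact huniq (hb ▸ intertwines_Bgen hn hs hc hf hl hi)

end BarExistence

/-! ### Weight spaces of modules of type `1` -/

theorem act_eq_sum {K : Type u} [Field K] {n : ℕ} {M : Type u} [AddCommGroup M]
    [Module (Uq K n) M] {Y : Completion K n} {t : Finset (Fin n →₀ ℕ)}
    (ht : ∀ μ ∉ t, ∀ m : M, MvPowerSeries.coeff μ Y • m = 0) (m : M) :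
    act Y m = ∑ μ ∈ t, MvPowerSeries.coeff μ Y • m :=
  finsum_eq_sum_of_support_subset _ fun μ hμ => by
    by_contra h
    exact hμ (ht μ h m)

section Modules

variable {K : Type u} [Field K] {n : ℕ} {M : Type u} [AddCommGroup M] [Module (RatFunc K) M]
  [Module (Uq K n) M] [IsScalarTower (RatFunc K) (Uq K n) M]

/-- The weight space on which `K_i` acts by `q ^ χ i`. -/
def weightSpace (M : Type u) [AddCommGroup M] [Module (RatFunc K) M]
    [Module (Uq K n) M] [IsScalarTower (RatFunc K) (Uq K n) M] (χ : Fin n → ℤ) :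
    Submodule (RatFunc K) M where
  carrier := {m | ∀ i, (Kg i : Uq K n) • m = q K ^ χ i • m}
  add_mem' := fun h h' i => by rw [smul_add, smul_add, h i, h' i]
  zero_mem' := fun i => by rw [smul_zero, smul_zero]
  smul_mem' := fun r m h i => by rw [smul_comm, h i, smul_comm]

theorem iSup_weightSpace (hM : IsTypeOne K n M) : ⨆ χ, weightSpace (K := K) (n := n) M χ = ⊤ := by
  rw [eq_top_iff, ← hM.2, Submodule.span_le]
  rintro m ⟨χ, hm⟩
  exact Submodule.mem_iSup_of_mem χ hm

theorem q_zpow_injective : Function.Injective fun m : ℤ => q K ^ m := fun m m' h => by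
  have h' : q K ^ m = q K ^ m' := h
  have := q_zpow_eq_one (K := K) (m := m - m') (by
    rw [zpow_sub₀ (q_ne K), h', div_self (zpow_ne_zero _ (q_ne K))])
  omega

/-- Weight spaces are joint eigenspaces of the commuting operators `K_i`, and `q` is not a root of
unity. -/
theorem iSupIndep_weightSpace : iSupIndep (weightSpace (K := K) (n := n) M) := by
  let f : Fin n → Module.End (RatFunc K) M := fun i =>
    Algebra.lsmul (RatFunc K) (RatFunc K) M (Kg i : Uq K n)
  have h1 := Module.End.independent_iInf_maxGenEigenspace_of_forall_mapsTo f fun i j φ =>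
    Module.End.mapsTo_maxGenEigenspace_of_comm (by
      change f j * f i = f i * f j
      simp only [f]
      rw [← map_mul, ← map_mul, Uq_relations.KK]) φ
  have h2 := h1.comp (f := fun (χ : Fin n → ℤ) i => q K ^ χ i) fun χ χ' h =>
    funext fun i => q_zpow_injective (congrFun h i)
  refine h2.mono fun χ m hm => ?_
  rw [Function.comp_apply, Submodule.mem_iInf]
  exact fun i => (f i).genEigenspace_le_maximal (q K ^ χ i) 1
    (Module.End.mem_eigenspace_iff.mpr (hm i))

/-- The values `(β, α_i)` by which an element of weight `β` shifts weight spaces. -/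
def shift (β : Fin n → ℤ) : Fin n → ℤ := fun i => form β (alpha i)

theorem shift_add (β β' : Fin n → ℤ) : shift (β + β') = shift β + shift β' :=
  funext fun _ => form_add_left _ _ _

theorem shift_injective : Function.Injective (shift (n := n)) := fun β β' h => by
  rw [← sub_eq_zero]
  refine eq_zero_of_form_alpha fun i => ?_
  rw [form_sub_left, sub_eq_zero]
  exact congrFun h i

theorem HasWeight.smul_mem {x : Uq K n} {β χ : Fin n → ℤ} (hx : HasWeight x β) {m : M}
    (hm : m ∈ weightSpace (K := K) M χ) : x • m ∈ weightSpace (K := K) M (χ + shift β) := by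
  intro i
  have h := hx i
  unfold W at h
  rw [← mul_smul, h, smul_assoc, mul_smul, hm i, smul_comm x, smul_smul, ← zpow_add₀ (q_ne K),
    add_comm]
  rfl

theorem mem_UplusWeight_iff {μ : Fin n →₀ ℕ} {x : Uq K n} : x ∈ UplusWeight K μ ↔
    x ∈ Algebra.adjoin (RatFunc K) (Set.range (E : Fin n → Uq K n)) ∧
      HasWeight x fun j => (μ j : ℤ) := by
  refine and_congr Iff.rfl (forall_congr' fun i => ?_)
  unfold W
  constructor
  · intro h
    rw [← smul_mul_assoc, ← h, mul_assoc, Uq_relations.LK, mul_one]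
  · intro h
    rw [h, smul_mul_assoc, mul_assoc, Uq_relations.KL, mul_one]

/-- Elements vanishing on all weight vectors act by zero. -/
theorem smul_eq_zero_of_weightSpace (hM : IsTypeOne K n M) {x : Uq K n}
    (h : ∀ χ, ∀ m ∈ weightSpace (K := K) (n := n) M χ, x • m = 0) (m : M) : x • m = 0 := by
  have hm : m ∈ ⨆ χ, weightSpace (K := K) (n := n) M χ := by
    rw [iSup_weightSpace hM]; trivial
  induction hm using Submodule.iSup_induction' with
  | mem χ m hm => exact h χ m hm
  | zero => exact smul_zero _
  | add m m' _ _ h1 h2 => rw [smul_add, h1, h2, add_zero]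

/-- The components of an element of the completion act by zero, with finitely many exceptions. -/
theorem exists_finset_of_mem_UplusWeight (hM : IsTypeOne K n M) {Y : Completion K n}
    (hY : ∀ μ, MvPowerSeries.coeff μ Y ∈ UplusWeight K μ) :
    ∃ t : Finset (Fin n →₀ ℕ), ∀ μ ∉ t, ∀ m : M, MvPowerSeries.coeff μ Y • m = 0 := by
  have := hM.1
  have hfin : {χ | weightSpace (K := K) (n := n) M χ ≠ ⊥}.Finite :=
    WellFoundedGT.finite_ne_bot_of_iSupIndep iSupIndep_weightSpace
  have hfin2 := (hfin.image2 (fun χ χ' => χ' - χ) hfin).preimage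
    (f := fun μ : Fin n →₀ ℕ => shift fun j => (μ j : ℤ)) (fun μ _ μ' _ h => by
      ext j
      have := congrFun (shift_injective h) j
      exact_mod_cast this)
  refine ⟨hfin2.toFinset, fun μ hμ => smul_eq_zero_of_weightSpace hM fun χ m hm => ?_⟩
  by_contra h0
  apply hμ
  rw [Set.Finite.mem_toFinset, Set.mem_preimage]
  have h1 := (mem_UplusWeight_iff.mp (hY μ)).2.smul_mem hm
  refine ⟨χ, fun h => h0 ?_, _, fun h => h0 ?_, add_sub_cancel_left _ _⟩
  · rw [h, Submodule.mem_bot] at hm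
    rw [hm, smul_zero]
  · rwa [h, Submodule.mem_bot] at h1

/-- The projection onto a weight space. -/
theorem exists_weight_projection (hM : IsTypeOne K n M) (χ : Fin n → ℤ) :
    ∃ p : M →ₗ[RatFunc K] M, ∀ χ' m, m ∈ weightSpace (K := K) (n := n) M χ' →
      p m = if χ' = χ then m else 0 := by
  have hc : IsCompl (weightSpace (K := K) (n := n) M χ)
      (⨆ χ' ≠ χ, weightSpace (K := K) (n := n) M χ') := by
    refine ⟨iSupIndep_weightSpace χ, codisjoint_iff.mpr ?_⟩
    rw [← iSup_weightSpace hM, ← iSup_split_single]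
  refine ⟨Submodule.projection _ _ hc, fun χ' m hm => ?_⟩
  split_ifs with h
  · subst h
    exact Submodule.projection_apply_of_mem_left hc hm
  · exact Submodule.projection_apply_of_mem_right hc
      (Submodule.mem_iSup_of_mem χ' (Submodule.mem_iSup_of_mem h hm))

end Modules

/-! ### The product of `q`-exponentials in the completion -/

section ProductFormula

variable {K : Type u} [Field K] {n : ℕ}

theorem UplusWeight_zero_mem (μ : Fin n →₀ ℕ) : (0 : Uq K n) ∈ UplusWeight K μ :=
  ⟨zero_mem _, fun i => by simp⟩

theorem UplusWeight_add_mem {μ : Fin n →₀ ℕ} {x y : Uq K n} (hx : x ∈ UplusWeight K μ)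
    (hy : y ∈ UplusWeight K μ) : x + y ∈ UplusWeight K μ :=
  ⟨add_mem hx.1 hy.1, fun i => by rw [mul_add, add_mul, hx.2, hy.2, smul_add]⟩

theorem UplusWeight_mul_mem {μ ν : Fin n →₀ ℕ} {x y : Uq K n} (hx : x ∈ UplusWeight K μ)
    (hy : y ∈ UplusWeight K ν) : x * y ∈ UplusWeight K (μ + ν) := by
  rw [mem_UplusWeight_iff] at *
  refine ⟨mul_mem hx.1 hy.1, ?_⟩
  have h := hx.2.mul hy.2
  convert h using 2
  simp

theorem coeff_mul_mem_UplusWeight {Y Z : Completion K n}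
    (hY : ∀ μ, MvPowerSeries.coeff μ Y ∈ UplusWeight K μ)
    (hZ : ∀ μ, MvPowerSeries.coeff μ Z ∈ UplusWeight K μ) (μ : Fin n →₀ ℕ) :
    MvPowerSeries.coeff μ (Y * Z) ∈ UplusWeight K μ := by
  classical
  rw [MvPowerSeries.coeff_mul]
  refine Finset.sum_induction _ (· ∈ UplusWeight K μ) (fun _ _ => UplusWeight_add_mem)
    (UplusWeight_zero_mem μ) fun p hp => ?_
  rw [← Finset.HasAntidiagonal.mem_antidiagonal.mp hp]
  exact UplusWeight_mul_mem (hY _) (hZ _)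

theorem smul_left_injective_of_ne {γ : Fin n →₀ ℕ} (hγ : γ ≠ 0) :
    Function.Injective fun k : ℕ => k • γ := by
  intro k l h
  obtain ⟨i, hi⟩ := Finsupp.ne_iff.mp hγ
  have := DFunLike.congr_fun h i
  simp only [Finsupp.smul_apply, smul_eq_mul] at this
  exact Nat.eq_of_mul_eq_mul_right (Nat.pos_of_ne_zero hi) this

theorem coeff_qExp {γ : Fin n →₀ ℕ} (hγ : γ ≠ 0) (a : RatFunc K) (u : Uq K n) (k : ℕ) :
    MvPowerSeries.coeff (k • γ) (qExp γ a u) = PowerSeries.coeff k (qExpSeries a u) := by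
  rw [qExpSeries, PowerSeries.coeff_mk]
  change ∑ l ∈ Finset.range ((k • γ).degree + 1), _ = _
  rw [Finset.sum_eq_single k, if_pos rfl]
  · intro l _ hl
    rw [if_neg fun h => hl (smul_left_injective_of_ne hγ h.symm)]
  · intro h
    refine absurd (Finset.mem_range.mpr (Nat.lt_succ_of_le ?_)) h
    have h1 : γ.degree ≠ 0 := fun h => hγ ((Finsupp.degree_eq_zero_iff γ).mp h)
    rw [map_nsmul, smul_eq_mul]
    exact Nat.le_mul_of_pos_right k (Nat.pos_of_ne_zero h1)

theorem coeff_qExp_of_ne {γ : Fin n →₀ ℕ} (a : RatFunc K) (u : Uq K n) {μ : Fin n →₀ ℕ}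
    (hμ : ∀ k : ℕ, μ ≠ k • γ) : MvPowerSeries.coeff μ (qExp γ a u) = 0 := by
  change ∑ l ∈ Finset.range (μ.degree + 1), _ = _
  exact Finset.sum_eq_zero fun k _ => if_neg (hμ k)

theorem coeff_qExp_mem_UplusWeight {γ : Fin n →₀ ℕ} (hγ : γ ≠ 0) (a : RatFunc K) {u : Uq K n}
    (hu : u ∈ UplusWeight K γ) (μ : Fin n →₀ ℕ) :
    MvPowerSeries.coeff μ (qExp γ a u) ∈ UplusWeight K μ := by
  by_cases h : ∃ k : ℕ, μ = k • γ
  · obtain ⟨k, rfl⟩ := h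
    rw [coeff_qExp hγ, qExpSeries, PowerSeries.coeff_mk]
    rw [mem_UplusWeight_iff] at *
    refine ⟨Subalgebra.smul_mem _ (pow_mem hu.1 k) _, ?_⟩
    have h1 := (hu.2.pow k).smul (a ^ k / qFactorial K k)
    convert h1 using 2
    simp
  · push Not at h
    rw [coeff_qExp_of_ne a u h]
    exact UplusWeight_zero_mem μ

theorem coeff_qExp_mul {γ : Fin n →₀ ℕ} (hγ : γ ≠ 0) (a b : RatFunc K) (u v : Uq K n) (k : ℕ) :
    MvPowerSeries.coeff (k • γ) (qExp γ a u * qExp γ b v) =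
      PowerSeries.coeff k (qExpSeries a u * qExpSeries b v) := by
  classical
  rw [MvPowerSeries.coeff_mul, PowerSeries.coeff_mul]
  symm
  refine Finset.sum_of_injOn (fun p => (p.1 • γ, p.2 • γ)) ?_ ?_ ?_ ?_
  · rintro ⟨i, j⟩ _ ⟨i', j'⟩ _ h
    rw [Prod.mk.injEq] at h ⊢
    exact ⟨smul_left_injective_of_ne hγ h.1, smul_left_injective_of_ne hγ h.2⟩
  · rintro ⟨i, j⟩ h
    simp only [Finset.coe_sort_coe, Finset.mem_coe, Finset.HasAntidiagonal.mem_antidiagonal] at h ⊢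
    rw [← add_smul, h]
  · rintro ⟨μ, ν⟩ h h'
    by_cases h1 : ∃ i : ℕ, μ = i • γ
    · by_cases h2 : ∃ j : ℕ, ν = j • γ
      · obtain ⟨i, rfl⟩ := h1
        obtain ⟨j, rfl⟩ := h2
        refine absurd ⟨(i, j), ?_, rfl⟩ h'
        rw [Finset.HasAntidiagonal.mem_antidiagonal] at h
        rw [Finset.mem_coe, Finset.HasAntidiagonal.mem_antidiagonal]
        simp only [← add_smul] at h
        exact smul_left_injective_of_ne hγ h
      · push Not at h2
        rw [coeff_qExp_of_ne b v h2, mul_zero]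
    · push Not at h1
      rw [coeff_qExp_of_ne a u h1, zero_mul]
  · rintro ⟨i, j⟩ _
    rw [coeff_qExp hγ, coeff_qExp hγ]

theorem coeff_qExp_mul_of_ne {γ : Fin n →₀ ℕ} (a b : RatFunc K) (u v : Uq K n)
    {μ : Fin n →₀ ℕ} (hμ : ∀ k : ℕ, μ ≠ k • γ) :
    MvPowerSeries.coeff μ (qExp γ a u * qExp γ b v) = 0 := by
  classical
  rw [MvPowerSeries.coeff_mul]
  refine Finset.sum_eq_zero ?_
  rintro ⟨ν, ν'⟩ h
  by_cases h1 : ∃ i : ℕ, ν = i • γ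
  · obtain ⟨i, rfl⟩ := h1
    rw [coeff_qExp_of_ne b v, mul_zero]
    rintro j rfl
    rw [Finset.HasAntidiagonal.mem_antidiagonal, ← add_smul] at h
    exact hμ _ h.symm
  · push Not at h1
    rw [coeff_qExp_of_ne a u h1, zero_mul]

end ProductFormula

/-! ### Existence of the quasi `K`-matrix -/

section Existence

variable {K : Type u} [Field K] {n : ℕ}

/-- A family supported on the multiples of `γ` acts on a module of type `1` through finitely many
terms. -/
theorem exists_act_eq_sum_range {M : Type u} [AddCommGroup M] [Module (RatFunc K) M]
    [Module (Uq K n) M] [IsScalarTower (RatFunc K) (Uq K n) M] (hM : IsTypeOne K n M)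
    {Y : Completion K n} (hY : ∀ μ, MvPowerSeries.coeff μ Y ∈ UplusWeight K μ)
    {γ : Fin n →₀ ℕ} (hγ : γ ≠ 0) {Q : PowerSeries (Uq K n)}
    (hQ : ∀ k : ℕ, MvPowerSeries.coeff (k • γ) Y = PowerSeries.coeff k Q)
    (h0 : ∀ μ, (∀ k : ℕ, μ ≠ k • γ) → MvPowerSeries.coeff μ Y = 0) :
    ∃ N, ∀ N', N ≤ N' → ∀ m : M,
      act Y m = ∑ k ∈ Finset.range N', PowerSeries.coeff k Q • m := by
  classical
  obtain ⟨t, ht⟩ := exists_finset_of_mem_UplusWeight hM hY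
  refine ⟨t.sup Finsupp.degree + 1, fun N hN m => ?_⟩
  rw [act_eq_sum (t := (Finset.range N).image fun k => k • γ), Finset.sum_image]
  · exact Finset.sum_congr rfl fun k _ => by rw [hQ]
  · exact fun k _ l _ h => smul_left_injective_of_ne hγ h
  · intro μ hμ m
    by_cases h : ∃ k : ℕ, μ = k • γ
    · obtain ⟨k, rfl⟩ := h
      refine ht _ (fun h1 => hμ ?_) m
      refine Finset.mem_image.mpr ⟨k, Finset.mem_range.mpr (lt_of_le_of_lt ?_ hN), rfl⟩
      have h2 : γ.degree ≠ 0 := fun h => hγ ((Finsupp.degree_eq_zero_iff γ).mp h)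
      have h3 := Finset.le_sup (f := Finsupp.degree) h1
      rw [map_nsmul, smul_eq_mul] at h3
      exact (Nat.le_mul_of_pos_right k (Nat.pos_of_ne_zero h2)).trans h3
    · push Not at h
      rw [h0 μ h, zero_smul]

theorem highestRoot_ne_zero (hn : 2 ≤ n) : highestRoot n ≠ 0 := by
  intro h
  have := DFunLike.congr_fun h ⟨0, by omega⟩
  simp [highestRoot] at this

theorem Echain_mem_UplusWeight (hn : 2 ≤ n) (σ : Fin n ≃ Fin n) :
    chain (q K) (natSeq fun i => (E (σ i) : Uq K n)) 0 (n - 1) ∈ UplusWeight K (highestRoot n) := by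
  refine mem_UplusWeight_iff.mpr ⟨chain_mem fun j _ hj => ?_, ?_⟩
  · rw [natSeq_of_lt _ (by omega)]
    exact Algebra.subset_adjoin ⟨_, rfl⟩
  · convert hasWeight_highest (K := K) hn σ using 2
    simp [highestRoot]

variable {s : Fin n → K} {c : Fin n → RatFunc K} {first last : Fin n}

/-- The product of `q`-exponentials is a quasi `K`-matrix: the intertwining relation holds on generators
by comparing coefficients of the power series identities, and it is compatible with sums and
products. -/
theorem isQuasiKMatrix_qExp_mul (hn : 2 ≤ n) (hs : IsSignFunction s) (hc : IsParameter c)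
    (hf : first.val = 0) (hl : last.val + 1 = n) :
    IsQuasiKMatrix s c (qExp (highestRoot n) (Bcoeff s c first) (Echain K n 0 (n - 1)) *
      qExp (highestRoot n) (Bcoeff s c last) (EchainRev K n 0 (n - 1))) := by
  have hγ := highestRoot_ne_zero hn
  have hQ := coeff_qExp_mul hγ (Bcoeff s c first) (Bcoeff s c last) (Echain K n 0 (n - 1))
    (EchainRev K n 0 (n - 1))
  have h0 := fun μ => coeff_qExp_mul_of_ne (γ := highestRoot n) (Bcoeff s c first)
    (Bcoeff s c last) (Echain K n 0 (n - 1)) (EchainRev K n 0 (n - 1)) (μ := μ)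
  have hY := coeff_mul_mem_UplusWeight
    (coeff_qExp_mem_UplusWeight hγ (Bcoeff s c first)
      (Echain_mem_UplusWeight (K := K) hn (Equiv.refl _)))
    (coeff_qExp_mem_UplusWeight hγ (Bcoeff s c last)
      (Echain_mem_UplusWeight (K := K) hn Fin.revPerm))
  change ∀ μ, MvPowerSeries.coeff μ (qExp (highestRoot n) (Bcoeff s c first)
    (Echain K n 0 (n - 1)) * qExp (highestRoot n) (Bcoeff s c last)
      (EchainRev K n 0 (n - 1))) ∈ UplusWeight K μ at hY
  change ∀ k, _ = PowerSeries.coeff k (quasiK s c first last) at hQ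
  generalize qExp (highestRoot n) (Bcoeff s c first) (Echain K n 0 (n - 1)) *
      qExp (highestRoot n) (Bcoeff s c last) (EchainRev K n 0 (n - 1)) = Y at *
  have hF := fun i => C_F_mul (i := i) hn hs hc hf hl
  have hlevi : ∀ x ∈ leviGenerators K n, ∀ k,
      bar x * PowerSeries.coeff k (quasiK s c first last) =
        PowerSeries.coeff k (quasiK s c first last) * bar x := by
    intro x hx k
    obtain ⟨h1, h2⟩ := leviGenerators_commute hn (bar_mem_leviGenerators hx)
    have h3 := congrArg (PowerSeries.coeff k)
      (C_commute_quasiSeries h1 h2 (Bcoeff s c first) (Bcoeff s c last)).eq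
    rwa [PowerSeries.coeff_C_mul, PowerSeries.coeff_mul_C] at h3
  have hconst : PowerSeries.coeff 0 (quasiK s c first last) = 1 := by
    simp [quasiSeries, qExpSeries, qFactorial]
  generalize quasiK s c first last = Q at *
  obtain ⟨ψ, hψ⟩ := exists_isBarInvolution hn hs hc
  refine ⟨?_, hY, ψ, hψ, fun M _ _ _ _ hM b m => ?_⟩
  · have := hQ 0
    rwa [zero_smul, hconst] at this
  obtain ⟨N, hN⟩ := exists_act_eq_sum_range hM hY hγ hQ h0
  have hadd : ∀ m m' : M, act Y (m + m') = act Y m + act Y m' := fun m m' => by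
    simp only [hN N le_rfl, smul_add, Finset.sum_add_distrib]
  have hsmul : ∀ (r : RatFunc K) (m : M), act Y (r • m) = r • act Y m := fun r m => by
    simp only [hN N le_rfl, Finset.smul_sum]
    exact Finset.sum_congr rfl fun k _ => smul_comm _ _ _
  have hneg : ∀ m m' : M, act Y (m - m') = act Y m - act Y m' := fun m m' => by
    simp only [hN N le_rfl, smul_sub, Finset.sum_sub_distrib]
  have key : ∀ (x : Uq K n) (hx : x ∈ Bc s c), ∀ m : M,
      (ψ ⟨x, hx⟩ : Uq K n) • act Y m = act Y (bar x • m) := by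
    intro x hx
    induction hx using Algebra.adjoin_induction with
    | mem x hx' =>
      intro m
      rcases hx' with hx' | ⟨i, hi, rfl⟩
      · rw [hψ.1 _ (Algebra.subset_adjoin hx'), hN N le_rfl, hN N le_rfl, Finset.smul_sum]
        exact Finset.sum_congr rfl fun k _ => by rw [← mul_smul, hlevi x hx', mul_smul]
      · rw [hψ.2 _ i hi rfl]
        have h1 := hF i hi
        have e : Bgen s c i = F i - Bcoeff s c i • (TwX K n (E (Fin.rev i)) * Ki i) := rfl
        simp only [e]
        rw [map_sub, bar_F]
        generalize Bcoeff s c i • (TwX K n (E (Fin.rev i)) * Ki i) = D at *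
        generalize bar D = D' at *
        rw [sub_smul, sub_smul, hneg]
        have h2 : (F i : Uq K n) • act Y m = act Y ((F i : Uq K n) • m) + D • act Y m - act Y (D' • m) := by
          have h3 := hN (N + 1) (by omega)
          have h3' : D • act Y m = D • ∑ k ∈ Finset.range N, PowerSeries.coeff k Q • m := by
            rw [hN N le_rfl]
          rw [h3', hN N le_rfl (D' • m), h3 m, h3 ((F i : Uq K n) • m), Finset.sum_range_succ',
            Finset.sum_range_succ' _ N, smul_add, Finset.smul_sum, Finset.smul_sum]
          have h4 := congrArg (PowerSeries.coeff 0) h1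
          simp only [map_add, map_sub, PowerSeries.coeff_C_mul, PowerSeries.coeff_mul_C,
            PowerSeries.coeff_zero_X_mul, add_zero, sub_zero] at h4
          have h5 : ∀ k, F i * PowerSeries.coeff (k + 1) Q = PowerSeries.coeff (k + 1) Q * F i +
              D * PowerSeries.coeff k Q - PowerSeries.coeff k Q * D' := fun k => by
            have h6 := congrArg (PowerSeries.coeff (k + 1)) h1
            simpa only [map_add, map_sub, PowerSeries.coeff_C_mul, PowerSeries.coeff_mul_C,
              PowerSeries.coeff_succ_X_mul] using h6
          rw [← mul_smul, h4, mul_smul]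
          have h7 : ∑ k ∈ Finset.range N, (F i : Uq K n) • PowerSeries.coeff (k + 1) Q • m =
              ∑ k ∈ Finset.range N, PowerSeries.coeff (k + 1) Q • (F i : Uq K n) • m +
                ∑ k ∈ Finset.range N, D • PowerSeries.coeff k Q • m -
                  ∑ k ∈ Finset.range N, PowerSeries.coeff k Q • D' • m := by
            rw [← Finset.sum_add_distrib, ← Finset.sum_sub_distrib]
            refine Finset.sum_congr rfl fun k _ => ?_
            rw [← mul_smul, h5, sub_smul, add_smul, mul_smul, mul_smul, mul_smul]
          rw [h7]
          abel
        rw [h2]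
        abel
    | algebraMap a =>
      intro m
      rw [hψ.1 _ (Subalgebra.algebraMap_mem _ a), bar_algebraMap, algebraMap_smul, algebraMap_smul,
        hsmul]
    | add x x' hx hx' h h' =>
      intro m
      have e : ψ ⟨x + x', add_mem hx hx'⟩ = ψ ⟨x, hx⟩ + ψ ⟨x', hx'⟩ := map_add ψ ⟨x, hx⟩ ⟨x', hx'⟩
      rw [e, Subalgebra.coe_add, add_smul, h, h', map_add, add_smul, hadd]
    | mul x x' hx hx' h h' =>
      intro m
      have e : ψ ⟨x * x', mul_mem hx hx'⟩ = ψ ⟨x, hx⟩ * ψ ⟨x', hx'⟩ := map_mul ψ ⟨x, hx⟩ ⟨x', hx'⟩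
      rw [e, Subalgebra.coe_mul, mul_smul, h', h, map_mul, mul_smul]
  exact key b b.2 m

end Existence

/-! ### Uniqueness of the quasi `K`-matrix -/

section Uniqueness

variable {K : Type u} [Field K] {n : ℕ} {s : Fin n → K} {c : Fin n → RatFunc K}

/-- The summand of positive degree of `B_i`, extended by zero to the black nodes. -/
noncomputable def positivePart (s : Fin n → K) (c : Fin n → RatFunc K) (i : Fin n) : Uq K n :=
  open Classical in
  if Black i then 0 else Bcoeff s c i • (TwX K n (E (Fin.rev i)) * Ki i)

theorem hasWeight_positivePart (hn : 2 ≤ n) (i : Fin n) :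
    HasWeight (positivePart s c i) ((fun _ => 1) - alpha i) := by
  unfold positivePart
  split_ifs with h
  · intro j
    simp [W]
  · exact (hasWeight_Bgen hn h).smul _

/-- The part of the intertwining relation that determines a quasi `K`-matrix, uniformly in all nodes. -/
theorem IsQuasiKMatrix.F_smul_act {X : Completion K n} (hX : IsQuasiKMatrix s c X) (i : Fin n)
    {M : Type u} [AddCommGroup M] [Module (RatFunc K) M] [Module (Uq K n) M]
    [IsScalarTower (RatFunc K) (Uq K n) M] (hM : IsTypeOne K n M) (m : M) :
    (F i - positivePart s c i) • act X m = act X ((F i - bar (positivePart s c i)) • m) := by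
  obtain ⟨-, -, ψ, hψ, h⟩ := hX
  unfold positivePart
  split_ifs with hi
  · have h1 : (F i : Uq K n) ∈ leviGenerators K n := Or.inl ⟨i, hi, Or.inr (Or.inl rfl)⟩
    have h2 := h M hM ⟨F i, Algebra.subset_adjoin (Or.inl h1)⟩ m
    rw [hψ.1 _ (Algebra.subset_adjoin h1), bar_F] at h2
    rwa [map_zero, sub_zero]
  · have h2 := h M hM ⟨Bgen s c i, Algebra.subset_adjoin (Or.inr ⟨i, hi, rfl⟩)⟩ m
    rw [hψ.2 _ i hi rfl] at h2
    have e : Bgen s c i = F i - Bcoeff s c i • (TwX K n (E (Fin.rev i)) * Ki i) := rfl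
    simp only [e] at h2
    rwa [map_sub, bar_F] at h2

/-- By induction on the height of `μ`, the components of weight `μ` agree: their difference commutes with
every `F_i` on every module. -/
theorem IsQuasiKMatrix.unique (hn : 2 ≤ n) {X Y : Completion K n} (hX : IsQuasiKMatrix s c X)
    (hY : IsQuasiKMatrix s c Y) : X = Y := by
  classical
  have hD : ∀ μ, MvPowerSeries.coeff μ X - MvPowerSeries.coeff μ Y ∈ UplusWeight K μ := fun μ =>
    ⟨sub_mem (hX.2.1 μ).1 (hY.2.1 μ).1, fun i => by
      rw [mul_sub, sub_mul, (hX.2.1 μ).2, (hY.2.1 μ).2, smul_sub]⟩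
  suffices key : ∀ N, ∀ μ : Fin n →₀ ℕ, μ.degree = N →
      MvPowerSeries.coeff μ X - MvPowerSeries.coeff μ Y = 0 by
    ext μ
    exact sub_eq_zero.mp (key _ μ rfl)
  intro N
  induction N using Nat.strong_induction_on with
  | _ N ih =>
    intro μ hμ
    by_cases hμ0 : μ = 0
    · rw [hμ0, hX.1, hY.1, sub_self]
    refine eq_zero_of_mem_UplusWeight hμ0 (hD μ) fun i M _ _ _ _ hM =>
      smul_eq_zero_of_weightSpace hM fun χ m hm => ?_
    obtain ⟨t, ht⟩ := exists_finset_of_mem_UplusWeight hM hX.2.1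
    obtain ⟨t', ht'⟩ := exists_finset_of_mem_UplusWeight hM hY.2.1
    obtain ⟨p, hp⟩ := exists_weight_projection hM (χ + shift (fun j => (μ j : ℤ)) + shift (-alpha i))
    have h1 := hX.F_smul_act i hM m
    have h2 := hY.F_smul_act i hM m
    have hV := hasWeight_positivePart (s := s) (c := c) hn i
    have hV' := hV.bar
    generalize positivePart s c i = V at *
    generalize bar V = V' at *
    let T := insert μ (t ∪ t')
    have hT : ∀ ν ∉ T, ν ∉ t ∧ ν ∉ t' := fun ν hν => by
      simp only [T, Finset.mem_insert, Finset.mem_union, not_or] at hν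
      exact hν.2
    have e1 : ∀ m, act X m = ∑ ν ∈ T, MvPowerSeries.coeff ν X • m :=
      act_eq_sum fun ν hν => ht ν (hT ν hν).1
    have e2 : ∀ m, act Y m = ∑ ν ∈ T, MvPowerSeries.coeff ν Y • m :=
      act_eq_sum fun ν hν => ht' ν (hT ν hν).2
    have h3 : ∑ ν ∈ T, (F i - V) • (MvPowerSeries.coeff ν X - MvPowerSeries.coeff ν Y) • m =
        ∑ ν ∈ T, (MvPowerSeries.coeff ν X - MvPowerSeries.coeff ν Y) • (F i - V') • m := by
      simp only [sub_smul (MvPowerSeries.coeff _ X), smul_sub (F i - V), Finset.sum_sub_distrib]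
      rw [← Finset.smul_sum, ← Finset.smul_sum, ← e1, ← e2, ← e1, ← e2, h1, h2]
    -- compare the components of weight `χ + μ - α_i`; the second summands of the `B_i` contribute
    -- components of the difference of weight `μ - θ`, which vanish by induction
    have hshift : ∀ ν : Fin n →₀ ℕ, shift (fun j => (ν j : ℤ)) = shift (fun j => (μ j : ℤ)) ↔
        ν = μ := fun ν => by
      refine ⟨fun h => ?_, fun h => by rw [h]⟩
      ext j
      exact_mod_cast congrFun (shift_injective h) j
    have hlow : ∀ ν : Fin n →₀ ℕ, shift (fun j => (ν j : ℤ)) + shift ((fun _ => 1) - alpha i) =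
        shift (fun j => (μ j : ℤ)) + shift (-alpha i) →
          MvPowerSeries.coeff ν X - MvPowerSeries.coeff ν Y = 0 := fun ν h => by
      rw [← shift_add, ← shift_add] at h
      have h4 := shift_injective h
      refine ih ν.degree ?_ ν rfl
      have h5 : ∀ j, ν j + 1 = μ j := fun j => by
        have := congrFun h4 j
        simp only [Pi.add_apply, Pi.sub_apply, Pi.neg_apply] at this
        omega
      rw [← hμ, Finsupp.degree_eq_sum, Finsupp.degree_eq_sum]
      exact Finset.sum_lt_sum_of_nonempty ⟨i, Finset.mem_univ i⟩ fun j _ => by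
        rw [← h5]; omega
    have hwt := fun ν => (mem_UplusWeight_iff.mp (hD ν)).2
    generalize hDdef : (fun ν => MvPowerSeries.coeff ν X - MvPowerSeries.coeff ν Y) = D at *
    have hDν : ∀ ν, MvPowerSeries.coeff ν X - MvPowerSeries.coeff ν Y = D ν := fun ν =>
      congrFun hDdef ν
    simp only [hDν] at *
    have h4 := congrArg p h3
    rw [map_sum, map_sum] at h4
    have e3 : ∀ ν, p ((F i - V) • D ν • m) = if ν = μ then F i • D μ • m else 0 := fun ν => by
      rw [sub_smul, map_sub, hp _ _ ((HasWeight.F i).smul_mem ((hwt ν).smul_mem hm)),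
        hp _ _ (hV.smul_mem ((hwt ν).smul_mem hm))]
      have e : (if χ + shift (fun j => (ν j : ℤ)) + shift ((fun _ => 1) - alpha i) =
          χ + shift (fun j => (μ j : ℤ)) + shift (-alpha i) then V • D ν • m else 0) = 0 := by
        split_ifs with h
        · rw [add_assoc, add_assoc, add_left_cancel_iff] at h
          rw [hlow ν h, zero_smul, smul_zero]
        · rfl
      rw [e, sub_zero]
      by_cases h : ν = μ
      · rw [if_pos h, h, if_pos rfl]
      · rw [if_neg h, if_neg (by rwa [add_left_inj, add_right_inj, hshift])]
    have e4 : ∀ ν, p (D ν • (F i - V') • m) = if ν = μ then D μ • F i • m else 0 := fun ν => by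
      rw [sub_smul, smul_sub, map_sub, hp _ _ ((hwt ν).smul_mem ((HasWeight.F i).smul_mem hm)),
        hp _ _ ((hwt ν).smul_mem (hV'.smul_mem hm))]
      have e : (if χ + shift ((fun _ => 1) - alpha i) + shift (fun j => (ν j : ℤ)) =
          χ + shift (fun j => (μ j : ℤ)) + shift (-alpha i) then D ν • V' • m else 0) = 0 := by
        split_ifs with h
        · rw [add_assoc, add_assoc, add_left_cancel_iff, add_comm] at h
          rw [hlow ν h, zero_smul]
        · rfl
      rw [e, sub_zero]
      by_cases h : ν = μ
      · rw [if_pos h, h, if_pos (add_right_comm _ _ _)]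
      · rw [if_neg h, if_neg (by rwa [add_right_comm, add_left_inj, add_right_inj, hshift])]
    simp only [e3, e4, Finset.sum_ite_eq', T, Finset.mem_insert_self, if_true] at h4
    rw [sub_smul, mul_smul, mul_smul, h4, sub_self]

end Uniqueness

end QSP

theorem mainTheorem10 {K : Type*} [Field K] [CharZero K] (n : ℕ) (hn : 2 ≤ n)
    (s : Fin n → K) (hs : IsSignFunction s) (c : Fin n → RatFunc K) (hc : IsParameter c)
    (first last : Fin n) (hfirst : first.val = 0) (hlast : last.val + 1 = n)
    (X : Completion K n) :
    IsQuasiKMatrix s c X ↔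
      X = qExp (highestRoot n) (c first * RatFunc.C (s last)) (T first (TwX K n (E last))) *
        qExp (highestRoot n) (c last * RatFunc.C (s first)) (T last (TwX K n (E first))) := by
  have h := isQuasiKMatrix_qExp_mul hn hs hc hfirst hlast
  rw [Bcoeff, Bcoeff, rev_first hfirst hlast, rev_last hfirst hlast] at h
  rw [T_first_TwX hn hfirst hlast, T_last_TwX hn hfirst hlast]
  exact ⟨fun hX => hX.unique hn h, fun hX => hX ▸ h⟩
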